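/- All graphs are finite, undirected and simple; a graph is $C_5$-free if it does not contain the cycle $C_5$ of length $5$ as a (not necessarily induced) subgraph. Let $\mathrm{ex}_{\mathcal P}(n,C_5)$ denote the maximum number of edges in a $C_5$-free planar graph on $n$ vertices. 1. For every $n\ge 11$, $$\mathrm{ex}_{\mathcal P}(n,C_5)\le \frac{12n-33}{5};$$ that is, every $C_5$-free planar graph $G$ on $n\ge 11$ vertices has at most $(12n-33)/5$ edges. 2. In particular, every $2$-connected $C_5$-free planar graph $G$ with minimum degree $\delta(G)\ge 3$ on $n\ge 11$ vertices has at most $(12n-33)/5$ edges. 3. The bound is sharp: for every integer $t\ge 1$ there is a $2$-connected $C_5$-free planar graph with minimum degree at least $3$ that has $n=15t^2-6$ vertices and exactly $36t^2-21=(12n-33)/5$ edges. -/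

import Mathlib

namespace SimpleGraph

/-- A rotation system on `G`: a permutation `next` of the darts (oriented edges) of `G` whose
cycles are exactly the sets of darts leaving a common vertex, so that `next` lists the darts at
each vertex in a cyclic order.

Rotation systems describe the drawings of `G` on oriented closed surfaces (for each connected
component, its drawings in which every face is a disc): `next` is the counterclockwise order of the
edges around each vertex. -/
structure RotationSystem {V : Type*} (G : SimpleGraph V) where
  /-- The next dart, counterclockwise, around the same starting vertex. -/
  next : Equiv.Perm G.Dart
  /-- `next` does not change the starting vertex. -/
  next_fst : ∀ d, (next d).fst = d.fst
  /-- All darts leaving a vertex form a single cycle of `next`. -/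
  sameCycle_of_fst_eq : ∀ d d' : G.Dart, d.fst = d'.fst → next.SameCycle d d'

namespace RotationSystem

variable {V : Type*} {G : SimpleGraph V}

/-- The permutation of the darts that walks along the boundaries of the faces: traverse a dart,
then leave its end point along the next dart in the cyclic order there. -/
def facePerm (R : RotationSystem G) : Equiv.Perm G.Dart :=
  (Function.Involutive.toPerm Dart.symm Dart.symm_involutive).trans R.next

/-- The faces traced by a rotation system: the cycles of `facePerm`. -/
def Face (R : RotationSystem G) : Type _ := Quotient (Equiv.Perm.SameCycle.setoid R.facePerm)

/-- The number of faces, every connected component being drawn on a surface of its own. A component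
with an edge has the faces traced along its darts; an isolated vertex, which has no darts, lies on a
sphere with one face. -/
noncomputable def faceCount (R : RotationSystem G) : ℕ :=
  Nat.card R.Face + {v : V | ∀ w, ¬ G.Adj v w}.ncard

/-- All components are drawn on spheres, i.e. the total genus is `0`: the Euler characteristics
`v - e + f` of the surfaces of the components, each at most `2`, add up to twice the number of
components. -/
def IsSpherical (R : RotationSystem G) : Prop :=
  Nat.card V + R.faceCount = G.edgeSet.ncard + 2 * Nat.card G.ConnectedComponent

end RotationSystem

/-- A finite graph is planar if it can be drawn on the sphere (equivalently, in the plane) without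
crossings. Drawings are encoded combinatorially, as rotation systems of genus `0`. -/
def IsPlanar {V : Type*} [Finite V] (G : SimpleGraph V) : Prop :=
  ∃ R : RotationSystem G, R.IsSpherical

/-- A graph is 2-connected if it has at least three vertices, is connected, and stays connected
after the deletion of any single vertex. -/
def IsTwoConnected {V : Type*} [Finite V] (G : SimpleGraph V) : Prop :=
  3 ≤ Nat.card V ∧ G.Connected ∧ ∀ v : V, (G.induce {v}ᶜ).Connected

/-- Every vertex has degree at least `k`, i.e. `δ(G) ≥ k`. -/
def MinDegreeAtLeast {V : Type*} [Finite V] (G : SimpleGraph V) (k : ℕ) : Prop :=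
  ∀ v : V, k ≤ (G.neighborSet v).ncard

open scoped Classical in
/-- The planar Turán number: the maximum number of edges of a planar graph on `n` vertices that
does not contain `H` as a (not necessarily induced) subgraph. -/
noncomputable def planarTuranNumber (n : ℕ) {W : Type*} (H : SimpleGraph W) : ℕ :=
  Finset.sup {G : SimpleGraph (Fin n) | G.IsPlanar ∧ H.Free G} (fun G => G.edgeSet.ncard)

end SimpleGraph

/-! Upper bound. Planarity is used in a homological form, `CombMap.Flat`: every circulation on the
darts (antisymmetric across edges, with sum zero at each vertex) is the jump across edges of a
function on the faces. Jumps of face functions are always circulations, and comparing dimensions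
gives V - E + F ≤ 2c, with equality exactly for flat maps; so flatness means genus zero. It passes
directly to submaps (`Flat.restrict`), where Euler's formula would need cases for merging faces and
splitting components. It also yields a discrete Jordan curve theorem: in a flat drawing without cut
vertices no face visits a vertex twice (`IsFlat.eq_of_sameFace`), so faces are bounded by cycles and
none has length 5.

For such a drawing of minimum degree at least 3 on at least 5 vertices (`IsCore`) the bound follows
by discharging. A triangle never borders a 4-face, and three consecutive triangles at a vertex force
degree 3, so that the vertex is the centre of a `K₄` block. An outer vertex of degree three of such
a block can be bypassed by an edge, hence a face of length at least 6 keeps at least 6 other corners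
(`card_special_add`): otherwise bypassing would shorten its boundary to a five-cycle. Corners
receive charges of total at least 132 per face (`face_charge`) and at most 46 deg - 36 per vertex
(`vertex_charge`). Therefore 132 F ≤ 92 E - 36 V, and Euler's formula turns this into 5 E ≤ 12 V -
33 (`IsCore.edge_bound`).

The general case is an induction on m = n - 1, which is additive when graphs are glued at a vertex
(`IsFlat.sparse`). Cut vertices split the graph and vertices of degree at most 2 are deleted. The
linear bound fails for small m, where gluings of `K₄`'s have 2m edges; `Sparse` therefore carries
the bound 2m for m ≤ 10, its strictness when 3 does not divide m, and the short paths present at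
equality. A path of length 3 between any two vertices of an equality graph shows that attaching a
vertex of degree 2 would create a five-cycle.

Construction. Two permutations of order three act on the 9t² points of (ℤ/3t)², and their orbits are
the blocks of two kinds. Each point lies in one block of either kind, and alternating between the
kinds goes around hexagons, except for three digons at the fixed points of the composition. Drawing
a `K₄` in every block gives a map on the sphere (`flat_flag`); deleting the centres of the six
blocks at the digons and one side of each digon leaves a simple graph with 15t² - 6 vertices and
36t² - 21 edges. It has no five-cycle: since five is odd, two successive edges have the same kind
and lie in one block, and the remaining cases are short words in the two rotations
(`no_five_of_consecutive`). -/

namespace CombMap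

/-! ### Linear algebra of combinatorial maps: circulations, face functions, Euler's inequality -/

open Module Equiv

variable {D : Type*}

/-- The functions that are constant along the cycles of a permutation. -/
def invFun (π : Perm D) : Submodule ℚ (D → ℚ) where
  carrier := {x | ∀ d, x (π d) = x d}
  add_mem' hx hy d := by simp [hx d, hy d]
  zero_mem' _ := rfl
  smul_mem' c x hx d := by simp [hx d]

lemma mem_invFun {π : Perm D} {x : D → ℚ} : x ∈ invFun π ↔ ∀ d, x (π d) = x d := Iff.rfl

/-- The number of cycles of a permutation, fixed points included. -/
noncomputable def orbitCount (π : Perm D) : ℕ := Nat.card (Quotient (Perm.SameCycle.setoid π))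

lemma invFun_sameCycle {π : Perm D} {x : D → ℚ} (hx : x ∈ invFun π) {d e : D}
    (h : π.SameCycle d e) : x e = x d := by
  have key : ∀ (n : ℕ) d, x ((π ^ n) d) = x d := by
    intro n
    induction n with
    | zero => simp
    | succ n ih => intro d; rw [pow_succ', Perm.mul_apply, hx, ih]
  obtain ⟨n, rfl⟩ := h
  rcases n with n | n
  · simpa using key n d
  · have := key (n + 1) ((π ^ Int.negSucc n) d)
    rw [← this, ← Perm.mul_apply, zpow_negSucc, mul_inv_cancel, Perm.one_apply]

/-- Invariant functions are functions on the set of cycles. -/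
noncomputable def invFunEquiv (π : Perm D) :
    (Quotient (Perm.SameCycle.setoid π) → ℚ) ≃ₗ[ℚ] invFun π where
  toFun f := ⟨fun d => f (Quotient.mk _ d), fun d => congrArg f
    (Quotient.sound (s := Perm.SameCycle.setoid π) (Perm.SameCycle.symm ⟨1, by simp⟩))⟩
  map_add' _ _ := rfl
  map_smul' _ _ := rfl
  invFun x q := Quotient.lift (s := Perm.SameCycle.setoid π) x.1
    (fun _ _ h => (invFun_sameCycle x.2 h).symm) q
  left_inv f := by
    funext q
    induction q using Quotient.inductionOn with
    | h d => rfl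
  right_inv x := rfl

variable [Fintype D]

lemma finrank_invFun (π : Perm D) : finrank ℚ (invFun π) = orbitCount π := by
  classical
  have : Fintype (Quotient (Perm.SameCycle.setoid π)) := Fintype.ofFinite _
  rw [← (invFunEquiv π).finrank_eq, Module.finrank_fintype_fun_eq_card, orbitCount,
    Nat.card_eq_fintype_card]

/-- The orthogonal complement for the standard bilinear form. -/
def perp (W : Submodule ℚ (D → ℚ)) : Submodule ℚ (D → ℚ) :=
  LinearMap.BilinForm.orthogonal (dotProductBilin ℚ ℚ : LinearMap.BilinForm ℚ (D → ℚ)) W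

lemma mem_perp {W : Submodule ℚ (D → ℚ)} {z : D → ℚ} :
    z ∈ perp W ↔ ∀ u ∈ W, ∑ d, u d * z d = 0 := Iff.rfl

lemma finrank_perp (W : Submodule ℚ (D → ℚ)) :
    finrank ℚ (perp W) + finrank ℚ W = Fintype.card D := by
  classical
  have hnd : (dotProductBilin ℚ ℚ : LinearMap.BilinForm ℚ (D → ℚ)).Nondegenerate := by
    constructor
    · intro x hx
      funext d
      simpa [dotProductBilin] using hx (Pi.single d 1)
    · intro x hx
      funext d
      simpa [dotProductBilin] using hx (Pi.single d 1)
  have := LinearMap.BilinForm.finrank_orthogonal hnd W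
  rw [perp, this, Module.finrank_fintype_fun_eq_card, Nat.sub_add_cancel]
  exact (Submodule.finrank_le W).trans_eq (Module.finrank_fintype_fun_eq_card ℚ)

/-- The map sending a function on the darts to its differences across the edges. -/
def delta (α : Perm D) : (D → ℚ) →ₗ[ℚ] (D → ℚ) :=
  LinearMap.id - LinearMap.funLeft ℚ ℚ α

@[simp] lemma delta_apply (α : Perm D) (x : D → ℚ) (d : D) : delta α x d = x d - x (α d) := rfl

/-- The map with edge involution `α` and vertex rotation `σ` has trivial first homology: every
circulation is the difference function of a function on the faces. -/
def Flat (α σ : Perm D) : Prop :=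
  ∀ z ∈ perp (invFun α ⊔ invFun σ), ∃ x ∈ invFun (α.trans σ), delta α x = z

/-- The face permutation is `α` followed by `σ`, so invariance under it and under `α` gives
invariance under `σ`. This identifies the kernel of `delta` on face functions with the functions on
the components. -/
lemma inf_invFun_face (α σ : Perm D) :
    invFun (α.trans σ) ⊓ LinearMap.ker (delta α) = invFun α ⊓ invFun σ := by
  ext x
  simp only [Submodule.mem_inf, mem_invFun, LinearMap.mem_ker, Equiv.trans_apply]
  constructor
  · rintro ⟨h1, h2⟩
    have h3 : ∀ d, x (α d) = x d := fun d => by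
      have := congrFun h2 d
      simp only [delta_apply, Pi.zero_apply] at this
      linarith
    refine ⟨h3, fun d => ?_⟩
    have := h1 (α.symm d)
    rw [Equiv.apply_symm_apply] at this
    rw [this, ← h3, Equiv.apply_symm_apply]
  · rintro ⟨h1, h2⟩
    refine ⟨fun d => by rw [h2, h1], ?_⟩
    funext d
    simp [h1 d]

lemma finrank_map_delta (α σ : Perm D) :
    finrank ℚ ((invFun (α.trans σ)).map (delta α)) + finrank ℚ ↥(invFun α ⊓ invFun σ) =
      orbitCount (α.trans σ) := by
  have h := LinearMap.finrank_range_add_finrank_ker ((delta α).domRestrict (invFun (α.trans σ)))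
  rw [LinearMap.range_domRestrict, finrank_invFun] at h
  rw [← h, ← inf_invFun_face, LinearMap.ker_domRestrict]
  congr 1
  rw [inf_comm]
  have : Submodule.map (invFun (α.trans σ)).subtype
      (Submodule.comap (invFun (α.trans σ)).subtype (LinearMap.ker (delta α))) =
      LinearMap.ker (delta α) ⊓ invFun (α.trans σ) := by
    rw [Submodule.map_comap_subtype, inf_comm]
  rw [← this]
  exact Submodule.finrank_map_subtype_eq (R := ℚ) (invFun (α.trans σ)) _

/-- Jumps of face functions are circulations. Pairing with an edge function vanishes after
reindexing by `α`; pairing with a vertex function vanishes after reindexing by `σ`, because a face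
function takes equal values at `σ d` and `α d`. -/
lemma map_delta_le (α σ : Perm D) (hα : ∀ d, α (α d) = d) :
    (invFun (α.trans σ)).map (delta α) ≤ perp (invFun α ⊔ invFun σ) := by
  rintro _ ⟨x, hx, rfl⟩
  rw [mem_perp]
  intro u hu
  obtain ⟨v, hv, w, hw, rfl⟩ := Submodule.mem_sup.mp hu
  have hv' : ∑ d, v d * x (α d) = ∑ d, v d * x d := by
    rw [← Equiv.sum_comp α (fun d => v d * x d)]
    exact Finset.sum_congr rfl fun d _ => by rw [hv d]
  have hw' : ∑ d, w d * x (α d) = ∑ d, w d * x d := by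
    rw [← Equiv.sum_comp σ (fun d => w d * x d)]
    refine Finset.sum_congr rfl fun d _ => ?_
    have := hx (α d)
    rw [Equiv.trans_apply, hα] at this
    rw [hw d, this]
  simp only [Pi.add_apply, delta_apply, mul_sub, add_mul, Finset.sum_sub_distrib,
    Finset.sum_add_distrib, hv', hw', sub_self]

lemma finrank_circulations (α σ : Perm D) :
    finrank ℚ (perp (invFun α ⊔ invFun σ)) + orbitCount α + orbitCount σ =
      Fintype.card D + finrank ℚ ↥(invFun α ⊓ invFun σ) := by
  have h1 := finrank_perp (invFun α ⊔ invFun σ)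
  have h2 := Submodule.finrank_sup_add_finrank_inf_eq (invFun α) (invFun σ)
  rw [finrank_invFun, finrank_invFun] at h2
  omega

/-- Lower bounds on the numbers of faces, edges and vertices suffice: the hypothesis says that face
jumps have at least the dimension of the circulations containing them. -/
lemma flat_of_le (α σ : Perm D) (hα : ∀ d, α (α d) = d)
    (h : Fintype.card D + 2 * finrank ℚ ↥(invFun α ⊓ invFun σ) ≤
      orbitCount (α.trans σ) + orbitCount α + orbitCount σ) : Flat α σ := by
  intro z hz
  have h1 := finrank_map_delta α σ
  have h2 := finrank_circulations α σ
  have := Submodule.eq_of_le_of_finrank_le (map_delta_le α σ hα) (by omega)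
  rw [← this] at hz
  exact hz

lemma Flat.euler {α σ : Perm D} (hα : ∀ d, α (α d) = d) (h : Flat α σ) :
    orbitCount (α.trans σ) + orbitCount α + orbitCount σ =
      Fintype.card D + 2 * finrank ℚ ↥(invFun α ⊓ invFun σ) := by
  have h1 := finrank_map_delta α σ
  have h2 := finrank_circulations α σ
  have : (invFun (α.trans σ)).map (delta α) = perp (invFun α ⊔ invFun σ) :=
    le_antisymm (map_delta_le α σ hα) fun z hz => h z hz
  rw [this] at h1
  omega

/-- If the only functions constant on edges and vertices are the constant ones, the map has a
single component. -/
lemma finrank_inf_eq_one [Nonempty D] (α σ : Perm D)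
    (h : ∀ x ∈ invFun α ⊓ invFun σ, ∀ d e, x d = x e) :
    finrank ℚ ↥(invFun α ⊓ invFun σ) = 1 := by
  have d₀ : D := Classical.arbitrary D
  refine finrank_eq_one (⟨fun _ => 1, fun _ => rfl, fun _ => rfl⟩ : ↥(invFun α ⊓ invFun σ)) ?_ ?_
  · intro hc
    have := congrFun (congrArg Subtype.val hc) d₀
    simp at this
  · rintro ⟨x, hx⟩
    refine ⟨x d₀, Subtype.ext (funext fun d => ?_)⟩
    simp [h x hx d₀ d]

lemma orbitCount_involutive {α : Perm D} (hα : ∀ d, α (α d) = d) (hf : ∀ d, α d ≠ d) :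
    2 * orbitCount α = Fintype.card D := by
  classical
  have : Fintype (Quotient (Perm.SameCycle.setoid α)) := Fintype.ofFinite _
  have : DecidableEq (Quotient (Perm.SameCycle.setoid α)) := Classical.decEq _
  rw [orbitCount, Nat.card_eq_fintype_card, ← Finset.card_univ (α := D),
    Finset.card_eq_sum_card_fiberwise (f := fun d => (Quotient.mk (Perm.SameCycle.setoid α) d))
      (t := Finset.univ) (fun _ _ => Finset.mem_coe.mpr (Finset.mem_univ _)),
    Finset.sum_const_nat (m := 2), Finset.card_univ, mul_comm]
  intro q _
  induction q using Quotient.inductionOn with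
  | h d =>
    rw [Finset.card_eq_two]
    refine ⟨d, α d, (hf d).symm, ?_⟩
    ext e
    simp only [Finset.mem_filter, Finset.mem_univ, true_and, Finset.mem_insert,
      Finset.mem_singleton]
    rw [Quotient.eq]
    constructor
    · intro h
      obtain ⟨n, hn⟩ := Perm.SameCycle.symm h
      have h2 : α ^ 2 = 1 := by
        ext x
        simp [pow_two, hα]
      rcases Int.even_or_odd' n with ⟨k, rfl | rfl⟩
      · left
        rw [zpow_mul, zpow_ofNat, h2, one_zpow] at hn
        exact hn.symm
      · right
        rw [zpow_add, zpow_mul, zpow_ofNat, h2, one_zpow, one_mul, zpow_one] at hn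
        exact hn.symm
    · rintro (rfl | rfl)
      · exact Perm.SameCycle.refl _ _
      · exact Perm.SameCycle.symm ⟨1, by simp⟩

end CombMap

/-! ### Deleting darts from a map -/

namespace CombMap

open Module Equiv

/-- The first return map of a permutation to the range of an injection. -/
lemma exists_firstReturn {D D' : Type*} [Finite D] (π : Perm D) {ι : D' → D}
    (hι : Function.Injective ι) :
    ∃ π' : Perm D',
      (∀ (u : D → ℚ), (∀ d, d ∉ Set.range ι → u (π d) = u d) →
        ∀ d, u (ι (π' d)) = u (π (ι d))) ∧
      (∀ d e, π.SameCycle (ι d) (ι e) → π'.SameCycle d e) ∧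
      (∀ d, π.SameCycle (ι d) (ι (π' d))) := by
  classical
  have : Finite D' := Finite.of_injective ι hι
  have hex : ∀ d : D', ∃ k, (π ^ (k + 1)) (ι d) ∈ Set.range ι := by
    intro d
    -- The exponent `k + 1` keeps the return time positive; the order of `π` shows that a return
    -- happens.
    refine ⟨orderOf π - 1, d, ?_⟩
    rw [Nat.sub_add_cancel (orderOf_pos π), pow_orderOf_eq_one, Perm.one_apply]
  let k : D' → ℕ := fun d => Nat.find (hex d)
  have hk : ∀ d, (π ^ (k d + 1)) (ι d) ∈ Set.range ι := fun d => Nat.find_spec (hex d)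
  have hmin : ∀ d j, j < k d → (π ^ (j + 1)) (ι d) ∉ Set.range ι :=
    fun d j hj => Nat.find_min (hex d) hj
  choose f hf using hk
  have hinj : Function.Injective f := by
    have main : ∀ d e, k d ≤ k e → f d = f e → d = e := by
      intro d e hle heq
      have h1 : (π ^ (k d + 1)) (ι d) = (π ^ (k e + 1)) (ι e) := by rw [← hf, ← hf, heq]
      have h2 : (π ^ (k e - k d)) (ι e) = ι d := by
        apply (π ^ (k d + 1)).injective
        rw [h1, ← Perm.mul_apply, ← pow_add]
        congr 2
        omega
      rcases Nat.eq_or_lt_of_le hle with h | h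
      · rw [h, Nat.sub_self, pow_zero, Perm.one_apply] at h2
        exact (hι h2).symm
      -- Equal arrival points with different return times would make the orbit of `ι e` pass through
      -- `ι d` before its first return.
      · exact absurd ⟨d, by rw [← h2]; congr 2; omega⟩ (hmin e (k e - k d - 1) (by omega))
    intro d e heq
    rcases le_total (k d) (k e) with h | h
    · exact main d e h heq
    · exact (main e d h heq.symm).symm
  have hbij : Function.Bijective f := Finite.injective_iff_bijective.mp hinj
  refine ⟨Equiv.ofBijective f hbij, ?_, ?_, ?_⟩
  · intro u hu d
    rw [Equiv.ofBijective_apply, hf]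
    have : ∀ j, j ≤ k d → u ((π ^ (j + 1)) (ι d)) = u (π (ι d)) := by
      intro j
      induction j with
      | zero => simp
      | succ j ih =>
        intro hj
        rw [pow_succ', Perm.mul_apply, hu _ (hmin d j (by omega)), ih (by omega)]
    exact this _ le_rfl
  · have main : ∀ n d e, (π ^ n) (ι d) = ι e → Perm.SameCycle (Equiv.ofBijective f hbij) d e := by
      intro n
      induction n using Nat.strong_induction_on with
      | h n ih =>
        intro d e hde
        rcases Nat.eq_zero_or_pos n with rfl | hn
        · rw [pow_zero, Perm.one_apply] at hde
          rw [hι hde]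
        · have hkn : k d + 1 ≤ n := by
            by_contra hlt
            exact hmin d (n - 1) (by omega) ⟨e, by rw [Nat.sub_add_cancel hn, hde]⟩
          have h1 : (π ^ (n - (k d + 1))) (ι (f d)) = ι e := by
            rw [hf, ← Perm.mul_apply, ← pow_add, Nat.sub_add_cancel hkn, hde]
          have h2 := ih _ (by omega) _ _ h1
          exact Perm.SameCycle.trans ⟨1, by rw [zpow_one, Equiv.ofBijective_apply]⟩ h2
    have := Fintype.ofFinite D
    intro d e h
    obtain ⟨n, -, -, hn⟩ := h.exists_pow_eq
    exact main n d e hn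
  · intro d
    rw [Equiv.ofBijective_apply, hf]
    exact ⟨(k d + 1 : ℕ), by rw [zpow_natCast]⟩

/-- Extend a circulation of the submap by zero and take a face function for it on the big map. It
does not jump across deleted edges, so it is constant on the faces that merge and restricts to a
face function of the submap. -/
lemma Flat.restrict {D D' : Type*} [Fintype D] [Fintype D'] {α σ : Perm D} (h : Flat α σ)
    (hα : ∀ d, α (α d) = d) {ι : D' → D} (hι : Function.Injective ι) {α' σ' : Perm D'}
    (hα' : ∀ d, ι (α' d) = α (ι d))
    (hσ' : ∀ (u : D → ℚ), (∀ d, d ∉ Set.range ι → u (σ d) = u d) →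
        ∀ d, u (ι (σ' d)) = u (σ (ι d))) : Flat α' σ' := by
  classical
  intro z' hz'
  have hsum : ∀ u : D → ℚ, ∑ d, u d * Function.extend ι z' 0 d = ∑ d, u (ι d) * z' d := by
    intro u
    rw [← Finset.sum_subset (Finset.subset_univ (Finset.univ.image ι)),
      Finset.sum_image (fun a _ b _ hab => hι hab)]
    · exact Finset.sum_congr rfl fun d _ => by rw [hι.extend_apply]
    · intro d _ hd
      rw [Function.extend_apply', Pi.zero_apply, mul_zero]
      rintro ⟨e, rfl⟩
      exact hd (Finset.mem_image_of_mem _ (Finset.mem_univ _))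
  have hz : Function.extend ι z' 0 ∈ perp (invFun α ⊔ invFun σ) := by
    rw [mem_perp]
    intro u hu
    obtain ⟨v, hv, w, hw, rfl⟩ := Submodule.mem_sup.mp hu
    rw [hsum]
    refine mem_perp.mp hz' (fun d => (v + w) (ι d)) ?_
    refine Submodule.mem_sup.mpr ⟨fun d => v (ι d), fun d => ?_, fun d => w (ι d), fun d => ?_, rfl⟩
    · change v (ι (α' d)) = v (ι d)
      rw [hα', hv]
    · change w (ι (σ' d)) = w (ι d)
      rw [hσ' w (fun d _ => hw d), hw]
  obtain ⟨x, hx, hxz⟩ := h _ hz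
  -- Without a jump at `d`, face invariance at `α d` becomes invariance under `σ`, which is what the
  -- first return map needs in order to skip deleted darts.
  have hoff : ∀ d, d ∉ Set.range ι → x (σ d) = x d := by
    intro d hd
    have h1 := congrFun hxz d
    rw [delta_apply, Function.extend_apply' _ _ _ hd, Pi.zero_apply] at h1
    have h2 := hx (α d)
    rw [Equiv.trans_apply, hα] at h2
    linarith
  refine ⟨fun d => x (ι d), fun d => ?_, funext fun d => ?_⟩
  · change x (ι (σ' (α' d))) = x (ι d)
    rw [hσ' x hoff, hα']
    exact hx (ι d)
  · have := congrFun hxz (ι d)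
    rw [delta_apply, hι.extend_apply] at this
    rw [delta_apply, hα', this]

end CombMap

/-! ### Planar graphs and flat rotation systems -/

namespace SimpleGraph

namespace RotationSystem

open CombMap

variable {V : Type*} {G : SimpleGraph V}

/-- The involution of the darts that reverses them. -/
def flip (G : SimpleGraph V) : Equiv.Perm G.Dart :=
  Function.Involutive.toPerm Dart.symm Dart.symm_involutive

lemma flip_flip (d : G.Dart) : flip G (flip G d) = d := Dart.symm_symm d

lemma facePerm_eq (R : RotationSystem G) : R.facePerm = (flip G).trans R.next := rfl

lemma facePerm_apply (R : RotationSystem G) (d : G.Dart) : R.facePerm d = R.next d.symm := rfl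

lemma orbitCount_facePerm (R : RotationSystem G) : orbitCount R.facePerm = Nat.card R.Face := rfl

lemma sameCycle_next_iff (R : RotationSystem G) {d d' : G.Dart} :
    R.next.SameCycle d d' ↔ d.fst = d'.fst := by
  refine ⟨?_, R.sameCycle_of_fst_eq d d'⟩
  have h1 : ∀ (n : ℕ) d, ((R.next ^ n) d).fst = d.fst := by
    intro n
    induction n with
    | zero => simp
    | succ n ih => intro d; rw [pow_succ', Equiv.Perm.mul_apply, R.next_fst, ih]
  rintro ⟨n, rfl⟩
  rcases n with n | n
  · simpa using (h1 n d).symm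
  · have := h1 (n + 1) ((R.next ^ Int.negSucc n) d)
    rw [← this, ← Equiv.Perm.mul_apply, zpow_negSucc, mul_inv_cancel, Equiv.Perm.one_apply]

/-- A rotation system without homology. -/
def IsFlat [Fintype G.Dart] (R : RotationSystem G) : Prop := Flat (flip G) R.next

/-- A graph whose darts embed in a flat map, compatibly with edges and vertices, has a flat
rotation system. -/
lemma exists_isFlat_of_embedding [Fintype G.Dart] {D : Type*} [Fintype D]
    {α σ : Equiv.Perm D} (h : Flat α σ) (hα : ∀ d, α (α d) = d) (ι : G.Dart → D)
    (hι : Function.Injective ι) (hsymm : ∀ d, ι d.symm = α (ι d))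
    (hfst : ∀ d e, σ.SameCycle (ι d) (ι e) ↔ d.fst = e.fst) :
    ∃ R : RotationSystem G, R.IsFlat := by
  obtain ⟨π', h1, h2, h3⟩ := exists_firstReturn σ hι
  exact ⟨⟨π', fun d => ((hfst _ _).mp (h3 d)).symm, fun d d' hd => h2 _ _ ((hfst _ _).mpr hd)⟩,
    h.restrict hα hι hsymm h1⟩

lemma IsFlat.of_le [Fintype G.Dart] {H : SimpleGraph V} [Fintype H.Dart] (hle : H ≤ G)
    {R : RotationSystem G} (hR : R.IsFlat) : ∃ R' : RotationSystem H, R'.IsFlat := by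
  refine exists_isFlat_of_embedding hR flip_flip (fun d => ⟨d.toProd, hle d.adj⟩) ?_ ?_ ?_
  · intro d e h
    ext1
    exact congrArg (fun a : G.Dart => a.toProd) h
  · intro d
    rfl
  · intro d e
    exact R.sameCycle_next_iff

end RotationSystem

end SimpleGraph

namespace SimpleGraph

namespace RotationSystem

open CombMap Module

variable {V : Type*} {G : SimpleGraph V}

lemma invFun_next_eq (R : RotationSystem G) {x : G.Dart → ℚ} (hx : x ∈ invFun R.next)
    {d e : G.Dart} (h : d.fst = e.fst) : x d = x e :=
  (invFun_sameCycle hx (R.sameCycle_next_iff.mpr h)).symm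

lemma eq_of_reachable (R : RotationSystem G) {x : G.Dart → ℚ}
    (hx : x ∈ invFun (flip G) ⊓ invFun R.next) {d e : G.Dart} (h : G.Reachable d.fst e.fst) :
    x d = x e := by
  have key : ∀ {u w : V} (_ : G.Walk u w) (d e : G.Dart), d.fst = u → e.fst = w → x d = x e := by
    intro u w p
    induction p with
    | nil => intro d e hd he; exact R.invFun_next_eq hx.2 (hd.trans he.symm)
    | @cons u v w hadj p ih =>
      intro d e hd he
      rw [R.invFun_next_eq (e := ⟨(u, v), hadj⟩) hx.2 hd, ← hx.1 ⟨(u, v), hadj⟩]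
      exact ih _ e rfl he
  obtain ⟨p⟩ := h
  exact key p d e rfl rfl

variable [Fintype V] [Fintype G.Dart]

lemma orbitCount_next (R : RotationSystem G) :
    orbitCount R.next + {v : V | ∀ w, ¬ G.Adj v w}.ncard = Nat.card V := by
  classical
  have e : Quotient (Equiv.Perm.SameCycle.setoid R.next) ≃ ({v : V | ∀ w, ¬ G.Adj v w}ᶜ : Set V) := by
    refine Equiv.ofBijective (Quotient.lift (fun d : G.Dart =>
      (⟨d.fst, fun h => h _ d.adj⟩ : ({v : V | ∀ w, ¬ G.Adj v w}ᶜ : Set V)))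
      fun d d' h => Subtype.ext (R.sameCycle_next_iff.mp h)) ⟨?_, ?_⟩
    · intro a b
      refine Quotient.inductionOn₂ a b fun d d' h => ?_
      exact Quotient.sound (R.sameCycle_next_iff.mpr (congrArg Subtype.val h))
    · rintro ⟨v, hv⟩
      simp only [Set.mem_compl_iff, Set.mem_ofPred_eq, not_forall, not_not] at hv
      obtain ⟨w, hw⟩ := hv
      exact ⟨Quotient.mk _ ⟨(v, w), hw⟩, rfl⟩
  rw [orbitCount, Nat.card_congr e, Nat.card_coe_set_eq, add_comm, Set.ncard_add_ncard_compl]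

lemma card_dart : Fintype.card G.Dart = 2 * G.edgeSet.ncard := by
  classical
  have h := G.dart_card_eq_twice_card_edges
  rw [← Set.ncard_coe_finset, coe_edgeFinset] at h
  convert h

lemma orbitCount_flip : orbitCount (flip G) = G.edgeSet.ncard := by
  have := orbitCount_involutive (α := flip G) flip_flip fun d => d.symm_ne
  rw [card_dart] at this
  omega

/-- A function constant on edges and vertices is determined by its values on the components that
have an edge; each isolated vertex is a further component. -/
lemma finrank_inf_add_le (R : RotationSystem G) :
    finrank ℚ ↥(invFun (flip G) ⊓ invFun R.next) + {v : V | ∀ w, ¬ G.Adj v w}.ncard ≤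
      Nat.card G.ConnectedComponent := by
  classical
  let S : Set G.ConnectedComponent := Set.range fun d : G.Dart => G.connectedComponentMk d.fst
  have : Fintype S := Fintype.ofFinite _
  have h1 : finrank ℚ ↥(invFun (flip G) ⊓ invFun R.next) ≤ S.ncard := by
    let Ψ : (S → ℚ) →ₗ[ℚ] (G.Dart → ℚ) :=
      LinearMap.funLeft ℚ ℚ fun d => (⟨G.connectedComponentMk d.fst, ⟨d, rfl⟩⟩ : S)
    have hle : invFun (flip G) ⊓ invFun R.next ≤ LinearMap.range Ψ := by
      intro x hx
      refine ⟨fun C => x C.2.choose, funext fun d => ?_⟩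
      have hs := (⟨G.connectedComponentMk d.fst, ⟨d, rfl⟩⟩ : S).2.choose_spec
      exact R.eq_of_reachable hx (ConnectedComponent.exact hs)
    refine (Submodule.finrank_mono hle).trans ((LinearMap.finrank_range_le Ψ).trans ?_)
    rw [Module.finrank_fintype_fun_eq_card, ← Nat.card_eq_fintype_card, Nat.card_coe_set_eq]
  have h2 : {v : V | ∀ w, ¬ G.Adj v w}.ncard =
      (G.connectedComponentMk '' {v : V | ∀ w, ¬ G.Adj v w}).ncard := by
    refine (Set.InjOn.ncard_image ?_).symm
    intro v hv w _ hvw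
    obtain ⟨p⟩ := ConnectedComponent.exact hvw
    cases p with
    | nil => rfl
    | cons h p => exact absurd h (hv _)
  have h3 : Disjoint S (G.connectedComponentMk '' {v : V | ∀ w, ¬ G.Adj v w}) := by
    rw [Set.disjoint_left]
    rintro _ ⟨d, rfl⟩ ⟨v, hv, hvd⟩
    obtain ⟨p⟩ := ConnectedComponent.exact hvd
    cases p with
    | nil => exact hv _ d.adj
    | cons h p => exact hv _ h
  rw [h2]
  have h4 := Set.ncard_union_eq h3
  have h5 := Set.ncard_le_ncard (Set.subset_univ
    (S ∪ G.connectedComponentMk '' {v : V | ∀ w, ¬ G.Adj v w}))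
  rw [Set.ncard_univ] at h5
  omega

/-- Isolated vertices carry no darts; they are counted once as vertices and once as faces, which
cancels the 2 that each contributes as a component. -/
lemma IsSpherical.isFlat {R : RotationSystem G} (h : R.IsSpherical) : R.IsFlat := by
  refine flat_of_le _ _ flip_flip ?_
  have h1 := R.finrank_inf_add_le
  have h2 := R.orbitCount_next
  unfold IsSpherical faceCount at h
  rw [← facePerm_eq, orbitCount_facePerm, orbitCount_flip, card_dart]
  omega

lemma IsFlat.euler {R : RotationSystem G} (h : R.IsFlat) [Nonempty G.Dart]
    (hc : ∀ x ∈ invFun (flip G) ⊓ invFun R.next, ∀ d e, x d = x e) :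
    Nat.card R.Face + Nat.card V = G.edgeSet.ncard + {v : V | ∀ w, ¬ G.Adj v w}.ncard + 2 := by
  have h1 := Flat.euler flip_flip h
  have h2 := R.orbitCount_next
  rw [← facePerm_eq, orbitCount_facePerm, orbitCount_flip, card_dart,
    finrank_inf_eq_one _ _ hc] at h1
  omega

lemma IsFlat.isSpherical {R : RotationSystem G} (h : R.IsFlat) [Nonempty G.Dart]
    (hc : G.Connected) : R.IsSpherical := by
  have h1 := h.euler fun x hx d e => R.eq_of_reachable hx (hc.preconnected _ _)
  have h2 : Nat.card G.ConnectedComponent = 1 := by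
    have := hc.preconnected.subsingleton_connectedComponent
    have := hc.nonempty
    rw [Nat.card_eq_one_iff_unique]
    exact ⟨inferInstance, inferInstance⟩
  have h3 : {v : V | ∀ w, ¬ G.Adj v w} = ∅ := by
    rw [Set.eq_empty_iff_forall_notMem]
    intro v hv
    obtain ⟨d⟩ := ‹Nonempty G.Dart›
    obtain ⟨p⟩ := hc.preconnected v d.fst
    cases p with
    | nil => exact hv _ d.adj
    | cons h p => exact hv _ h
  unfold IsSpherical faceCount
  rw [h3, Set.ncard_empty] at h1
  rw [h3, Set.ncard_empty]
  omega

end RotationSystem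

/-- The graph has a rotation system without homology. -/
def IsFlat {V : Type*} (G : SimpleGraph V) : Prop :=
  ∃ (_ : Fintype G.Dart) (R : RotationSystem G), R.IsFlat

lemma IsPlanar.isFlat {V : Type*} [Finite V] {G : SimpleGraph V} (h : G.IsPlanar) : G.IsFlat := by
  classical
  have := Fintype.ofFinite V
  obtain ⟨R, hR⟩ := h
  exact ⟨inferInstance, R, hR.isFlat⟩

lemma IsFlat.mono {V : Type*} [Finite V] {G H : SimpleGraph V} (hle : H ≤ G) (h : G.IsFlat) :
    H.IsFlat := by
  classical
  have := Fintype.ofFinite V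
  obtain ⟨_, R, hR⟩ := h
  exact ⟨inferInstance, hR.of_le hle⟩

end SimpleGraph

/-! ### A discrete Jordan curve theorem: faces visit no vertex twice -/

namespace CombMap

open Module

lemma perp_perp {D : Type*} [Fintype D] (W : Submodule ℚ (D → ℚ)) : perp (perp W) = W := by
  have hle : W ≤ perp (perp W) := by
    intro u hu
    rw [mem_perp]
    intro z hz
    rw [← mem_perp.mp hz u hu]
    exact Finset.sum_congr rfl fun d _ => mul_comm _ _
  have h1 := finrank_perp W
  have h2 := finrank_perp (perp W)
  exact (Submodule.eq_of_le_of_finrank_le hle (by omega)).symm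

end CombMap

namespace SimpleGraph

/-- No vertex separates two vertices of positive degree. -/
def Unsplittable {V : Type*} (G : SimpleGraph V) : Prop :=
  ∀ (z : V) (A : Set V), z ∉ A → (∃ d : G.Dart, d.fst ∈ A) →
    (∃ d : G.Dart, d.fst ∉ A ∧ d.fst ≠ z) → ∃ d : G.Dart, d.fst ∈ A ∧ d.snd ∉ A ∧ d.snd ≠ z

/-- No five distinct vertices are the consecutive vertices of a cycle. -/
def NoFiveCycle {V : Type*} (G : SimpleGraph V) : Prop :=
  ∀ a b c d e : V, G.Adj a b → G.Adj b c → G.Adj c d → G.Adj d e → G.Adj e a →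
    a ≠ c → a ≠ d → b ≠ d → b ≠ e → c ≠ e → False

namespace RotationSystem

open CombMap

variable {V : Type*} {G : SimpleGraph V}

lemma facePerm_fst (R : RotationSystem G) (d : G.Dart) : (R.facePerm d).fst = d.snd := by
  rw [facePerm_apply, R.next_fst]
  rfl

lemma facePerm_symm (R : RotationSystem G) (d : G.Dart) : R.facePerm d.symm = R.next d := by
  rw [facePerm_apply, Dart.symm_symm]

lemma next_pow_fst (R : RotationSystem G) (d : G.Dart) (n : ℕ) :
    ((R.next ^ n) d).fst = d.fst :=
  (R.sameCycle_next_iff.mp ⟨n, by rw [zpow_natCast]⟩).symm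

lemma dart_ext {d e : G.Dart} (h1 : d.fst = e.fst) (h2 : d.snd = e.snd) : d = e :=
  Dart.ext _ _ (Prod.ext h1 h2)

variable [Fintype G.Dart]

/-- In a flat drawing of a graph without cut vertices, faces visit no vertex twice. -/
lemma IsFlat.eq_of_sameFace {R : RotationSystem G} (hR : R.IsFlat) (hG : G.Unsplittable)
    {d d' : G.Dart} (hface : R.facePerm.SameCycle d d') (hfst : d.fst = d'.fst) : d = d' := by
  classical
  by_contra hne
  have hex : ∃ n, (R.next ^ n) d = d' := by
    obtain ⟨n, -, -, hn⟩ := (R.sameCycle_of_fst_eq d d' hfst).exists_pow_eq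
    exact ⟨n, hn⟩
  set n := Nat.find hex with hn
  have hnd : (R.next ^ n) d = d' := Nat.find_spec hex
  have hmin : ∀ i < n, (R.next ^ i) d ≠ d' := fun i hi => Nat.find_min hex hi
  have hn0 : 0 < n := by
    rcases Nat.eq_zero_or_pos n with h | h
    · rw [h, pow_zero, Equiv.Perm.one_apply] at hnd
      exact absurd hnd hne
    · exact h
  have hinj : ∀ i j, i < j → j < n → (R.next ^ i) d ≠ (R.next ^ j) d := by
    intro i j hij hj h
    apply hmin (n - j + i) (by omega)
    rw [pow_add, Equiv.Perm.mul_apply, h, ← Equiv.Perm.mul_apply, ← pow_add,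
      Nat.sub_add_cancel hj.le, hnd]
  -- The sector at the vertex from `d` up to, but excluding, `d'`. A closed curve inside the face
  -- through both corners would cut exactly these darts off.
  set A : Finset G.Dart := (Finset.range n).image fun i => (R.next ^ i) d with hA
  have hdA : d ∈ A := Finset.mem_image.mpr ⟨0, Finset.mem_range.mpr hn0, by simp⟩
  have hd'A : d' ∉ A := by
    intro h
    obtain ⟨i, hi, h⟩ := Finset.mem_image.mp h
    exact hmin i (Finset.mem_range.mp hi) h
  have hAfst : ∀ e ∈ A, e.fst = d.fst := by
    intro e he
    obtain ⟨i, -, rfl⟩ := Finset.mem_image.mp he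
    exact R.next_pow_fst d i
  set l : G.Dart → ℚ := fun e => if e ∈ A then 1 else 0 with hl
  -- The flow of any circulation through the sector telescopes to the difference of a face function
  -- between the corners of `d` and `d'`, which is zero because they share the face.
  have hmem : l ∈ perp (perp (invFun (flip G) ⊔ invFun R.next)) := by
    rw [mem_perp]
    intro z hz
    obtain ⟨x, hx, rfl⟩ := hR z hz
    have hx' : ∀ e : G.Dart, x (flip G e) = x (R.next e) := by
      intro e
      have := hx (flip G e)
      rw [Equiv.trans_apply, flip_flip] at this
      exact this.symm
    have hs : ∀ m, ∑ i ∈ Finset.range m, (delta (flip G) x) ((R.next ^ i) d) =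
        x d - x ((R.next ^ m) d) := by
      intro m
      induction m with
      | zero => simp
      | succ m ih =>
        rw [Finset.sum_range_succ, ih, delta_apply, hx', pow_succ', Equiv.Perm.mul_apply]
        ring
    have : ∑ e, delta (flip G) x e * l e = ∑ e ∈ A, delta (flip G) x e := by
      rw [hl]
      simp [Finset.sum_ite_mem]
    rw [this, hA, Finset.sum_image, hs, hnd, invFun_sameCycle hx hface, sub_self]
    intro i hi j hj hij
    rw [Finset.coe_range, Set.mem_Iio] at hi hj
    by_contra hc
    rcases Nat.lt_or_gt_of_ne hc with h | h
    · exact hinj i j h hj hij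
    · exact hinj j i h hi hij.symm
  rw [perp_perp] at hmem
  -- The edge part `s` drops out of differences across edges. So the vertex function `w` falls by 1
  -- along the darts of the sector and is constant along every edge that avoids the vertex.
  obtain ⟨s, hs, w, hw, hsw⟩ := Submodule.mem_sup.mp hmem
  have hdiff : ∀ e : G.Dart, l e - l e.symm = w e - w e.symm := by
    intro e
    have h1 : s e.symm = s e := hs e
    rw [← hsw]
    simp only [Pi.add_apply, h1]
    ring
  have hl0 : ∀ e : G.Dart, e.fst ≠ d.fst → l e = 0 := fun e he => by
    rw [hl]
    exact if_neg fun h => he (hAfst e h)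
  -- The level set of `w` one below its value at the vertex contains the end of `d` and misses the
  -- end of `d'`; no edge that avoids the vertex leaves it, so the vertex would be a cut vertex.
  obtain ⟨e, ⟨he1, g, hg1, hg2⟩, he3, he4⟩ := hG d.fst
    {p | p ≠ d.fst ∧ ∃ e : G.Dart, e.fst = p ∧ w e = w d - 1} (fun h => h.1 rfl)
    ⟨d.symm, d.adj.ne', d.symm, rfl, by
      have h1 := hdiff d
      have h2 : l d = 1 := if_pos hdA
      rw [h2, hl0 d.symm d.adj.ne'] at h1
      linarith⟩
    ⟨d'.symm, by
      rintro ⟨-, e, he, hwe⟩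
      have h1 := hdiff d'
      have h2 : l d' = 0 := if_neg hd'A
      rw [h2, hl0 d'.symm (by rw [hfst]; exact d'.adj.ne'), ← R.invFun_next_eq hw hfst,
        ← R.invFun_next_eq hw he, hwe] at h1
      linarith, by rw [hfst]; exact d'.adj.ne'⟩
  apply he3
  refine ⟨he4, e.symm, rfl, ?_⟩
  have h1 := hdiff e
  rw [hl0 e he1, hl0 e.symm he4, ← R.invFun_next_eq hw hg1, hg2] at h1
  linarith

/-- The edges of the graph lie in one component, so that Euler's formula applies with c = 1.
Otherwise a level set of `x`, with the cut at an end of an edge of that level, contradicts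
unsplittability. -/
lemma Unsplittable.const (R : RotationSystem G) (hG : G.Unsplittable) :
    ∀ x ∈ invFun (flip G) ⊓ invFun R.next, ∀ d e, x d = x e := by
  intro x hx d e
  by_contra hne
  obtain ⟨g, ⟨⟨g', hg'1, hg'2⟩, -⟩, hg2, hg3⟩ := hG d.snd
    {p | (∃ g : G.Dart, g.fst = p ∧ x g = x d) ∧ p ≠ d.snd} (fun h => h.2 rfl)
    ⟨d, ⟨d, rfl, rfl⟩, d.adj.ne⟩
    ⟨e, by
      rintro ⟨⟨g, hg, hgx⟩, -⟩
      exact hne (hgx.symm.trans (R.invFun_next_eq hx.2 hg)), by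
      intro h
      apply hne
      rw [← hx.1 d]
      exact R.invFun_next_eq hx.2 h.symm⟩
  apply hg2
  refine ⟨⟨g.symm, rfl, ?_⟩, hg3⟩
  have h1 : x g.symm = x g := hx.1 g
  rw [h1, ← hg'2, R.invFun_next_eq hx.2 hg'1]

end RotationSystem

end SimpleGraph

/-! ### Face lengths, triangular faces and `K₄` blocks -/

namespace SimpleGraph

namespace RotationSystem

open CombMap

variable {V : Type*} {G : SimpleGraph V}

/-- The length of the face to the left of a dart. -/
noncomputable def faceLength (R : RotationSystem G) (d : G.Dart) : ℕ :=
  Function.minimalPeriod R.facePerm d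

/-- The face of the dart is a triangle. -/
def Tri (R : RotationSystem G) (d : G.Dart) : Prop := R.faceLength d = 3

/-- Both faces at the edge of the dart are triangles. -/
def Inner (R : RotationSystem G) (d : G.Dart) : Prop := R.Tri d ∧ R.Tri d.symm

/-- A drawing to which the discharging argument applies. -/
structure IsCore [Fintype G.Dart] (R : RotationSystem G) : Prop where
  isFlat : R.IsFlat
  unsplittable : G.Unsplittable
  next_ne : ∀ d, R.next d ≠ d
  next_next_ne : ∀ d, R.next (R.next d) ≠ d
  noFiveCycle : G.NoFiveCycle
  five_le : 5 ≤ {v : V | ∃ w, G.Adj v w}.ncard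

lemma faceLength_facePerm [Finite G.Dart] (R : RotationSystem G) (d : G.Dart) :
    R.faceLength (R.facePerm d) = R.faceLength d :=
  Function.minimalPeriod_apply (Function.Injective.mem_periodicPts R.facePerm.injective d)

lemma faceLength_pos [Finite G.Dart] (R : RotationSystem G) (d : G.Dart) :
    0 < R.faceLength d :=
  Function.minimalPeriod_pos_of_mem_periodicPts
    (Function.Injective.mem_periodicPts R.facePerm.injective d)

lemma sameFace_iterate (R : RotationSystem G) (d : G.Dart) (i j : ℕ) :
    R.facePerm.SameCycle (R.facePerm^[i] d) (R.facePerm^[j] d) := by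
  rw [← Equiv.Perm.coe_pow, ← Equiv.Perm.coe_pow]
  exact (Equiv.Perm.sameCycle_pow_left.mpr (Equiv.Perm.sameCycle_pow_right.mpr
    (Equiv.Perm.SameCycle.refl _ _)))

lemma iterate_eq_iff [Finite G.Dart] (R : RotationSystem G) (d : G.Dart) {i j : ℕ}
    (hi : i < R.faceLength d) (hj : j < R.faceLength d) :
    R.facePerm^[i] d = R.facePerm^[j] d ↔ i = j :=
  Function.iterate_eq_iterate_iff_of_lt_minimalPeriod hi hj

lemma iterate_faceLength (R : RotationSystem G) (d : G.Dart) :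
    R.facePerm^[R.faceLength d] d = d :=
  Function.isPeriodicPt_minimalPeriod _ _

lemma iterate_fst_ne [Fintype G.Dart] {R : RotationSystem G} (hR : R.IsCore) (d : G.Dart)
    {i j : ℕ} (hi : i < R.faceLength d) (hj : j < R.faceLength d) (hij : i ≠ j) :
    (R.facePerm^[i] d).fst ≠ (R.facePerm^[j] d).fst := fun h =>
  hij ((R.iterate_eq_iff d hi hj).mp
    (hR.isFlat.eq_of_sameFace hR.unsplittable (R.sameFace_iterate d i j) h))

lemma adj_iterate (R : RotationSystem G) (d : G.Dart) (i : ℕ) :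
    G.Adj (R.facePerm^[i] d).fst (R.facePerm^[i + 1] d).fst := by
  rw [Function.iterate_succ_apply', facePerm_fst]
  exact (R.facePerm^[i] d).adj

namespace IsCore

variable [Fintype G.Dart] {R : RotationSystem G}

lemma three_le_faceLength (hR : R.IsCore) (d : G.Dart) : 3 ≤ R.faceLength d := by
  have h0 := R.faceLength_pos d
  have hp := R.iterate_faceLength d
  by_contra h
  have : R.faceLength d = 1 ∨ R.faceLength d = 2 := by omega
  rcases this with h1 | h1 <;> rw [h1] at hp
  · have := R.facePerm_fst d
    rw [Function.iterate_one] at hp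
    rw [hp] at this
    exact d.adj.ne this
  · have e1 : R.facePerm (R.facePerm d) = d := hp
    have h2 := R.facePerm_fst (R.facePerm d)
    rw [e1] at h2
    have h3 : R.facePerm d = d.symm := dart_ext (R.facePerm_fst d) h2.symm
    rw [facePerm_apply] at h3
    exact hR.next_ne _ h3

lemma faceLength_ne_five (hR : R.IsCore) (d : G.Dart) : R.faceLength d ≠ 5 := by
  intro h
  have hne : ∀ i j, i < 5 → j < 5 → i ≠ j →
      (R.facePerm^[i] d).fst ≠ (R.facePerm^[j] d).fst := fun i j hi hj hij =>
    iterate_fst_ne hR d (by omega) (by omega) hij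
  have h5 := R.adj_iterate d 4
  have hp := R.iterate_faceLength d
  rw [h] at hp
  rw [show 4 + 1 = 5 from rfl, hp] at h5
  exact hR.noFiveCycle _ _ _ _ _ (R.adj_iterate d 0) (R.adj_iterate d 1) (R.adj_iterate d 2)
    (R.adj_iterate d 3) h5 (hne 0 2 (by omega) (by omega) (by omega))
    (hne 0 3 (by omega) (by omega) (by omega)) (hne 1 3 (by omega) (by omega) (by omega))
    (hne 1 4 (by omega) (by omega) (by omega)) (hne 2 4 (by omega) (by omega) (by omega))

end IsCore

variable [Fintype G.Dart] {R : RotationSystem G}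

lemma tri_facePerm {d : G.Dart} : R.Tri (R.facePerm d) ↔ R.Tri d := by
  rw [Tri, Tri, faceLength_facePerm]

lemma tri_next {d : G.Dart} : R.Tri (R.next d) ↔ R.Tri d.symm := by
  rw [← facePerm_symm, tri_facePerm]

/-- The face of `d` fills the corner before `d` in the rotation and the face of `next d` the corner
after it. Inner edges can thus be read off from the corners at their starting vertex. -/
lemma inner_iff {d : G.Dart} : R.Inner d ↔ R.Tri d ∧ R.Tri (R.next d) := by
  rw [Inner, tri_next]

lemma inner_symm {d : G.Dart} : R.Inner d.symm ↔ R.Inner d := by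
  rw [Inner, Inner, Dart.symm_symm, and_comm]

lemma Tri.facePerm_three {d : G.Dart} (h : R.Tri d) :
    R.facePerm (R.facePerm (R.facePerm d)) = d := by
  have := R.iterate_faceLength d
  rw [h] at this
  exact this

/-- The dart before `d` around its starting vertex. -/
lemma Tri.next_symm {d : G.Dart} (h : R.Tri d) :
    R.next (R.facePerm (R.facePerm d)).symm = d := by
  rw [← facePerm_apply, h.facePerm_three]

lemma Tri.facePerm_facePerm {d : G.Dart} (h : R.Tri (R.next d)) :
    R.facePerm (R.facePerm (R.next d)) = d.symm := by
  have := R.next.injective h.next_symm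
  exact (Dart.symm_symm _).symm.trans (congrArg Dart.symm this)

lemma Tri.facePerm_snd {d : G.Dart} (h : R.Tri (R.next d)) :
    (R.facePerm (R.next d)).snd = d.snd := by
  rw [← facePerm_fst, h.facePerm_facePerm]
  rfl

lemma Tri.adj {d : G.Dart} (h : R.Tri (R.next d)) : G.Adj (R.next d).snd d.snd := by
  have := (R.facePerm (R.next d)).adj
  rwa [h.facePerm_snd, facePerm_fst] at this

namespace IsCore

/-- Three consecutive triangles at a vertex are all the faces there. -/
lemma next_three (hR : R.IsCore) {d : G.Dart} (h1 : R.Tri d) (h2 : R.Tri (R.next d))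
    (h3 : R.Tri (R.next (R.next d))) : R.next (R.next (R.next d)) = d := by
  by_contra hne
  obtain ⟨e, he⟩ : ∃ e, R.next e = d := ⟨_, h1.next_symm⟩
  have hfst : ∀ g, (R.next g).fst = g.fst := R.next_fst
  have hs : ∀ {a b : G.Dart}, a.fst = b.fst → a ≠ b → a.snd ≠ b.snd := fun h1 h2 h3 =>
    h2 (dart_ext h1 h3)
  have f1 : e.fst = d.fst := by rw [← he, hfst]
  have f2 := hfst d
  have f3 := (hfst (R.next d)).trans f2
  have a1 : G.Adj d.snd e.snd := by
    have : R.Tri (R.next e) := by rwa [he]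
    have := this.adj
    rwa [he] at this
  have hd1 := hR.next_ne d
  have hd2 := hR.next_next_ne d
  have hd3 := hR.next_ne (R.next d)
  -- The triangles join four successive neighbours into a path; if these are distinct, the path
  -- closes through the vertex itself to a five-cycle.
  refine hR.noFiveCycle d.fst e.snd d.snd (R.next d).snd (R.next (R.next d)).snd ?_ a1.symm
    h2.adj.symm h3.adj.symm ?_ d.adj.ne ?_ ?_ ?_ ?_
  · rw [← f1]; exact e.adj
  · rw [← f3]; exact (R.next (R.next d)).adj.symm
  · rw [← f2]; exact (R.next d).adj.ne
  · refine hs (f1.trans f2.symm) ?_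
    rintro rfl
    exact hd2 he
  · refine hs (f1.trans f3.symm) ?_
    rintro rfl
    exact hne he
  · exact hs f3.symm hd2.symm

/-- The face on the other side of an edge of a triangle is a triangle or long. -/
lemma six_le (hR : R.IsCore) {d : G.Dart} (h1 : R.Tri d) (h2 : ¬ R.Tri d.symm) :
    6 ≤ R.faceLength d.symm := by
  have h3 := hR.three_le_faceLength d.symm
  have h5 := hR.faceLength_ne_five d.symm
  have h3' : R.faceLength d.symm ≠ 3 := h2
  by_contra hlt
  have h4 : R.faceLength d.symm = 4 := by omega
  have hne : ∀ i j, i < 4 → j < 4 → i ≠ j →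
      (R.facePerm^[i] d.symm).fst ≠ (R.facePerm^[j] d.symm).fst := fun i j hi hj hij =>
    iterate_fst_ne hR _ (by omega) (by omega) hij
  have hp := R.iterate_faceLength d.symm
  rw [h4] at hp
  have a0 := R.adj_iterate d.symm 0
  have a1 := R.adj_iterate d.symm 1
  have a2 := R.adj_iterate d.symm 2
  have a3 := R.adj_iterate d.symm 3
  rw [show 3 + 1 = 4 from rfl, hp] at a3
  simp only [zero_add] at a0 a1 a2
  have n02 := hne 0 2 (by omega) (by omega) (by omega)
  have n13 := hne 1 3 (by omega) (by omega) (by omega)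
  have q1 : R.facePerm^[1] d.symm = R.next d := by
    rw [Function.iterate_one, facePerm_symm]
  have q0 : R.facePerm^[0] d.symm = d.symm := rfl
  have ht := h1.facePerm_three
  have hprev := h1.next_symm
  have hx : (R.facePerm d).snd = (R.facePerm (R.facePerm d)).fst := (R.facePerm_fst _).symm
  have hy : (R.facePerm (R.facePerm d)).snd = d.fst := by
    rw [← facePerm_fst, ht]
  have hdd : d.symm.fst = d.snd := rfl
  rw [q0, hdd] at a0 n02
  rw [hdd] at a3
  have qf : (R.facePerm^[1] d.symm).fst = d.fst := by rw [q1, R.next_fst]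
  rw [qf] at a0 a1 n13
  -- the third vertex of the triangle is on the quadrilateral only if some degree is two
  by_cases hxp : (R.facePerm d).snd = (R.facePerm^[2] d.symm).fst
  · have h6 : R.next d = (R.facePerm (R.facePerm d)).symm := by
      refine dart_ext ?_ ?_
      · rw [R.next_fst]; exact hy.symm
      · rw [← facePerm_fst, ← q1, ← Function.iterate_succ_apply' R.facePerm, ← hxp]
        exact hx
    have h7 := hR.next_next_ne d
    rw [h6, hprev] at h7
    exact h7 rfl
  by_cases hxq : (R.facePerm d).snd = (R.facePerm^[3] d.symm).fst
  · have h8 : (R.facePerm^[3] d.symm).symm = R.facePerm d := by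
      refine dart_ext ?_ ?_
      · change (R.facePerm^[3] d.symm).snd = _
        rw [← facePerm_fst, ← Function.iterate_succ_apply' R.facePerm, hp, facePerm_fst]
        rfl
      · exact hxq.symm
    have h9 : R.next (R.next d.symm) = d.symm := by
      rw [← facePerm_apply, ← h8, ← facePerm_apply, ← Function.iterate_succ_apply' R.facePerm, hp]
    exact hR.next_next_ne _ h9
  · have b1 : G.Adj d.fst (R.facePerm d).snd := by
      have := (R.facePerm (R.facePerm d)).adj
      rw [hy, ← hx] at this
      exact this.symm
    have b2 : G.Adj (R.facePerm d).snd d.snd := by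
      have := (R.facePerm d).adj
      rw [facePerm_fst] at this
      exact this.symm
    exact hR.noFiveCycle d.fst (R.facePerm d).snd d.snd (R.facePerm^[3] d.symm).fst
      (R.facePerm^[2] d.symm).fst b1 b2 a3.symm a2.symm a1.symm d.adj.ne n13 hxq hxp n02

/-- Consecutive inner edges of a triangle meet in a vertex of degree three. -/
lemma center (hR : R.IsCore) {e : G.Dart} (h1 : R.Inner e) (h2 : R.Inner (R.facePerm e)) :
    R.next (R.next (R.facePerm e)) = e.symm ∧ R.Tri e.symm ∧ R.Tri (R.facePerm e) ∧
      R.Tri (R.next (R.facePerm e)) ∧ (R.next (R.facePerm e)).snd = (R.next e).snd := by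
  -- The two inner edges meet at the end of `e`, where they give three consecutive triangular
  -- corners.
  have t1 : R.Tri e.symm := h1.2
  have t2 : R.Tri (R.next e.symm) := by rw [← facePerm_apply]; exact h2.1
  have t3 : R.Tri (R.next (R.next e.symm)) := by
    rw [← facePerm_apply]; exact (inner_iff.mp h2).2
  have h3 := hR.next_three t1 t2 t3
  rw [← facePerm_apply] at h3 t2 t3
  refine ⟨h3, t1, t2, t3, ?_⟩
  have h4 : R.next (R.next (R.facePerm e)) = R.next (R.facePerm (R.facePerm e.symm)).symm := by
    rw [h3, t1.next_symm]
  rw [R.next.injective h4]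
  change (R.facePerm (R.facePerm e.symm)).fst = _
  rw [facePerm_fst, facePerm_symm]

end IsCore

/-- All darts at a vertex of degree three. -/
lemma eq_of_next_three {d e : G.Dart} (h : R.next (R.next (R.next d)) = d) (he : e.fst = d.fst) :
    e = d ∨ e = R.next d ∨ e = R.next (R.next d) := by
  classical
  obtain ⟨n, -, -, rfl⟩ := (R.sameCycle_of_fst_eq d e he.symm).exists_pow_eq
  clear he
  induction n with
  | zero => exact Or.inl rfl
  | succ n ih =>
    rw [pow_succ', Equiv.Perm.mul_apply]
    rcases ih with h' | h' | h' <;> rw [h']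
    · exact Or.inr (Or.inl rfl)
    · exact Or.inr (Or.inr rfl)
    · exact Or.inl h

lemma IsCore.tri_of_center (hR : R.IsCore) {e g : G.Dart} (h1 : R.Inner e)
    (h2 : R.Inner (R.facePerm e)) (hg : g.fst = e.snd) : R.Tri g := by
  obtain ⟨c1, c2, c3, c4, -⟩ := hR.center h1 h2
  rcases eq_of_next_three (d := e.symm) (by rw [← facePerm_apply, c1]) (e := g) hg with
    rfl | rfl | rfl
  · exact c2
  · rwa [← facePerm_apply]
  · rwa [← facePerm_apply]

lemma IsCore.snd_of_center (hR : R.IsCore) {e g : G.Dart} (h1 : R.Inner e)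
    (h2 : R.Inner (R.facePerm e)) (hg : g.fst = e.snd) :
    g.snd = e.fst ∨ g.snd = (R.facePerm e).snd ∨ g.snd = (R.next e).snd := by
  obtain ⟨c1, -, -, -, c5⟩ := hR.center h1 h2
  rcases eq_of_next_three (d := e.symm) (by rw [← facePerm_apply, c1]) (e := g) hg with
    rfl | rfl | rfl
  · exact Or.inl rfl
  · exact Or.inr (Or.inl (by rw [← facePerm_apply]))
  · rw [← facePerm_apply, c5]; exact Or.inr (Or.inr rfl)

/-- No triangle has three inner edges. -/
lemma IsCore.not_inner_three (hR : R.IsCore) {e : G.Dart} (h1 : R.Inner e)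
    (h2 : R.Inner (R.facePerm e)) (h3 : R.Inner (R.facePerm (R.facePerm e))) : False := by
  have ht := h1.1.facePerm_three
  have c2 := (hR.center h1 h2).2.2.2.2
  have c3 := (hR.center h2 h3).2.2.2.2
  have h1' : R.Inner (R.facePerm (R.facePerm (R.facePerm e))) := by rwa [ht]
  have s2 := fun g => hR.snd_of_center (g := g) h1 h2
  have s3 := fun g => hR.snd_of_center (g := g) h2 h3
  have s1 := fun g => hR.snd_of_center (g := g) h3 h1'
  rw [c3, c2] at s1
  rw [c2] at s3
  rw [ht] at s1
  have f1 : (R.facePerm (R.facePerm e)).snd = e.fst := by rw [← facePerm_fst, ht]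
  simp only [facePerm_fst, f1] at s1 s2 s3
  set A : Set V := {e.fst, e.snd, (R.facePerm e).snd} with hA
  have hx : (R.next e).snd ∉ A := by
    rintro (h | h | h)
    · rw [← R.next_fst e] at h
      exact (R.next e).adj.ne' h
    · exact hR.next_ne e (dart_ext (R.next_fst e) h)
    · exact hR.next_ne (R.facePerm e) (dart_ext (R.next_fst _) (c2.trans h))
  -- All three corners of the triangle have degree three and the same third neighbour. A fifth
  -- vertex of positive degree makes this neighbour a cut vertex.
  have hcard : ¬ {v : V | ∃ w, G.Adj v w} ⊆ insert (R.next e).snd A := by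
    classical
    intro hsub
    have hfin : (insert (R.next e).snd A).Finite := by simp [hA]
    have h5 := Set.ncard_le_ncard hsub hfin
    have h6 : (insert (R.next e).snd A).ncard ≤ 4 := by
      refine (Set.ncard_insert_le _ _).trans (Nat.succ_le_succ ?_)
      refine (Set.ncard_insert_le _ _).trans (Nat.succ_le_succ ?_)
      refine (Set.ncard_insert_le _ _).trans (Nat.succ_le_succ ?_)
      rw [Set.ncard_singleton]
    have := hR.five_le
    omega
  rw [Set.not_subset] at hcard
  obtain ⟨v, ⟨w, hvw⟩, hv⟩ := hcard
  rw [Set.mem_insert_iff, not_or] at hv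
  obtain ⟨g, hg1, hg2, hg3⟩ := hR.unsplittable (R.next e).snd A hx ⟨e, Or.inl rfl⟩
    ⟨⟨(v, w), hvw⟩, hv.2, hv.1⟩
  simp only [hA, Set.mem_insert_iff, Set.mem_singleton_iff, not_or] at hg1 hg2
  rcases hg1 with h | h | h
  · have := s1 g h
    tauto
  · have := s2 g h
    tauto
  · have := s3 g h
    tauto

end RotationSystem

end SimpleGraph

/-! ### Long faces: bypassing the outer vertices of `K₄` blocks -/

namespace SimpleGraph

/-- The list of the vertices of a cycle. -/
def IsCyc {V : Type*} (G : SimpleGraph V) (l : List V) : Prop :=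
  l.Nodup ∧ ∀ v ∈ l.head?, (l ++ [v]).IsChain G.Adj

section Cyc

variable {V : Type*} {G : SimpleGraph V}

lemma IsCyc.rotate {s t : List V} {v : V} (h : G.IsCyc (s ++ v :: t)) :
    G.IsCyc (v :: t ++ s) := by
  refine ⟨(List.perm_append_comm.nodup_iff).mp h.1, ?_⟩
  rintro _ ⟨⟩
  cases s with
  | nil => simpa using h.2 v (by simp)
  | cons u s =>
    have h2 : ((u :: s) ++ v :: (t ++ [u])).IsChain G.Adj := by simpa using h.2 u (by simp)
    have h3 : ((v :: t) ++ u :: (s ++ [v])).IsChain G.Adj :=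
      List.isChain_split.mpr (List.isChain_split.mp h2).symm
    simpa using h3

lemma NoFiveCycle.length_ne (hG : G.NoFiveCycle) {l : List V} (h : G.IsCyc l) : l.length ≠ 5 := by
  intro h5
  match l, h, h5 with
  | [a, b, c, d, e], h, _ =>
    have h1 := h.1
    have h2 := h.2 a rfl
    simp only [List.nodup_cons, List.mem_cons, List.not_mem_nil, or_false, not_or,
      List.cons_append, List.nil_append, List.isChain_cons_cons, List.isChain_singleton,
      and_true] at h1 h2
    obtain ⟨⟨-, hac, had, -⟩, ⟨-, hbd, hbe⟩, ⟨-, hce⟩, -⟩ := h1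
    obtain ⟨e1, e2, e3, e4, e5⟩ := h2
    exact hG a b c d e e1 e2 e3 e4 e5 hac had hbd hbe hce

open Classical in
/-- A cycle through vertices that can be bypassed can be shortened to length five. -/
lemma NoFiveCycle.countP_add_lt (hG : G.NoFiveCycle) (C S : V → Prop)
    (hS : ∀ v, S v → ∀ a b, G.Adj v a → G.Adj v b → a ≠ b → ¬ C a → ¬ C b → G.Adj a b)
    (k : ℕ) : ∀ l : List V, G.IsCyc l → (∀ v ∈ l, ¬ C v) → l.length = k → 5 ≤ k →
      l.countP (fun v => decide (S v)) + 5 < k := by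
  induction k with
  | zero => intro l _ _ _ h; omega
  | succ k ih =>
    intro l hl hC hlen hk
    rcases Nat.lt_or_ge 4 k with h4 | h4
    · by_cases hex : ∃ v ∈ l, S v
      · obtain ⟨v, hv, hSv⟩ := hex
        obtain ⟨s, t, rfl⟩ := List.append_of_mem hv
        have hrot : G.IsCyc (v :: (t ++ s)) := hl.rotate
        have hperm : (v :: (t ++ s)).Perm (s ++ v :: t) :=
          List.perm_append_comm (l₁ := v :: t)
        rw [← hperm.countP_eq]
        have hC' : ∀ w ∈ v :: (t ++ s), ¬ C w := fun w hw => hC w (hperm.mem_iff.mp hw)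
        rw [← hperm.length_eq] at hlen
        generalize t ++ s = m at hrot hC' hlen ⊢
        obtain ⟨b, m', rfl⟩ : ∃ b m', m = b :: m' := by
          cases m with
          | nil => rw [List.length_cons] at hlen; simp at hlen; omega
          | cons b m' => exact ⟨b, m', rfl⟩
        obtain ⟨m'', a, rfl⟩ : ∃ m'' a, m' = m'' ++ [a] := by
          rcases List.eq_nil_or_concat m' with rfl | ⟨x, y, rfl⟩
          · rw [List.length_cons] at hlen; simp at hlen; omega
          · exact ⟨x, y, List.concat_eq_append⟩
        have hch := hrot.2 v rfl
        have hnd := hrot.1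
        rw [List.cons_append, List.cons_append, List.isChain_cons_cons] at hch
        obtain ⟨hvb, hch⟩ := hch
        have hch' : ((b :: m'') ++ a :: [v]).IsChain G.Adj := by simpa using hch
        obtain ⟨hbm, hav⟩ := List.isChain_split.mp hch'
        rw [List.isChain_cons_cons] at hav
        have hab : a ≠ b := by
          rintro rfl
          simp at hnd
        -- The neighbours of `v` on the cycle are joined by an edge that replaces the path through
        -- `v`: the length and the count of `S` vertices drop by at most one each, the length by
        -- exactly one.
        have hba : G.Adj a b := hS v hSv a b hav.1.symm hvb hab (hC' a (by simp)) (hC' b (by simp))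
        have hnew : G.IsCyc (b :: (m'' ++ [a])) := by
          refine ⟨(List.nodup_cons.mp hnd).2, ?_⟩
          rintro _ ⟨⟩
          have : ((b :: m'') ++ a :: [b]).IsChain G.Adj :=
            List.isChain_split.mpr ⟨hbm, by simp [hba]⟩
          simpa using this
        have := ih _ hnew (fun w hw => hC' w (List.mem_cons_of_mem _ hw)) (by simpa using hlen)
          (by omega)
        rw [List.countP_cons]
        split_ifs <;> omega
      · push Not at hex
        have : l.countP (fun v => decide (S v)) = 0 := by
          rw [List.countP_eq_zero]
          intro v hv
          simpa using hex v hv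
        omega
    -- Here the length is exactly five.
    · exact absurd (hlen.trans (by omega)) (hG.length_ne hl)

end Cyc

namespace RotationSystem

variable {V : Type*} {G : SimpleGraph V} [Fintype G.Dart] {R : RotationSystem G}

/-- The corner of a long face at an outer vertex of degree three of a `K₄` block. -/
def Special (R : RotationSystem G) (d : G.Dart) : Prop :=
  R.Tri (R.next d) ∧ R.Tri (R.next (R.next d)) ∧ R.next (R.next (R.next d)) = d ∧
    R.Inner (R.facePerm (R.next d))

/-- The vertex has three neighbours, and the hypotheses on `a` and `b` exclude the centre of the
block, all of whose corners are triangles. The other two are outer vertices of the block and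
adjacent. -/
lemma IsCore.adj_of_special (hR : R.IsCore) {d : G.Dart} (h : R.Special d) {a b : V}
    (ha : G.Adj d.fst a) (hb : G.Adj d.fst b) (hab : a ≠ b)
    (hCa : ¬ ∀ g : G.Dart, g.fst = a → R.Tri g) (hCb : ¬ ∀ g : G.Dart, g.fst = b → R.Tri g) :
    G.Adj a b := by
  obtain ⟨h1, h2, h3, h4⟩ := h
  have hin : R.Inner (R.next d) := inner_iff.mpr ⟨h1, h2⟩
  have hw : ∀ g : G.Dart, g.fst = (R.next d).snd → R.Tri g :=
    fun g hg => hR.tri_of_center hin h4 hg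
  obtain ⟨-, -, -, c4, c5⟩ := hR.center hin h4
  have hadj : G.Adj (R.next (R.next d)).snd d.snd := by
    rw [← c5, ← h1.facePerm_snd]
    exact c4.adj
  have hcases : ∀ p, G.Adj d.fst p → ¬ (∀ g : G.Dart, g.fst = p → R.Tri g) →
      p = d.snd ∨ p = (R.next (R.next d)).snd := by
    intro p hp hC
    rcases eq_of_next_three h3 (e := ⟨(d.fst, p), hp⟩) rfl with h | h | h
    · exact Or.inl (congrArg (fun g : G.Dart => g.snd) h)
    · exact absurd hw (by rw [← h]; exact hC)
    · exact Or.inr (congrArg (fun g : G.Dart => g.snd) h)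
  rcases hcases a ha hCa with rfl | rfl <;> rcases hcases b hb hCb with rfl | rfl
  · exact absurd rfl hab
  · exact hadj.symm
  · exact hadj
  · exact absurd rfl hab

open Classical in
/-- Long faces have at most `length - 6` special corners. -/
lemma IsCore.card_special_add (hR : R.IsCore) {d : G.Dart} (h : 6 ≤ R.faceLength d) :
    ((Finset.range (R.faceLength d)).filter fun i => R.Special (R.facePerm^[i] d)).card + 6 ≤
      R.faceLength d := by
  set L := R.faceLength d with hL
  have hlen : ∀ i, R.faceLength (R.facePerm^[i] d) = L := by
    intro i
    induction i with
    | zero => rfl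
    | succ i ih => rw [Function.iterate_succ_apply', faceLength_facePerm, ih]
  have hcyc : G.IsCyc ((List.range L).map fun i => (R.facePerm^[i] d).fst) := by
    constructor
    · refine List.Nodup.map_on ?_ List.nodup_range
      intro i hi j hj hij
      by_contra hne
      exact iterate_fst_ne hR d (List.mem_range.mp hi) (List.mem_range.mp hj) hne hij
    · intro v hv
      have hv' : v = (R.facePerm^[L] d).fst := by
        rw [hL, R.iterate_faceLength]
        obtain ⟨m, hm⟩ : ∃ m, L = m + 1 := ⟨L - 1, by omega⟩
        rw [hm, List.range_succ_eq_map] at hv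
        simpa using hv.symm
      have : (List.range L).map (fun i => (R.facePerm^[i] d).fst) ++ [v] =
          (List.range (L + 1)).map fun i => (R.facePerm^[i] d).fst := by
        rw [List.range_succ, List.map_append, List.map_singleton, hv']
      rw [this, List.isChain_map, List.isChain_range]
      intro m _
      exact R.adj_iterate d m
  have key := hR.noFiveCycle.countP_add_lt (fun a => ∀ g : G.Dart, g.fst = a → R.Tri g)
    (fun v => ∃ g : G.Dart, g.fst = v ∧ R.Special g)
    (by
      rintro _ ⟨g, rfl, hg⟩ a b ha hb hab hCa hCb
      exact hR.adj_of_special hg ha hb hab hCa hCb) L _ hcyc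
    -- No vertex of the face is excluded as a block centre, since it has a corner in a face of
    -- length at least six.
    (by
      intro v hv hC
      obtain ⟨i, -, rfl⟩ := List.mem_map.mp hv
      have := hC _ rfl
      rw [Tri, hlen] at this
      omega) (by simp) (by omega)
  rw [List.countP_map] at key
  have h1 : ((Finset.range L).filter fun i => R.Special (R.facePerm^[i] d)).card =
      (List.range L).countP fun i => decide (R.Special (R.facePerm^[i] d)) := by
    rw [List.countP_eq_length_filter]
    rfl
  have hle : ∀ p : ℕ → Bool, (∀ i, R.Special (R.facePerm^[i] d) → p i = true) →
      ((Finset.range L).filter fun i => R.Special (R.facePerm^[i] d)).card ≤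
        (List.range L).countP p := by
    intro p hp
    rw [h1]
    refine List.countP_mono_left fun i _ hi => hp i ?_
    simpa using hi
  refine Nat.succ_le_of_lt (lt_of_le_of_lt (Nat.add_le_add_right (hle _ ?_) 5) key)
  intro i hi
  simp only [Function.comp_apply, decide_eq_true_eq]
  exact ⟨_, rfl, hi⟩

end RotationSystem

end SimpleGraph

/-! ### Discharging -/

namespace SimpleGraph

namespace RotationSystem

variable {V : Type*} {G : SimpleGraph V} [Fintype G.Dart] {R : RotationSystem G}

open Classical in
/-- The charge that the corner between `d` and the dart before it receives from its face. -/
noncomputable def charge (R : RotationSystem G) (d : G.Dart) : ℤ :=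
  if R.Tri d then
    if R.Inner d then
      if R.Inner (R.facePerm (R.facePerm d)) then
        if R.Inner (R.facePerm d) then 44 else 34
      else if R.Inner (R.facePerm d) then 49 else 40
    else if R.Inner (R.facePerm (R.facePerm d)) then
      if R.Inner (R.facePerm d) then 49 else 40
    else if R.Inner (R.facePerm d) then 52 else 44
  else if R.faceLength d = 4 then 33
  else if R.Special d then 0 else 22

lemma faceLength_iterate (d : G.Dart) (i : ℕ) :
    R.faceLength (R.facePerm^[i] d) = R.faceLength d := by
  induction i with
  | zero => rfl
  | succ i ih => rw [Function.iterate_succ_apply', faceLength_facePerm, ih]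

/-- One face is worth 132 units. A 4-face pays 33 per corner; a long face pays 22 at each
non-special corner, of which it has at least six. -/
lemma IsCore.face_charge (hR : R.IsCore) (d : G.Dart) :
    132 ≤ ∑ i ∈ Finset.range (R.faceLength d), R.charge (R.facePerm^[i] d) := by
  classical
  have h3 := hR.three_le_faceLength d
  have h5 := hR.faceLength_ne_five d
  rcases Nat.lt_or_ge (R.faceLength d) 6 with hlt | h6
  · obtain h | h : R.faceLength d = 3 ∨ R.faceLength d = 4 := by omega
    · have ht : R.Tri d := h
      have e := ht.facePerm_three
      rw [h, Finset.sum_range_succ, Finset.sum_range_succ, Finset.sum_range_one]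
      simp only [Function.iterate_succ_apply', Function.iterate_zero_apply]
      simp only [charge, tri_facePerm, ht, if_true, e]
      -- By the number of inner edges the triangle pays 44 + 44 + 44, 40 + 40 + 52, 34 + 49 + 49, or
      -- 44 + 44 + 44.
      by_cases a : R.Inner d <;> by_cases b : R.Inner (R.facePerm d) <;>
        by_cases c : R.Inner (R.facePerm (R.facePerm d)) <;> simp [a, b, c]
    · have hc : ∀ i, R.charge (R.facePerm^[i] d) = 33 := by
        intro i
        have hl := faceLength_iterate (R := R) d i
        rw [h] at hl
        rw [charge, if_neg (by rw [Tri, hl]; decide), if_pos hl]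
      simp only [hc, h, Finset.sum_const, Finset.card_range]
      decide
  · have hc : ∀ i, R.charge (R.facePerm^[i] d) =
        22 - 22 * (if R.Special (R.facePerm^[i] d) then 1 else 0) := by
      intro i
      have hl := faceLength_iterate (R := R) d i
      rw [charge, if_neg (by rw [Tri, hl]; omega), if_neg (by omega)]
      split_ifs <;> rfl
    have hs := hR.card_special_add h6
    simp only [hc, Finset.sum_sub_distrib, ← Finset.mul_sum, Finset.sum_const, Finset.card_range,
      Finset.sum_boole, nsmul_eq_mul]
    have : ((((Finset.range (R.faceLength d)).filter
        fun i => R.Special (R.facePerm^[i] d)).card : ℕ) : ℤ) + 6 ≤ R.faceLength d := by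
      exact_mod_cast hs
    linarith

lemma IsCore.card_face_le (hR : R.IsCore) :
    132 * (Nat.card R.Face : ℤ) ≤ ∑ d, R.charge d := by
  classical
  have : Fintype R.Face := by
    unfold Face
    exact Fintype.ofFinite _
  let q : G.Dart → R.Face := fun d => Quotient.mk (Equiv.Perm.SameCycle.setoid R.facePerm) d
  rw [← Finset.sum_fiberwise (s := Finset.univ) (g := q), Nat.card_eq_fintype_card, mul_comm,
    ← nsmul_eq_mul, ← Finset.card_univ]
  refine Finset.card_nsmul_le_sum _ _ _ ?_
  intro F _
  obtain ⟨d, rfl⟩ : ∃ d, q d = F := Quotient.exists_rep F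
  have himg : (Finset.univ.filter fun e => q e = q d) =
      (Finset.range (R.faceLength d)).image fun i => R.facePerm^[i] d := by
    ext e
    simp only [Finset.mem_filter, Finset.mem_univ, true_and, Finset.mem_image, Finset.mem_range]
    constructor
    · intro h
      obtain ⟨i, -, -, hi⟩ := (Quotient.exact (s := Equiv.Perm.SameCycle.setoid R.facePerm)
        h.symm : R.facePerm.SameCycle d e).exists_pow_eq
      refine ⟨i % R.faceLength d, Nat.mod_lt _ (R.faceLength_pos d), ?_⟩
      rw [faceLength, Function.iterate_mod_minimalPeriod_eq, ← Equiv.Perm.coe_pow, hi]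
    · rintro ⟨i, -, rfl⟩
      exact Quotient.sound (s := Equiv.Perm.SameCycle.setoid R.facePerm)
        (R.sameFace_iterate d i 0)
  rw [himg, Finset.sum_image]
  · exact hR.face_charge d
  · intro i hi j hj hij
    rw [Finset.coe_range, Set.mem_Iio] at hi hj
    exact (R.iterate_eq_iff d hi hj).mp hij

/-- The face of the dart has length at least six. -/
def Long (R : RotationSystem G) (d : G.Dart) : Prop := 6 ≤ R.faceLength d

lemma IsCore.long_next (hR : R.IsCore) {d : G.Dart} (h1 : R.Tri d) (h2 : ¬ R.Tri (R.next d)) :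
    R.Long (R.next d) := by
  rw [tri_next] at h2
  have := hR.six_le h1 h2
  rwa [Long, ← facePerm_symm, faceLength_facePerm]

lemma IsCore.long_of_next (hR : R.IsCore) {d : G.Dart} (h1 : R.Tri (R.next d)) (h2 : ¬ R.Tri d) :
    R.Long d := by
  have h3 : R.Tri (R.facePerm (R.facePerm (R.next d))) := by
    rwa [tri_facePerm, tri_facePerm]
  have := hR.six_le h3
  rw [h1.facePerm_facePerm, Dart.symm_symm] at this
  exact this h2

lemma IsCore.charge_of_not_tri (hR : R.IsCore) {d : G.Dart} (h1 : ¬ R.Tri d)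
    (h2 : ¬ R.Long d) : R.charge d = 33 := by
  have h3 := hR.three_le_faceLength d
  have h5 := hR.faceLength_ne_five d
  have h1' : R.faceLength d ≠ 3 := h1
  have h2' : ¬ 6 ≤ R.faceLength d := h2
  rw [charge, if_neg h1, if_pos (by omega)]

lemma charge_of_long {d : G.Dart} (h : R.Long d) : R.charge d ≤ 22 := by
  have h' : 6 ≤ R.faceLength d := h
  rw [charge, if_neg (by rw [Tri]; omega), if_neg (by omega)]
  split_ifs <;> decide

lemma charge_of_special {d : G.Dart} (h : R.Long d) (hs : R.Special d) : R.charge d = 0 := by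
  have h' : 6 ≤ R.faceLength d := h
  rw [charge, if_neg (by rw [Tri]; omega), if_neg (by omega), if_pos hs]

lemma inner_prev {d : G.Dart} (h : R.Tri (R.next d)) :
    R.Inner (R.facePerm (R.facePerm (R.next d))) ↔ R.Tri d := by
  rw [h.facePerm_facePerm, inner_symm, inner_iff]
  exact ⟨And.left, fun h' => ⟨h', h⟩⟩

/-- The charge of the corner after `d`, at a vertex that is not the centre of a `K₄`. -/
lemma charge_next_le {d : G.Dart} (h : R.Tri (R.next d))
    (h3 : ¬ (R.Tri d ∧ R.Tri (R.next (R.next d)))) :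
    R.charge (R.next d) ≤ 52 ∧ (R.Tri d → R.charge (R.next d) ≤ 49) ∧
      (R.Tri (R.next (R.next d)) → R.charge (R.next d) ≤ 49) := by
  classical
  rw [charge, if_pos h]
  simp only [inner_prev h, inner_iff (d := R.next d), h, true_and]
  by_cases a : R.Tri d <;> by_cases b : R.Tri (R.next (R.next d)) <;>
    simp only [a, b, if_true, if_false, true_and, and_true, not_true_eq_false, true_implies,
      false_implies] at h3 ⊢ <;> split_ifs <;> norm_num

/-- Both edges at this corner are inner, so the opposite one is not. The three corners of a centre
total 102 = 46 · 3 - 36. -/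
lemma IsCore.charge_center (hR : R.IsCore) {d : G.Dart} (h1 : R.Tri d) (h2 : R.Tri (R.next d))
    (h3 : R.Tri (R.next (R.next d))) : R.charge (R.next d) = 34 := by
  have i1 : R.Inner (R.next d) := inner_iff.mpr ⟨h2, h3⟩
  have i2 := (inner_prev h2).mpr h1
  rw [charge, if_pos h2, if_pos i1, if_pos i2, if_neg]
  exact fun i3 => hR.not_inner_three i1 i3 i2

/-- At a vertex of degree three with exactly two triangles, these are both in a `K₄` block or both
not. -/
lemma IsCore.inner_facePerm_iff (hR : R.IsCore) {e : G.Dart} (h : R.Inner e) :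
    R.Inner (R.facePerm e) ↔ R.Inner (R.facePerm (R.next e)) := by
  have h2 : R.Tri (R.next e) := (inner_iff.mp h).2
  rw [← facePerm_symm, tri_facePerm] at h2
  obtain ⟨y', hy'⟩ : ∃ y', y' = (R.facePerm (R.facePerm e.symm)).symm := ⟨_, rfl⟩
  have hn : R.next y' = e.symm := by rw [hy', h2.next_symm]
  have hi : R.Inner (R.facePerm (R.next e)) ↔ R.Tri y' := by
    rw [← facePerm_symm, ← inner_symm, ← hy', inner_iff, hn]
    exact ⟨And.left, fun h' => ⟨h', h2⟩⟩
  rw [hi]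
  constructor
  · intro h3
    refine hR.tri_of_center h h3 ?_
    have := R.next_fst y'
    rw [hn] at this
    exact this.symm
  · intro h3
    have h4 : R.Tri (R.next (R.next y')) := by
      rw [hn, ← facePerm_apply, tri_facePerm]
      exact h.1
    have h5 := hR.next_three h3 (by rwa [hn]) h4
    rw [hn, ← facePerm_apply] at h5
    rw [inner_iff, h5, tri_facePerm]
    exact ⟨h.1, h3⟩

end RotationSystem

end SimpleGraph

namespace SimpleGraph

namespace RotationSystem

variable {V : Type*} {G : SimpleGraph V} [Fintype G.Dart] {R : RotationSystem G}

open Classical in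
/-- The darts leaving a vertex. -/
noncomputable def dartsAt (G : SimpleGraph V) [Fintype G.Dart] (v : V) : Finset G.Dart :=
  Finset.univ.filter fun d => d.fst = v

lemma mem_dartsAt {v : V} {d : G.Dart} : d ∈ dartsAt G v ↔ d.fst = v := by
  classical simp [dartsAt]

lemma sum_next (R : RotationSystem G) (v : V) (g : G.Dart → ℤ) :
    ∑ d ∈ dartsAt G v, g (R.next d) = ∑ d ∈ dartsAt G v, g d := by
  refine Finset.sum_equiv R.next ?_ fun _ _ => rfl
  intro d
  rw [mem_dartsAt, mem_dartsAt, R.next_fst]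

lemma IsCore.dartsAt_eq (hR : R.IsCore) {d : G.Dart} (h : R.next (R.next (R.next d)) = d)
    (g : G.Dart → ℤ) :
    ∑ e ∈ dartsAt G d.fst, g e = g d + g (R.next d) + g (R.next (R.next d)) ∧
      (dartsAt G d.fst).card = 3 := by
  classical
  have h1 := (hR.next_ne d).symm
  have h2 := (hR.next_next_ne d).symm
  have h3 := (hR.next_ne (R.next d)).symm
  have hS : dartsAt G d.fst = {d, R.next d, R.next (R.next d)} := by
    ext e
    rw [mem_dartsAt, Finset.mem_insert, Finset.mem_insert, Finset.mem_singleton]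
    refine ⟨eq_of_next_three h, ?_⟩
    rintro (rfl | rfl | rfl)
    · rfl
    · rw [R.next_fst]
    · rw [R.next_fst, R.next_fst]
  rw [hS, Finset.sum_insert, Finset.sum_insert, Finset.sum_singleton, add_assoc,
    Finset.card_insert_of_notMem, Finset.card_insert_of_notMem, Finset.card_singleton]
  · exact ⟨rfl, rfl⟩
  all_goals simp [h1, h2, h3]

-- The two triangles are both in a `K₄` block or both not. The total is 49 + 49 + 0 in the first
-- case, where the long corner is special, and at most 40 + 40 + 22 in the second; the allowance is
-- 102.
open Classical in
lemma IsCore.charge_degree_three (hR : R.IsCore) {e : G.Dart} (hL : R.Long e)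
    (h1 : R.Tri (R.next e)) (h2 : R.Tri (R.next (R.next e)))
    (h3 : R.next (R.next (R.next e)) = e) :
    ∑ d ∈ dartsAt G e.fst, R.charge d ≤ 46 * ((dartsAt G e.fst).card : ℤ) - 36 := by
  obtain ⟨hs, hc⟩ := hR.dartsAt_eq h3 R.charge
  have hL' : 6 ≤ R.faceLength e := hL
  have ht : ¬ R.Tri e := by rw [Tri]; omega
  have i1 : R.Inner (R.next e) := inner_iff.mpr ⟨h1, h2⟩
  have i2 : ¬ R.Inner (R.facePerm (R.facePerm (R.next e))) := fun h => ht ((inner_prev h1).mp h)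
  have i3 : ¬ R.Inner (R.next (R.next e)) := fun h => ht (by
    have := (inner_iff.mp h).2
    rwa [h3] at this)
  have i4 : R.Inner (R.facePerm (R.facePerm (R.next (R.next e)))) := (inner_prev h2).mpr h1
  have hiff := hR.inner_facePerm_iff i1
  have c1 : R.charge (R.next e) = if R.Inner (R.facePerm (R.next e)) then 49 else 40 := by
    rw [charge, if_pos h1, if_pos i1, if_neg i2]
  have c2 : R.charge (R.next (R.next e)) =
      if R.Inner (R.facePerm (R.next (R.next e))) then 49 else 40 := by
    rw [charge, if_pos h2, if_neg i3, if_pos i4]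
  rw [hs, hc, c1, c2]
  by_cases hi : R.Inner (R.facePerm (R.next e))
  · rw [if_pos hi, if_pos (hiff.mp hi), charge_of_special hL ⟨h1, h2, h3, hi⟩]
    norm_num
  · rw [if_neg hi, if_neg fun h => hi (hiff.mpr h)]
    have := charge_of_long hL
    push_cast
    linarith

-- Away from block centres, every triangular corner has a long corner beside it, as triangles border
-- only triangles and long faces. A long corner is 24 below the average 46 and passes 3 to each
-- side, for a net saving of 18; a quadrilateral corner saves 13.
open Classical in
lemma IsCore.vertex_charge_le (hR : R.IsCore) {v : V}
    (hno : ∀ d, d.fst = v → ¬ (R.Tri d ∧ R.Tri (R.next d) ∧ R.Tri (R.next (R.next d)))) :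
    ∑ d ∈ dartsAt G v, R.charge d ≤ 46 * ((dartsAt G v).card : ℤ)
      - 18 * (((dartsAt G v).filter fun d => R.Long d).card : ℤ)
      - 13 * (((dartsAt G v).filter fun d => ¬ R.Tri d ∧ ¬ R.Long d).card : ℤ) := by
  set L : G.Dart → ℤ := fun d => if R.Long d then 1 else 0 with hL
  set Q : G.Dart → ℤ := fun d => if ¬ R.Tri d ∧ ¬ R.Long d then 1 else 0 with hQ
  have hL0 : ∀ d, 0 ≤ L d := fun d => by simp only [hL]; split_ifs <;> norm_num
  have hLs : (((dartsAt G v).filter fun d => R.Long d).card : ℤ) = ∑ d ∈ dartsAt G v, L d := by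
    simp [hL]
  have hQs : (((dartsAt G v).filter fun d => ¬ R.Tri d ∧ ¬ R.Long d).card : ℤ) =
      ∑ d ∈ dartsAt G v, Q d := by
    simp [hQ]
  -- A triangular corner costs at most 49 = 46 + 3 beside one long corner and at most 52 = 46 + 6
  -- between two.
  have key : ∀ d ∈ dartsAt G v, R.charge (R.next d) ≤
      46 + 3 * L d + 3 * L (R.next (R.next d)) - 24 * L (R.next d) - 13 * Q (R.next d) := by
    intro d hd
    have hno' := hno d (mem_dartsAt.mp hd)
    have a1 := hL0 d
    have a2 := hL0 (R.next (R.next d))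
    by_cases ht : R.Tri (R.next d)
    · have hnl : ¬ R.Long (R.next d) := by
        intro h
        have h' : 6 ≤ R.faceLength (R.next d) := h
        have ht' : R.faceLength (R.next d) = 3 := ht
        omega
      have e1 : L (R.next d) = 0 := if_neg hnl
      have e2 : Q (R.next d) = 0 := if_neg fun h => h.1 ht
      obtain ⟨b1, b2, b3⟩ := charge_next_le ht fun h => hno' ⟨h.1, ht, h.2⟩
      by_cases h1 : R.Tri d
      · have h2 : ¬ R.Tri (R.next (R.next d)) := fun h2 => hno' ⟨h1, ht, h2⟩
        have e3 : L (R.next (R.next d)) = 1 := if_pos (hR.long_next ht h2)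
        have := b2 h1
        linarith
      · have e4 : L d = 1 := if_pos (hR.long_of_next ht h1)
        by_cases h2 : R.Tri (R.next (R.next d))
        · have := b3 h2
          linarith
        · have e3 : L (R.next (R.next d)) = 1 := if_pos (hR.long_next ht h2)
          linarith
    · by_cases hl : R.Long (R.next d)
      · have e1 : L (R.next d) = 1 := if_pos hl
        have e2 : Q (R.next d) = 0 := if_neg fun h => h.2 hl
        have := charge_of_long hl
        linarith
      · have e1 : L (R.next d) = 0 := if_neg hl
        have e2 : Q (R.next d) = 1 := if_pos ⟨ht, hl⟩
        have := hR.charge_of_not_tri ht hl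
        linarith
  have hsum := Finset.sum_le_sum key
  simp only [Finset.sum_sub_distrib, Finset.sum_add_distrib, ← Finset.mul_sum, Finset.sum_const,
    nsmul_eq_mul] at hsum
  rw [R.sum_next v R.charge, R.sum_next v L, R.sum_next v Q,
    R.sum_next v (fun d => L (R.next d)), R.sum_next v L] at hsum
  rw [hLs, hQs]
  linarith

/-- A saving of 36 is needed. Two long corners save 36, one long and two quadrilateral corners 44,
three quadrilateral corners 39. What remains are block centres and vertices of degree three with two
triangles and one long corner. -/
lemma IsCore.vertex_charge (hR : R.IsCore) (d₀ : G.Dart) :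
    ∑ d ∈ dartsAt G d₀.fst, R.charge d ≤ 46 * ((dartsAt G d₀.fst).card : ℤ) - 36 := by
  classical
  set v := d₀.fst with hv
  by_cases hex : ∃ d : G.Dart, d.fst = v ∧ R.Tri d ∧ R.Tri (R.next d) ∧ R.Tri (R.next (R.next d))
  · obtain ⟨d, hd, h1, h2, h3⟩ := hex
    have h4 := hR.next_three h1 h2 h3
    obtain ⟨hs, hc⟩ := hR.dartsAt_eq h4 R.charge
    have c1 := hR.charge_center h1 h2 h3
    have c2 := hR.charge_center h2 h3 (by rwa [h4])
    have c3 := hR.charge_center h3 (by rwa [h4]) (by rwa [h4])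
    rw [h4] at c3
    rw [← hd, hs, hc, c1, c2, c3]
    norm_num
  push Not at hex
  have hno : ∀ d : G.Dart, d.fst = v →
      ¬ (R.Tri d ∧ R.Tri (R.next d) ∧ R.Tri (R.next (R.next d))) :=
    fun d hd h => hex d hd h.1 h.2.1 h.2.2
  have hmain := hR.vertex_charge_le hno
  have hnf := R.next_fst
  by_cases hlong : ∃ e : G.Dart, e.fst = v ∧ R.Long e
  · obtain ⟨e, he, hLe⟩ := hlong
    have hte : ¬ R.Tri e := by
      have h' : 6 ≤ R.faceLength e := hLe
      rw [Tri]; omega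
    have hB : 1 ≤ ((dartsAt G v).filter fun d => R.Long d).card :=
      Finset.card_pos.mpr ⟨e, Finset.mem_filter.mpr ⟨mem_dartsAt.mpr he, hLe⟩⟩
    by_cases hex2 : ∃ e' : G.Dart, e'.fst = v ∧ R.Long e' ∧ e ≠ e'
    · obtain ⟨e', he', hLe', hne⟩ := hex2
      have hB2 : 2 ≤ ((dartsAt G v).filter fun d => R.Long d).card := by
        rw [← Finset.card_pair hne]
        refine Finset.card_le_card ?_
        intro x hx
        rw [Finset.mem_insert, Finset.mem_singleton] at hx
        rcases hx with rfl | rfl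
        · exact Finset.mem_filter.mpr ⟨mem_dartsAt.mpr he, hLe⟩
        · exact Finset.mem_filter.mpr ⟨mem_dartsAt.mpr he', hLe'⟩
      linarith [Int.ofNat_le.mpr hB2, Int.natCast_nonneg
        ((dartsAt G v).filter fun d => ¬ R.Tri d ∧ ¬ R.Long d).card]
    push Not at hex2
    by_cases hne : R.Tri (R.next e)
    -- With only one long corner, the run of triangles after it must end at that corner again; as
    -- its length is at most two, the degree is three.
    · have hnne : R.Tri (R.next (R.next e)) := by
        by_contra h
        exact hR.next_next_ne e
          (hex2 _ (by rw [hnf, hnf, he]) (hR.long_next hne h)).symm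
      have hlast : R.next (R.next (R.next e)) = e :=
        (hex2 _ (by rw [hnf, hnf, hnf, he]) (hR.long_next hnne fun h =>
          hno (R.next e) (by rw [hnf, he]) ⟨hne, hnne, h⟩)).symm
      rw [← he]
      exact hR.charge_degree_three hLe hne hnne hlast
    · obtain ⟨y, rfl⟩ := R.next.surjective e
      obtain ⟨y', rfl⟩ := R.next.surjective y
      obtain ⟨y'', rfl⟩ := R.next.surjective y'
      simp only [hnf] at he hex2
      -- A run of triangles before the long corner would likewise go back to that corner,
      -- contradicting the nontriangular corner after it. So both neighbouring corners are
      -- quadrilateral.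
      have hyt : ¬ R.Tri (R.next (R.next y'')) := by
        intro hy
        have hy' : R.Tri (R.next y'') := by
          by_contra h
          have h1 := hex2 (R.next y'') (by rw [hnf, he]) (hR.long_of_next hy h)
          rw [h1] at hne
          exact hne hy
        have hy'' : ¬ R.Tri y'' := fun h => hno y'' he ⟨h, hy', hy⟩
        have h2 := hex2 y'' he (hR.long_of_next hy' hy'')
        rw [h2] at hne
        exact hne hy'
      have hl1 : ¬ R.Long (R.next (R.next y'')) := fun h =>
        hR.next_ne _ (hex2 _ (by rw [hnf, hnf, he]) h)
      have hl2 : ¬ R.Long (R.next (R.next (R.next (R.next y'')))) := fun h =>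
        hR.next_ne _ (hex2 _ (by simp only [hnf, he]) h).symm
      have hQ2 : 2 ≤ ((dartsAt G v).filter fun d => ¬ R.Tri d ∧ ¬ R.Long d).card := by
        rw [← Finset.card_pair (hR.next_next_ne (R.next (R.next y'')))]
        refine Finset.card_le_card ?_
        intro x hx
        rw [Finset.mem_insert, Finset.mem_singleton] at hx
        rcases hx with rfl | rfl
        · exact Finset.mem_filter.mpr ⟨mem_dartsAt.mpr (by simp only [hnf, he]), hne, hl2⟩
        · exact Finset.mem_filter.mpr ⟨mem_dartsAt.mpr (by simp only [hnf, he]), hyt, hl1⟩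
      linarith [Int.ofNat_le.mpr hQ2, Int.ofNat_le.mpr hB]
  · push Not at hlong
    -- Without long corners a triangle would be followed by triangles only, giving the excluded run
    -- of three.
    have hnt : ∀ d : G.Dart, d.fst = v → ¬ R.Tri d := by
      intro d hd h
      have step : ∀ d : G.Dart, d.fst = v → R.Tri d → R.Tri (R.next d) := by
        intro d hd h
        by_contra h'
        exact hlong _ (by rw [hnf, hd]) (hR.long_next h h')
      have h1 := step d hd h
      exact hno d hd ⟨h, h1, step _ (by rw [hnf, hd]) h1⟩
    have hQ3 : 3 ≤ ((dartsAt G v).filter fun d => ¬ R.Tri d ∧ ¬ R.Long d).card := by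
      have h3 : ({d₀, R.next d₀, R.next (R.next d₀)} : Finset G.Dart).card = 3 :=
        Finset.card_eq_three.mpr ⟨_, _, _, (hR.next_ne _).symm, (hR.next_next_ne _).symm,
          (hR.next_ne _).symm, rfl⟩
      rw [← h3]
      refine Finset.card_le_card ?_
      intro x hx
      have hxv : x.fst = v := by
        simp only [Finset.mem_insert, Finset.mem_singleton] at hx
        rcases hx with rfl | rfl | rfl <;> simp only [hnf, hv]
      exact Finset.mem_filter.mpr ⟨mem_dartsAt.mpr hxv, hnt x hxv, hlong x hxv⟩
    linarith [Int.ofNat_le.mpr hQ3, Int.natCast_nonneg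
      ((dartsAt G v).filter fun d => R.Long d).card]

/-- The edge bound for drawings to which the discharging argument applies. -/
theorem IsCore.edge_bound [Fintype V] (hR : R.IsCore) :
    5 * G.edgeSet.ncard + 33 ≤ 12 * {v : V | ∃ w, G.Adj v w}.ncard := by
  classical
  have hne : {v : V | ∃ w, G.Adj v w}.Nonempty := by
    rw [Set.nonempty_iff_ne_empty]
    intro h
    have := hR.five_le
    rw [h, Set.ncard_empty] at this
    omega
  obtain ⟨v₀, w₀, h₀⟩ := hne
  have : Nonempty G.Dart := ⟨⟨(v₀, w₀), h₀⟩⟩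
  have hE := hR.isFlat.euler (Unsplittable.const R hR.unsplittable)
  have hcompl : {v : V | ∀ w, ¬ G.Adj v w} = {v : V | ∃ w, G.Adj v w}ᶜ := by
    ext v
    simp
  have hV := Set.ncard_add_ncard_compl {v : V | ∃ w, G.Adj v w}
  rw [← hcompl] at hV
  set S : Finset V := Finset.univ.filter fun v => ∃ w, G.Adj v w with hS
  have hcard : {v : V | ∃ w, G.Adj v w}.ncard = S.card := by
    rw [← Set.ncard_coe_finset, hS]
    congr 1
    ext v
    simp
  have hfib : ∀ g : G.Dart → ℤ, ∑ v ∈ S, ∑ d ∈ dartsAt G v, g d = ∑ d, g d := by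
    intro g
    exact Finset.sum_fiberwise_of_maps_to
      (fun d _ => Finset.mem_filter.mpr ⟨Finset.mem_univ _, d.snd, d.adj⟩) g
  have h1 : ∑ v ∈ S, ∑ d ∈ dartsAt G v, R.charge d ≤
      ∑ v ∈ S, (46 * ((dartsAt G v).card : ℤ) - 36) := by
    refine Finset.sum_le_sum fun v hv => ?_
    obtain ⟨w, hw⟩ := (Finset.mem_filter.mp hv).2
    exact hR.vertex_charge ⟨(v, w), hw⟩
  have h2 : ∑ v ∈ S, ((dartsAt G v).card : ℤ) = 2 * G.edgeSet.ncard := by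
    have := hfib fun _ => 1
    simp only [Finset.sum_const, Finset.card_univ, card_dart, nsmul_eq_mul, mul_one] at this
    rw [this]
    push_cast
    ring
  have h3 := hR.card_face_le
  rw [hfib, Finset.sum_sub_distrib, ← Finset.mul_sum, h2, Finset.sum_const, nsmul_eq_mul,
    ← hcard] at h1
  -- 132 (E - V + 2) ≤ 92 E - 36 V, where V counts vertices of positive degree; divide by 8.
  omega

end RotationSystem

end SimpleGraph

/-! ### Reduction to the core: gluing at cut vertices and deleting vertices of low degree -/

namespace SimpleGraph

variable {V : Type*}

/-- `x` and `y` are joined by a path of length two. -/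
def Path2 (G : SimpleGraph V) (x y : V) : Prop := ∃ p, G.Adj x p ∧ G.Adj p y

/-- `x` and `y` are joined by a path of length three. -/
def Path3 (G : SimpleGraph V) (x y : V) : Prop :=
  ∃ p q, G.Adj x p ∧ G.Adj p q ∧ G.Adj q y ∧ x ≠ q ∧ p ≠ y

lemma Path2.symm {G : SimpleGraph V} {x y : V} (h : G.Path2 x y) : G.Path2 y x := by
  obtain ⟨p, h1, h2⟩ := h
  exact ⟨p, h2.symm, h1.symm⟩

lemma Path3.symm {G : SimpleGraph V} {x y : V} (h : G.Path3 x y) : G.Path3 y x := by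
  obtain ⟨p, q, h1, h2, h3, h4, h5⟩ := h
  exact ⟨q, p, h3.symm, h2.symm, h1.symm, h5.symm, h4.symm⟩

lemma Path2.mono {G H : SimpleGraph V} (hle : H ≤ G) {x y : V} (h : H.Path2 x y) :
    G.Path2 x y := by
  obtain ⟨p, h1, h2⟩ := h
  exact ⟨p, hle h1, hle h2⟩

lemma Path3.mono {G H : SimpleGraph V} (hle : H ≤ G) {x y : V} (h : H.Path3 x y) :
    G.Path3 x y := by
  obtain ⟨p, q, h1, h2, h3, h4, h5⟩ := h
  exact ⟨p, q, hle h1, hle h2, hle h3, h4, h5⟩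

lemma NoFiveCycle.mono {G H : SimpleGraph V} (hle : H ≤ G) (h : G.NoFiveCycle) :
    H.NoFiveCycle := fun a b c d e h1 h2 h3 h4 h5 =>
  h a b c d e (hle h1) (hle h2) (hle h3) (hle h4) (hle h5)

/-- The edge bounds for a graph living on a set of `m + 1` vertices, and the paths that exist when
they are attained. -/
structure Sparse (G : SimpleGraph V) (S : Finset V) (m : ℕ) : Prop where
  le : m ≤ 10 → G.edgeSet.ncard ≤ 2 * m
  lt : m ≤ 10 → m % 3 ≠ 0 → G.edgeSet.ncard + 1 ≤ 2 * m
  large : 10 ≤ m → 5 * G.edgeSet.ncard + 21 ≤ 12 * m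
  adj : m ≤ 3 → G.edgeSet.ncard = 2 * m → ∀ x ∈ S, ∀ y ∈ S, x ≠ y → G.Adj x y
  path2 : m ≤ 6 → G.edgeSet.ncard = 2 * m → ∀ x ∈ S, ∀ y ∈ S, x ≠ y → G.Path2 x y
  path3 : m ≤ 9 → G.edgeSet.ncard = 2 * m → ∀ x ∈ S, ∀ y ∈ S, x ≠ y → G.Path3 x y

/-- The graph with the same vertices and only the edges inside `S`. -/
def within (G : SimpleGraph V) (S : Finset V) : SimpleGraph V where
  Adj v w := G.Adj v w ∧ v ∈ S ∧ w ∈ S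
  symm := ⟨fun _ _ h => ⟨h.1.symm, h.2.2, h.2.1⟩⟩
  loopless := ⟨fun _ h => h.1.ne rfl⟩

lemma within_le (G : SimpleGraph V) (S : Finset V) : G.within S ≤ G := fun _ _ h => h.1

lemma edgeSet_ncard_le_choose (G : SimpleGraph V) (S : Finset V)
    (hS : ∀ v w, G.Adj v w → v ∈ S) :
    G.edgeSet.ncard ≤ S.card.choose 2 ∧
      (G.edgeSet.ncard = S.card.choose 2 → ∀ x ∈ S, ∀ y ∈ S, x ≠ y → G.Adj x y) := by
  classical
  have hsub : G.edgeSet ⊆ ((S.offDiag.image (Function.uncurry Sym2.mk) : Finset (Sym2 V)) : Set (Sym2 V)) := by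
    intro e
    induction e using Sym2.ind with
    | h x y =>
      intro h
      rw [mem_edgeSet] at h
      exact Finset.mem_coe.mpr (Finset.mem_image.mpr ⟨(x, y),
        Finset.mem_offDiag.mpr ⟨hS _ _ h, hS _ _ h.symm, h.ne⟩, rfl⟩)
  have hcard := Sym2.card_image_offDiag S
  rw [← Set.ncard_coe_finset] at hcard
  refine ⟨hcard ▸ Set.ncard_le_ncard hsub (Finset.finite_toSet _), ?_⟩
  intro heq x hx y hy hxy
  have := Set.eq_of_subset_of_ncard_le hsub (by rw [hcard, heq]) (Finset.finite_toSet _)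
  rw [← mem_edgeSet, this]
  exact Finset.mem_coe.mpr (Finset.mem_image.mpr ⟨(x, y), Finset.mem_offDiag.mpr ⟨hx, hy, hxy⟩, rfl⟩)

/-- On at most four vertices the count of pairs suffices, and 2m edges on at least two vertices mean
`K₄`. -/
lemma sparse_of_le_three {G : SimpleGraph V} {S : Finset V} {m : ℕ} (hm : m ≤ 3)
    (hcard : S.card = m + 1) (hS : ∀ v w, G.Adj v w → v ∈ S) : G.Sparse S m := by
  classical
  obtain ⟨h1, h2⟩ := G.edgeSet_ncard_le_choose S hS
  rw [hcard] at h1 h2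
  have hlt : G.edgeSet.ncard ≤ 2 * m ∧ (m % 3 ≠ 0 → G.edgeSet.ncard + 1 ≤ 2 * m) := by
    interval_cases m <;> simp [Nat.choose] at h1 ⊢ <;> omega
  have hadj : G.edgeSet.ncard = 2 * m → ∀ x ∈ S, ∀ y ∈ S, x ≠ y → G.Adj x y := by
    intro heq
    apply h2
    interval_cases m <;> simp [Nat.choose] at hlt heq ⊢ <;> omega
  have htwo : G.edgeSet.ncard = 2 * m → ∀ x ∈ S, ∀ y ∈ S, x ≠ y →
      ∃ p q, p ∈ S ∧ q ∈ S ∧ p ≠ q ∧ x ≠ p ∧ x ≠ q ∧ y ≠ p ∧ y ≠ q := by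
    intro heq x hx y hy hxy
    have h3 : m = 3 := by
      have h4 : 1 < S.card := Finset.one_lt_card.mpr ⟨x, hx, y, hy, hxy⟩
      have := hlt.2
      by_contra
      interval_cases m <;> omega
    have h5 : 1 < ((S.erase x).erase y).card := by
      rw [Finset.card_erase_of_mem (Finset.mem_erase.mpr ⟨hxy.symm, hy⟩),
        Finset.card_erase_of_mem hx]
      omega
    obtain ⟨p, hp, q, hq, hpq⟩ := Finset.one_lt_card.mp h5
    simp only [Finset.mem_erase] at hp hq
    exact ⟨p, q, hp.2.2, hq.2.2, hpq, hp.2.1.symm, hq.2.1.symm, hp.1.symm, hq.1.symm⟩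
  refine ⟨fun _ => hlt.1, fun _ => hlt.2, fun h => by omega, fun _ => hadj, ?_, ?_⟩
  · intro _ heq x hx y hy hxy
    obtain ⟨p, q, hp, hq, hpq, h3, h4, h5, h6⟩ := htwo heq x hx y hy hxy
    exact ⟨p, hadj heq x hx p hp h3, hadj heq p hp y hy h5.symm⟩
  · intro _ heq x hx y hy hxy
    obtain ⟨p, q, hp, hq, hpq, h3, h4, h5, h6⟩ := htwo heq x hx y hy hxy
    exact ⟨p, q, hadj heq x hx p hp h3, hadj heq p hp q hq hpq, hadj heq q hq y hy h6.symm, h4,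
      h5.symm⟩

lemma ncard_edgeSet_within_add [Finite V] [DecidableEq V] {G : SimpleGraph V} {S₁ S₂ : Finset V} {z : V}
    (hinter : S₁ ∩ S₂ = {z})
    (hedge : ∀ v w, G.Adj v w → (v ∈ S₁ ∧ w ∈ S₁) ∨ (v ∈ S₂ ∧ w ∈ S₂)) :
    G.edgeSet.ncard = (G.within S₁).edgeSet.ncard + (G.within S₂).edgeSet.ncard := by
  rw [← Set.ncard_union_eq]
  · congr 1
    ext e
    induction e using Sym2.ind with
    | h x y =>
      simp only [Set.mem_union, mem_edgeSet, within]
      constructor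
      · intro h
        rcases hedge x y h with h' | h'
        · exact Or.inl ⟨h, h'⟩
        · exact Or.inr ⟨h, h'⟩
      · rintro (h | h) <;> exact h.1
  · rw [Set.disjoint_left]
    intro e
    induction e using Sym2.ind with
    | h x y =>
      simp only [mem_edgeSet, within]
      rintro ⟨h, h1, h2⟩ ⟨-, h3, h4⟩
      have h5 : x ∈ S₁ ∩ S₂ := Finset.mem_inter.mpr ⟨h1, h3⟩
      have h6 : y ∈ S₁ ∩ S₂ := Finset.mem_inter.mpr ⟨h2, h4⟩
      rw [hinter, Finset.mem_singleton] at h5 h6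
      exact h.ne (h5.trans h6.symm)

lemma superadditive_bounds {m₁ m₂ e₁ e₂ : ℕ} (a1 : m₁ ≤ 10 → e₁ ≤ 2 * m₁)
    (a2 : m₁ ≤ 10 → m₁ % 3 ≠ 0 → e₁ + 1 ≤ 2 * m₁) (a3 : 10 ≤ m₁ → 5 * e₁ + 21 ≤ 12 * m₁)
    (b1 : m₂ ≤ 10 → e₂ ≤ 2 * m₂) (b2 : m₂ ≤ 10 → m₂ % 3 ≠ 0 → e₂ + 1 ≤ 2 * m₂)
    (b3 : 10 ≤ m₂ → 5 * e₂ + 21 ≤ 12 * m₂) :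
    (m₁ + m₂ ≤ 10 → e₁ + e₂ ≤ 2 * (m₁ + m₂)) ∧
      (m₁ + m₂ ≤ 10 → (m₁ + m₂) % 3 ≠ 0 → e₁ + e₂ + 1 ≤ 2 * (m₁ + m₂)) ∧
      (10 ≤ m₁ + m₂ → 5 * (e₁ + e₂) + 21 ≤ 12 * (m₁ + m₂)) := by
  have hsmall : m₁ + m₂ ≤ 10 → (m₁ + m₂) % 3 ≠ 0 → e₁ + e₂ + 1 ≤ 2 * (m₁ + m₂) := by
    intro h1 h2
    have ha := a1 (by omega)
    have hb := b1 (by omega)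
    by_cases h3 : m₁ % 3 = 0
    · have := b2 (by omega) (by omega)
      omega
    · have := a2 (by omega) h3
      omega
  refine ⟨fun h => ?_, hsmall, fun h => ?_⟩
  · have ha := a1 (by omega)
    have hb := b1 (by omega)
    omega
  · rcases Nat.lt_or_ge m₁ 10 with h1 | h1
    · have ha := a1 (by omega)
      rcases Nat.lt_or_ge m₂ 10 with h2 | h2
      · have hb := b1 (by omega)
        -- From 2m edges the linear bound follows only for m ≥ 11. At m = 10 strictness is needed
        -- and available, since 3 does not divide 10.
        by_cases h3 : m₁ + m₂ = 10
        · have := hsmall (by omega) (by omega)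
          omega
        · omega
      · have hb := b3 h2
        omega
    · have ha := a3 h1
      rcases Nat.lt_or_ge m₂ 10 with h2 | h2
      · have hb := b1 (by omega)
        omega
      · have hb := b3 h2
        omega

/-- Equality forces equality in both parts, with `m₁` and `m₂` divisible by 3. Paths between the
parts are composed at `z`: for sum 6 both parts are complete, and for sum at most 9 one part is
complete while the other has paths of length two. -/
lemma sparse_of_split [Finite V] [DecidableEq V] {G : SimpleGraph V} {S S₁ S₂ : Finset V} {z : V}
    {m m₁ m₂ : ℕ} (hunion : S₁ ∪ S₂ = S) (hinter : S₁ ∩ S₂ = {z})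
    (hedge : ∀ v w, G.Adj v w → (v ∈ S₁ ∧ w ∈ S₁) ∨ (v ∈ S₂ ∧ w ∈ S₂))
    (hm : m = m₁ + m₂) (hm₁ : 0 < m₁) (hm₂ : 0 < m₂)
    (h₁ : (G.within S₁).Sparse S₁ m₁) (h₂ : (G.within S₂).Sparse S₂ m₂) : G.Sparse S m := by
  have hcard := ncard_edgeSet_within_add hinter hedge
  obtain ⟨a1, a2, a3, a4, a5, a6⟩ := h₁
  obtain ⟨b1, b2, b3, b4, b5, b6⟩ := h₂
  generalize (G.within S₁).edgeSet.ncard = e₁ at *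
  generalize (G.within S₂).edgeSet.ncard = e₂ at *
  have hz : z ∈ S₁ ∧ z ∈ S₂ := by
    rw [← Finset.mem_inter, hinter, Finset.mem_singleton]
  have hzz : ∀ x, x ∈ S₁ → x ∈ S₂ → x = z := by
    intro x h h'
    rw [← Finset.mem_singleton, ← hinter, Finset.mem_inter]
    exact ⟨h, h'⟩
  have heqs : m ≤ 9 → G.edgeSet.ncard = 2 * m → e₁ = 2 * m₁ ∧ e₂ = 2 * m₂ ∧ m₁ % 3 = 0 ∧
      m₂ % 3 = 0 := by
    intro h1 h2
    have ha := a1 (by omega)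
    have hb := b1 (by omega)
    clear a1 a3 a4 a5 a6 b1 b3 b4 b5 b6
    refine ⟨by omega, by omega, ?_, ?_⟩
    · by_contra h
      have := a2 (by omega) h
      omega
    · by_contra h
      have := b2 (by omega) h
      omega
  have hbounds := superadditive_bounds a1 a2 a3 b1 b2 b3
  rw [← hcard, ← hm] at hbounds
  refine ⟨hbounds.1, hbounds.2.1, hbounds.2.2, ?_, ?_, ?_⟩
  · intro h1 h2
    have := heqs (by omega) h2
    omega
  · intro h1 h2 x hx y hy hxy
    obtain ⟨h3, h4, h5, h6⟩ := heqs (by omega) h2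
    have cross : ∀ x ∈ S₁, ∀ y ∈ S₂, x ∉ S₂ → y ∉ S₁ → G.Path2 x y := by
      intro x hx y hy hx' hy'
      exact ⟨z, within_le _ _ (a4 (by omega) h3 x hx z hz.1 (by rintro rfl; exact hx' hz.2)),
        within_le _ _ (b4 (by omega) h4 z hz.2 y hy (by rintro rfl; exact hy' hz.1))⟩
    by_cases c1 : x ∈ S₁ ∧ y ∈ S₁
    · exact (a5 (by omega) h3 x c1.1 y c1.2 hxy).mono (within_le _ _)
    by_cases c2 : x ∈ S₂ ∧ y ∈ S₂
    · exact (b5 (by omega) h4 x c2.1 y c2.2 hxy).mono (within_le _ _)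
    rw [← hunion, Finset.mem_union] at hx hy
    rcases hx with hx | hx <;> rcases hy with hy | hy
    · exact absurd ⟨hx, hy⟩ c1
    · exact cross x hx y hy (fun h => c2 ⟨h, hy⟩) (fun h => c1 ⟨hx, h⟩)
    · exact (cross y hy x hx (fun h => c2 ⟨hx, h⟩) (fun h => c1 ⟨h, hy⟩)).symm
    · exact absurd ⟨hx, hy⟩ c2
  · intro h1 h2 x hx y hy hxy
    obtain ⟨h3, h4, h5, h6⟩ := heqs h1 h2
    have cross : ∀ x ∈ S₁, ∀ y ∈ S₂, x ∉ S₂ → y ∉ S₁ → G.Path3 x y := by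
      intro x hx y hy hx' hy'
      have hxz : x ≠ z := by rintro rfl; exact hx' hz.2
      have hyz : z ≠ y := by rintro rfl; exact hy' hz.1
      rcases Nat.lt_or_ge 3 m₁ with h | h
      · obtain ⟨p, hp1, hp2⟩ := a5 (by omega) h3 x hx z hz.1 hxz
        exact ⟨p, z, hp1.1, hp2.1, within_le _ _ (b4 (by omega) h4 z hz.2 y hy hyz), hxz, by
          rintro rfl
          exact hy' hp1.2.2⟩
      · obtain ⟨p, hp1, hp2⟩ := b5 (by omega) h4 z hz.2 y hy hyz
        exact ⟨z, p, within_le _ _ (a4 (by omega) h3 x hx z hz.1 hxz), hp1.1, hp2.1, by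
          rintro rfl
          exact hx' hp1.2.2, hyz⟩
    by_cases c1 : x ∈ S₁ ∧ y ∈ S₁
    · exact (a6 (by omega) h3 x c1.1 y c1.2 hxy).mono (within_le _ _)
    by_cases c2 : x ∈ S₂ ∧ y ∈ S₂
    · exact (b6 (by omega) h4 x c2.1 y c2.2 hxy).mono (within_le _ _)
    rw [← hunion, Finset.mem_union] at hx hy
    rcases hx with hx | hx <;> rcases hy with hy | hy
    · exact absurd ⟨hx, hy⟩ c1
    · exact cross x hx y hy (fun h => c2 ⟨h, hy⟩) (fun h => c1 ⟨hx, h⟩)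
    · exact (cross y hy x hx (fun h => c2 ⟨hx, h⟩) (fun h => c1 ⟨h, hy⟩)).symm
    · exact absurd ⟨hx, hy⟩ c2

lemma ncard_edgeSet_le_erase [Finite V] [DecidableEq V] {G : SimpleGraph V} {S : Finset V}
    (hS : ∀ v w, G.Adj v w → v ∈ S) (v : V) :
    G.edgeSet.ncard ≤ (G.within (S.erase v)).edgeSet.ncard + (G.neighborSet v).ncard := by
  have hsub : G.edgeSet ⊆ (G.within (S.erase v)).edgeSet ∪ (fun w => s(v, w)) '' G.neighborSet v := by
    intro e
    induction e using Sym2.ind with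
    | h x y =>
      intro h
      rw [mem_edgeSet] at h
      by_cases hx : x = v
      · subst hx
        exact Or.inr ⟨y, h, rfl⟩
      by_cases hy : y = v
      · subst hy
        exact Or.inr ⟨x, h.symm, Sym2.eq_swap⟩
      · exact Or.inl ⟨h, Finset.mem_erase.mpr ⟨hx, hS _ _ h⟩,
          Finset.mem_erase.mpr ⟨hy, hS _ _ h.symm⟩⟩
  refine (Set.ncard_le_ncard hsub).trans ((Set.ncard_union_le _ _).trans ?_)
  exact Nat.add_le_add_left (Set.ncard_image_le (Set.toFinite _)) _

/-- For m ≤ 10 the bound 2m becomes strict, so nothing is left to show about paths at equality. For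
m > 10 the two lost edges cost 10 ≤ 12. -/
lemma sparse_of_erase [Finite V] [DecidableEq V] {G : SimpleGraph V} {S : Finset V} {m : ℕ}
    (hG : G.NoFiveCycle) (hS : ∀ v w, G.Adj v w → v ∈ S) {v : V}
    (hdeg : (G.neighborSet v).ncard ≤ 2) (hm : 0 < m)
    (h : (G.within (S.erase v)).Sparse (S.erase v) (m - 1)) : G.Sparse S m := by
  have hle := ncard_edgeSet_le_erase hS v
  have hlt : m ≤ 10 → G.edgeSet.ncard + 1 ≤ 2 * m := by
    intro hm10
    have h1 := h.le (by omega)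
    by_cases hmod : (m - 1) % 3 = 0
    · by_contra hcon
      have h2 : (G.neighborSet v).ncard = 2 := by omega
      have h3 : (G.within (S.erase v)).edgeSet.ncard = 2 * (m - 1) := by omega
      obtain ⟨x, y, hxy, hxyv⟩ := Set.ncard_eq_two.mp h2
      have hx : G.Adj v x := by
        change x ∈ G.neighborSet v
        rw [hxyv]; exact Or.inl rfl
      have hy : G.Adj v y := by
        change y ∈ G.neighborSet v
        rw [hxyv]; exact Or.inr rfl
      -- A path of length three between the two neighbours closes through `v` to a five-cycle.
      obtain ⟨p, q, e1, e2, e3, n1, n2⟩ := h.path3 (by omega) h3 x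
        (Finset.mem_erase.mpr ⟨hx.ne', hS _ _ hx.symm⟩) y
        (Finset.mem_erase.mpr ⟨hy.ne', hS _ _ hy.symm⟩) hxy
      exact hG v x p q y hx e1.1 e2.1 e3.1 hy.symm (Finset.ne_of_mem_erase e2.2.1).symm
        (Finset.ne_of_mem_erase e2.2.2).symm n1 hxy n2
    · have h2 := h.lt (by omega) hmod
      omega
  refine ⟨fun h1 => ?_, fun h1 _ => hlt h1, fun h1 => ?_, ?_, ?_, ?_⟩
  · have := hlt h1
    omega
  · rcases Nat.lt_or_ge 10 m with h2 | h2
    · have := h.large (by omega)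
      omega
    · have := hlt h2
      omega
  all_goals
    intro h1 h2
    have := hlt (by omega)
    omega

end SimpleGraph

namespace SimpleGraph

variable {V : Type*}

/-- A set of positive degree vertices without a cut vertex and with minimum degree three satisfies
the hypotheses of the discharging argument. -/
lemma unsplittable_of_forall_split [DecidableEq V] {G : SimpleGraph V} {S : Finset V}
    (hS : ∀ v w, G.Adj v w → v ∈ S)
    (h : ∀ z S₁ S₂, S₁ ∪ S₂ = S → S₁ ∩ S₂ = {z} →
      (∀ v w, G.Adj v w → (v ∈ S₁ ∧ w ∈ S₁) ∨ (v ∈ S₂ ∧ w ∈ S₂)) → S₁ = S ∨ S₂ = S) :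
    G.Unsplittable := by
  classical
  intro z A hzA ⟨d, hd⟩ ⟨e, he, hez⟩
  by_contra hcon
  push Not at hcon
  have hcross : ∀ v w, G.Adj v w → v ∈ A → w ∉ A → w = z := fun v w hvw hv hw =>
    hcon ⟨(v, w), hvw⟩ hv hw
  have hmem : ∀ g : G.Dart, g.fst ∈ S := fun g => hS _ _ g.adj
  by_cases hz : z ∈ S
  · rcases h z (S.filter fun v => v ∈ A ∨ v = z) (S.filter fun v => v ∉ A)
      (by
        ext v
        simp only [Finset.mem_union, Finset.mem_filter]
        tauto)
      (by
        ext v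
        simp only [Finset.mem_inter, Finset.mem_filter, Finset.mem_singleton]
        constructor
        · tauto
        · rintro rfl
          tauto)
      (by
        intro v w hvw
        simp only [Finset.mem_filter]
        have hv := hS _ _ hvw
        have hw := hS _ _ hvw.symm
        have h1 := hcross v w hvw
        have h2 := hcross w v hvw.symm
        tauto) with h' | h'
    · have := hmem e
      rw [← h', Finset.mem_filter] at this
      tauto
    · have := hmem d
      rw [← h', Finset.mem_filter] at this
      tauto
  · have hcross' : ∀ v w, G.Adj v w → v ∈ A → w ∈ A := by
      intro v w hvw hv
      by_contra hw
      have := hcross v w hvw hv hw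
      rw [← this] at hz
      exact hz (hS _ _ hvw.symm)
    -- If `z` is outside `S`, no edge leaves `A` at all. The two sides are then glued at a vertex of
    -- `A`, because a split has to share one point.
    rcases h d.fst (S.filter fun v => v ∈ A) (S.filter fun v => v ∉ A ∨ v = d.fst)
      (by
        ext v
        simp only [Finset.mem_union, Finset.mem_filter]
        tauto)
      (by
        ext v
        simp only [Finset.mem_inter, Finset.mem_filter, Finset.mem_singleton]
        constructor
        · tauto
        · rintro rfl
          have := hmem d
          tauto)
      (by
        intro v w hvw
        simp only [Finset.mem_filter]
        have hv := hS _ _ hvw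
        have hw := hS _ _ hvw.symm
        have h1 := hcross' v w hvw
        have h2 := hcross' w v hvw.symm
        tauto) with h' | h'
    · have := hmem e
      rw [← h', Finset.mem_filter] at this
      tauto
    · have h1 := hmem d.symm
      rw [← h', Finset.mem_filter] at h1
      have h2 := hcross' _ _ d.adj hd
      rcases h1.2 with h3 | h3
      · exact h3 h2
      · exact d.adj.ne' h3

lemma RotationSystem.next_next_ne_of_degree {G : SimpleGraph V} [Fintype G.Dart]
    (R : RotationSystem G) (d : G.Dart) (hdeg : 3 ≤ (G.neighborSet d.fst).ncard) :
    R.next (R.next d) ≠ d := by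
  classical
  intro h
  have hsub : G.neighborSet d.fst ⊆ {d.snd, (R.next d).snd} := by
    intro w hw
    obtain ⟨n, -, -, hn⟩ := (R.sameCycle_of_fst_eq d ⟨(d.fst, w), hw⟩ rfl).exists_pow_eq
    have key : ∀ n : ℕ, (R.next ^ n) d = d ∨ (R.next ^ n) d = R.next d := by
      intro n
      induction n with
      | zero => exact Or.inl rfl
      | succ n ih =>
        rw [pow_succ', Equiv.Perm.mul_apply]
        rcases ih with h' | h' <;> rw [h']
        · exact Or.inr rfl
        · exact Or.inl h
    have hsnd : (⟨(d.fst, w), hw⟩ : G.Dart).snd = w := rfl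
    rcases key n with h' | h' <;> rw [hn] at h'
    · left; rw [← hsnd, h']
    · right; rw [← hsnd, h']; rfl
  have h1 := Set.ncard_le_ncard hsub (Set.toFinite _)
  have h2 := Set.ncard_insert_le d.snd {(R.next d).snd}
  rw [Set.ncard_singleton] at h2
  omega

theorem IsFlat.sparse [Finite V] (m : ℕ) : ∀ (G : SimpleGraph V) (S : Finset V),
    S.card = m + 1 → (∀ v w, G.Adj v w → v ∈ S) → G.IsFlat → G.NoFiveCycle → G.Sparse S m := by
  classical
  have := Fintype.ofFinite V
  induction m using Nat.strong_induction_on with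
  | h m ih =>
    intro G S hcard hS hflat h5
    rcases Nat.lt_or_ge 3 m with hm | hm
    swap
    · exact sparse_of_le_three hm hcard hS
    have hsub : ∀ (T : Finset V) (k : ℕ), k < m → T.card = k + 1 → (G.within T).Sparse T k :=
      fun T k hk hT => ih k hk _ T hT (fun _ _ h => h.2.1) (hflat.mono (within_le _ _))
        (h5.mono (within_le _ _))
    by_cases hdeg : ∃ v ∈ S, (G.neighborSet v).ncard ≤ 2
    · obtain ⟨v, hv, hdeg⟩ := hdeg
      refine sparse_of_erase h5 hS hdeg (by omega) (hsub _ (m - 1) (by omega) ?_)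
      rw [Finset.card_erase_of_mem hv]
      omega
    push Not at hdeg
    by_cases hsplit : ∃ z S₁ S₂, S₁ ∪ S₂ = S ∧ S₁ ∩ S₂ = {z} ∧
      (∀ v w, G.Adj v w → (v ∈ S₁ ∧ w ∈ S₁) ∨ (v ∈ S₂ ∧ w ∈ S₂)) ∧ S₁ ≠ S ∧ S₂ ≠ S
    · obtain ⟨z, S₁, S₂, hu, hi, he, hn₁, hn₂⟩ := hsplit
      have hc := Finset.card_union_add_card_inter S₁ S₂
      rw [hu, hi, Finset.card_singleton, hcard] at hc
      have hlt₁ : S₁.card < S.card := Finset.card_lt_card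
        ((Finset.subset_union_left.trans_eq hu).ssubset_of_ne hn₁)
      have hlt₂ : S₂.card < S.card := Finset.card_lt_card
        ((Finset.subset_union_right.trans_eq hu).ssubset_of_ne hn₂)
      exact sparse_of_split (m₁ := S₁.card - 1) (m₂ := S₂.card - 1) hu hi he (by omega) (by omega)
        (by omega) (hsub _ _ (by omega) (by omega)) (hsub _ _ (by omega) (by omega))
    · have hun : G.Unsplittable := by
        refine unsplittable_of_forall_split hS ?_
        intro z S₁ S₂ hu hi he
        by_contra hcon
        push Not at hcon
        exact hsplit ⟨z, S₁, S₂, hu, hi, he, hcon.1, hcon.2⟩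
      obtain ⟨_, R, hR⟩ := hflat
      have hsupp : {v : V | ∃ w, G.Adj v w} = S := by
        ext v
        constructor
        · rintro ⟨w, hw⟩
          exact hS _ _ hw
        · intro hv
          have h1 := hdeg v hv
          have h2 : (G.neighborSet v).Nonempty := by
            rw [Set.nonempty_iff_ne_empty]
            intro h
            rw [h, Set.ncard_empty] at h1
            omega
          exact h2
      have hnn : ∀ d, R.next (R.next d) ≠ d := fun d =>
        R.next_next_ne_of_degree d (hdeg _ (hS _ _ d.adj))
      have hcore : R.IsCore := by
        refine ⟨hR, hun, fun d h => hnn d (by rw [h, h]), hnn, h5, ?_⟩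
        rw [hsupp, Set.ncard_coe_finset]
        omega
      have hb := hcore.edge_bound
      rw [hsupp, Set.ncard_coe_finset, hcard] at hb
      -- With m + 1 vertices the core bound reads 5 e ≤ 12 m - 21, which is less than 10 m for m ≤
      -- 10; so 2m is not attained.
      refine ⟨fun _ => by omega, fun _ _ => by omega, fun _ => by omega, ?_, ?_, ?_⟩ <;>
      · intro h1 h2
        omega

lemma noFiveCycle_of_free {G : SimpleGraph V} (h : (cycleGraph 5).Free G) : G.NoFiveCycle := by
  intro a b c d e h1 h2 h3 h4 h5 n1 n2 n3 n4 n5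
  apply h
  refine ⟨⟨⟨![a, b, c, d, e], ?_⟩, ?_⟩⟩
  · intro i j hij
    rw [cycleGraph_adj] at hij
    fin_cases i <;> fin_cases j <;>
      first
      | exact absurd hij (by decide)
      | assumption
      | (apply SimpleGraph.Adj.symm; assumption)
  · intro i j hij
    have e1 := h1.ne
    have e2 := h2.ne
    have e3 := h3.ne
    have e4 := h4.ne
    have e5 := h5.ne
    fin_cases i <;> fin_cases j <;>
      first
      | rfl
      | exact absurd hij ‹_›
      | exact absurd hij.symm ‹_›

/-- Planar graphs without a five-cycle have at most `(12 n - 33) / 5` edges. -/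
theorem IsPlanar.edge_bound [Finite V] {G : SimpleGraph V} (hn : 11 ≤ Nat.card V)
    (hG : G.IsPlanar) (hfree : (cycleGraph 5).Free G) :
    5 * G.edgeSet.ncard + 33 ≤ 12 * Nat.card V := by
  have := Fintype.ofFinite V
  rw [Nat.card_eq_fintype_card] at hn ⊢
  have := (IsFlat.sparse (Fintype.card V - 1) G Finset.univ (by rw [Finset.card_univ]; omega)
    (fun _ _ _ => Finset.mem_univ _) hG.isFlat (noFiveCycle_of_free hfree)).large (by omega)
  omega

lemma planarTuranNumber_bound {n : ℕ} (hn : 11 ≤ n) :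
    5 * planarTuranNumber n (cycleGraph 5) + 33 ≤ 12 * n := by
  classical
  have h : planarTuranNumber n (cycleGraph 5) ≤ (12 * n - 33) / 5 := by
    unfold planarTuranNumber
    refine Finset.sup_le fun G hG => ?_
    obtain ⟨h1, h2⟩ := (Finset.mem_filter.mp hG).2
    have := h1.edge_bound (by simpa using hn) h2
    rw [Nat.card_eq_fintype_card, Fintype.card_fin] at this
    omega
  omega

end SimpleGraph

/-! ### Lower bounds for orbit counts -/

namespace CombMap

open Equiv

lemma le_orbitCount {D X : Type*} [Finite D] [Fintype X] {π : Perm D} (f : D → X)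
    (hf : ∀ d, f (π d) = f d) (hs : Function.Surjective f) : Fintype.card X ≤ orbitCount π := by
  have hp : ∀ (n : ℕ) d, f ((π ^ n) d) = f d := by
    intro n
    induction n with
    | zero => simp
    | succ n ih => intro d; rw [pow_succ', Perm.mul_apply, hf, ih]
  have hc : ∀ d e, π.SameCycle d e → f d = f e := by
    intro d e h
    classical
    have := Fintype.ofFinite D
    obtain ⟨n, -, -, rfl⟩ := h.exists_pow_eq
    exact (hp n d).symm
  rw [orbitCount, ← Nat.card_eq_fintype_card]
  refine Nat.card_le_card_of_surjective
    (Quotient.lift (s := Perm.SameCycle.setoid π) f fun d e h => hc d e h) ?_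
  intro x
  obtain ⟨d, rfl⟩ := hs x
  exact ⟨Quotient.mk _ d, rfl⟩

-- Give weight 3 to fixed points and 1 to other points. Orbits have at most three points, so each
-- has weight at most 3.
open Classical in
lemma card_add_le_orbitCount {D : Type*} [Fintype D] {π : Perm D} (h : ∀ d, π (π (π d)) = d) :
    Fintype.card D + 2 * (Finset.univ.filter fun d => π d = d).card ≤ 3 * orbitCount π := by
  have : Fintype (Quotient (Perm.SameCycle.setoid π)) := Fintype.ofFinite _
  have hw : ∑ d : D, (1 + 2 * if π d = d then 1 else 0) =
      Fintype.card D + 2 * (Finset.univ.filter fun d => π d = d).card := by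
    rw [Finset.sum_add_distrib, ← Finset.mul_sum, Finset.sum_boole, Finset.sum_const,
      Finset.card_univ]
    simp
  rw [← hw, orbitCount, Nat.card_eq_fintype_card,
    ← Finset.sum_fiberwise (g := fun d => Quotient.mk (Perm.SameCycle.setoid π) d), mul_comm,
    ← smul_eq_mul, ← Finset.card_univ]
  refine Finset.sum_le_card_nsmul _ _ _ ?_
  intro q _
  induction q using Quotient.inductionOn with
  | h d =>
    have hsub : (Finset.univ.filter fun e => Quotient.mk (Perm.SameCycle.setoid π) e =
        Quotient.mk _ d) ⊆ {d, π d, π (π d)} := by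
      intro e he
      have he' : π.SameCycle d e := Perm.SameCycle.symm
        (Quotient.exact (s := Perm.SameCycle.setoid π) (Finset.mem_filter.mp he).2)
      obtain ⟨n, -, -, rfl⟩ := he'.exists_pow_eq
      simp only [Finset.mem_insert, Finset.mem_singleton]
      clear he he'
      induction n with
      | zero => exact Or.inl rfl
      | succ n ih =>
        rw [pow_succ', Perm.mul_apply]
        rcases ih with h' | h' | h' <;> rw [h']
        · exact Or.inr (Or.inl rfl)
        · exact Or.inr (Or.inr rfl)
        · exact Or.inl (h d)
    refine (Finset.sum_le_sum_of_subset hsub).trans ?_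
    by_cases hd : π d = d
    · simp [hd]
    · have h2 : ¬ π (π d) = π d := fun h' => hd (π.injective h')
      have h3 : ¬ π (π (π d)) = π (π d) := fun h' => h2 (π.injective h')
      have hle : ∑ e ∈ ({d, π d, π (π d)} : Finset D), (1 + 2 * if π e = e then 1 else 0) ≤
          ∑ e ∈ ({d, π d, π (π d)} : Finset D), 1 := by
        refine Finset.sum_le_sum fun e he => ?_
        simp only [Finset.mem_insert, Finset.mem_singleton] at he
        rcases he with rfl | rfl | rfl
        · rw [if_neg hd]
        · rw [if_neg h2]
        · rw [if_neg h3]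
      refine hle.trans ?_
      rw [Finset.sum_const, smul_eq_mul, mul_one]
      exact Finset.card_le_three

end CombMap

/-! ### Two rotations of order three on the torus lattice -/

namespace Lattice

variable (t : ℕ)

/-- The triangular lattice modulo `3 t`. -/
abbrev Torus : Type := ZMod (3 * t) × ZMod (3 * t)

variable {t}

/-- The rotations by a third of a turn about the two kinds of nodes. -/
def turn : Bool → Equiv.Perm (Torus t)
  | true => ⟨fun p => (p.2 + 1, -p.1 - p.2), fun p => (1 - p.1 - p.2, p.1 - 1),
      fun p => by ext <;> simp only <;> ring, fun p => by ext <;> simp only <;> ring⟩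
  | false => ⟨fun p => (p.2 + 1, -p.1 - p.2 - 1), fun p => (-p.1 - p.2, p.1 - 1),
      fun p => by ext <;> simp only <;> ring, fun p => by ext <;> simp only <;> ring⟩

lemma turn_true (p : Torus t) : turn true p = (p.2 + 1, -p.1 - p.2) := rfl

lemma turn_false (p : Torus t) : turn false p = (p.2 + 1, -p.1 - p.2 - 1) := rfl

lemma turn_three (s : Bool) (p : Torus t) : turn s (turn s (turn s p)) = p := by
  cases s <;> ext <;> simp only [turn_true, turn_false] <;> ring

lemma turn_symm (s : Bool) (p : Torus t) : (turn s).symm p = turn s (turn s p) := by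
  rw [Equiv.symm_apply_eq, turn_three]

/-- The composition is linear of order three, which makes the alternating faces hexagons, or digons
at its fixed points. -/
lemma turn_true_false (p : Torus t) : turn true (turn false p) = (-p.1 - p.2, p.1) := by
  ext <;> simp only [turn_true, turn_false] <;> ring

lemma turn_false_true (p : Torus t) :
    turn false (turn true p) = turn true (turn false p) + (1, -2) := by
  ext <;> simp only [turn_true, turn_false, Prod.fst_add, Prod.snd_add] <;> ring

/-- The class of a lattice point modulo the centres of the hexagons. -/
def cls (p : Torus t) : ZMod 3 :=
  ZMod.castHom (Dvd.intro t rfl : 3 ∣ 3 * t) (ZMod 3) (p.1 - p.2)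

/-- The change of the class under a rotation. -/
def sgn : Bool → ZMod 3
  | true => 1
  | false => -1

lemma three_eq_zero : (3 : ZMod 3) = 0 := by decide

lemma cls_turn (s : Bool) (p : Torus t) : cls (turn s p) = cls p + sgn s := by
  cases s <;> simp only [cls, sgn, turn_true, turn_false, map_sub, map_add, map_neg, map_one]
  · linear_combination (ZMod.castHom (Dvd.intro t rfl : 3 ∣ 3 * t) (ZMod 3) p.2 + 1) * three_eq_zero
  · linear_combination ZMod.castHom (Dvd.intro t rfl : 3 ∣ 3 * t) (ZMod 3) p.2 * three_eq_zero

lemma sgn_ne_zero (s : Bool) : sgn s ≠ 0 := by cases s <;> decide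

lemma turn_ne (s : Bool) (p : Torus t) : turn s p ≠ p := by
  intro h
  have := cls_turn s p
  rw [h] at this
  exact sgn_ne_zero s (by simpa using this)

lemma turn_turn_ne (s : Bool) (p : Torus t) : turn s (turn s p) ≠ p := by
  intro h
  have := congrArg (turn s) h
  rw [turn_three] at this
  exact turn_ne s p this.symm

lemma one_ne_zero' : (1 : ZMod (3 * t)) ≠ 0 := by
  intro h
  have := congrArg (ZMod.castHom (Dvd.intro t rfl : 3 ∣ 3 * t) (ZMod 3)) h
  rw [map_one, map_zero] at this
  exact absurd this (by decide)

lemma turn_true_ne_false (p : Torus t) : turn true p ≠ turn false p := by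
  intro h
  have := congrArg Prod.snd h
  simp only [turn_true, turn_false] at this
  exact one_ne_zero' (by linear_combination this)

lemma turn_comm_ne (p : Torus t) : turn false (turn true p) ≠ turn true (turn false p) := by
  rw [turn_false_true]
  intro h
  have := congrArg Prod.fst h
  simp only [Prod.fst_add] at this
  exact one_ne_zero' (by linear_combination this)

/-- The centres of the digons. -/
def IsApex (p : Torus t) : Prop := turn true (turn false p) = p

lemma isApex_iff (p : Torus t) : IsApex p ↔ p.2 = p.1 ∧ 3 * p.1 = 0 := by
  rw [IsApex, turn_true_false, Prod.ext_iff]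
  constructor
  · rintro ⟨h1, h2⟩
    simp only at h1 h2
    exact ⟨h2.symm, by linear_combination -h1 + h2⟩
  · rintro ⟨h1, h2⟩
    exact ⟨by simp only [h1]; linear_combination -h2, by simp only [h1]⟩

lemma IsApex.cls_eq {p : Torus t} (h : IsApex p) : cls p = 0 := by
  rw [isApex_iff] at h
  rw [cls, h.1, sub_self, map_zero]

open Classical in
/-- The point of class `0` on the orbit of a rotation. -/
noncomputable def rep (s : Bool) (p : Torus t) : Torus t :=
  if cls p = 0 then p else if cls (turn s p) = 0 then turn s p else turn s (turn s p)

lemma rep_of_cls {s : Bool} {p : Torus t} (h : cls p = 0) : rep s p = p := if_pos h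

lemma zmod_three_cases (s : Bool) (c : ZMod 3) :
    (c = 0 ∧ c + sgn s ≠ 0 ∧ c + sgn s + sgn s ≠ 0) ∨
    (c ≠ 0 ∧ c + sgn s = 0 ∧ c + sgn s + sgn s ≠ 0) ∨
    (c ≠ 0 ∧ c + sgn s ≠ 0 ∧ c + sgn s + sgn s = 0) := by
  revert c; cases s <;> decide

lemma rep_turn (s : Bool) (p : Torus t) : rep s (turn s p) = rep s p := by
  simp only [rep, cls_turn, turn_three]
  rcases zmod_three_cases s (cls p) with ⟨h1, h2, h3⟩ | ⟨h1, h2, h3⟩ | ⟨h1, h2, h3⟩ <;>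
    split_ifs <;> first | rfl | contradiction

lemma cls_rep (s : Bool) (p : Torus t) : cls (rep s p) = 0 := by
  unfold rep
  split_ifs with h1 h2
  · exact h1
  · exact h2
  · rw [cls_turn] at h2
    rw [cls_turn, cls_turn]
    rcases zmod_three_cases s (cls p) with ⟨h3, -, -⟩ | ⟨-, h3, -⟩ | ⟨-, -, h3⟩
    · exact absurd h3 h1
    · exact absurd h3 h2
    · exact h3

lemma rep_cases (s : Bool) (p : Torus t) :
    rep s p = p ∨ rep s p = turn s p ∨ rep s p = turn s (turn s p) := by
  unfold rep
  split_ifs <;> simp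

lemma eq_of_rep_eq {s : Bool} {p q : Torus t} (h : rep s p = rep s q) :
    q = p ∨ q = turn s p ∨ q = turn s (turn s p) := by
  rcases rep_cases s p with h1 | h1 | h1 <;> rcases rep_cases s q with h2 | h2 | h2 <;>
    rw [h1, h2] at h
  · exact Or.inl h.symm
  · exact Or.inr (Or.inr (by rw [h, turn_three]))
  · exact Or.inr (Or.inl (by rw [h, turn_three]))
  · exact Or.inr (Or.inl h.symm)
  · exact Or.inl ((turn s).injective h.symm)
  · exact Or.inr (Or.inr (by rw [h, turn_three]))
  · exact Or.inr (Or.inr h.symm)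
  · exact Or.inr (Or.inl ((turn s).injective h.symm))
  · exact Or.inl ((turn s).injective ((turn s).injective h.symm))

/-- Points joined by rotations of both kinds lie on a digon. -/
lemma isApex_of_rep_eq {p q : Torus t} (hne : p ≠ q) (h : ∀ s, rep s p = rep s q) (s : Bool) :
    IsApex (rep s p) := by
  have h1 := eq_of_rep_eq (h true)
  have h2 := eq_of_rep_eq (h false)
  have hinv : ∀ x : Torus t, IsApex x → ∀ s, IsApex (rep s x) := by
    intro x hx s
    rwa [rep_of_cls hx.cls_eq]
  rcases h1 with h1 | h1 | h1
  · exact absurd h1.symm hne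
  · rcases h2 with h2 | h2 | h2
    · exact absurd h2.symm hne
    · exact absurd (h1.symm.trans h2) (turn_true_ne_false p)
    · have h3 : turn false q = p := by rw [h2, turn_three]
      have hq : IsApex q := by rw [IsApex, h3, h1]
      rw [h s]
      exact hinv q hq s
  · rcases h2 with h2 | h2 | h2
    · exact absurd h2.symm hne
    · have hp : IsApex p := by rw [IsApex, ← h2, h1, turn_three]
      exact hinv p hp s
    · have h3 : turn true q = turn false q := by rw [h1, turn_three, ← h1, h2, turn_three]
      exact absurd h3 (turn_true_ne_false q)

/-- There are no closed alternating words of length four. -/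
lemma no_alternating_cycle {p₀ p₁ p₂ p₃ : Torus t} (h02 : p₀ ≠ p₂)
    (h0 : p₁ = turn true p₀ ∨ p₀ = turn true p₁) (h1 : p₂ = turn false p₁ ∨ p₁ = turn false p₂)
    (h2 : p₃ = turn true p₂ ∨ p₂ = turn true p₃) (h3 : p₀ = turn false p₃ ∨ p₃ = turn false p₀) :
    False := by
  -- The composition has order three, so a fixed point of its square is a fixed point.
  have hAB : ∀ p : Torus t, turn true (turn false (turn true (turn false p))) = p →
      turn true (turn false p) = p := by
    intro p h
    rw [turn_true_false, turn_true_false, Prod.ext_iff] at h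
    rw [turn_true_false]
    simp only at h
    ext
    · simp only; linear_combination h.2 + h.1
    · simp only; linear_combination -h.1
  have c := cls_turn (t := t)
  have key : ∀ (b : Bool) (p q : Torus t), p = turn b q → cls p = cls q + sgn b := by
    rintro b _ q rfl
    exact c b q
  rcases h0 with h0 | h0 <;> rcases h1 with h1 | h1 <;> rcases h2 with h2 | h2 <;>
    rcases h3 with h3 | h3 <;> have k0 := key _ _ _ h0 <;> have k1 := key _ _ _ h1 <;>
    have k2 := key _ _ _ h2 <;> have k3 := key _ _ _ h3 <;>
    simp only [sgn] at k0 k1 k2 k3 <;>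
    generalize cls p₀ = c₀ at * <;> generalize cls p₁ = c₁ at * <;>
    generalize cls p₂ = c₂ at * <;> generalize cls p₃ = c₃ at *
  -- Each step changes the class by ±1 modulo 3, so closing after four steps needs two of each sign.
  -- Six sign patterns remain: two are squares of the composition, four say that the rotations
  -- commute at a point.
  all_goals try (exfalso; clear hAB key c h02 h0 h1 h2 h3; revert c₀ c₁ c₂ c₃; decide)
  · have h4 := hAB p₃ (by rw [← h3, ← h0, ← h1, ← h2])
    rw [← h3, h2] at h4
    exact h02 ((turn true).injective h4)
  · exact turn_comm_ne p₀ (by rw [← h3, ← h0, ← h1, ← h2])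
  · exact turn_comm_ne p₃ (by rw [← h2, ← h3, ← h1, ← h0])
  · exact turn_comm_ne p₁ (by rw [← h0, ← h1, ← h2, ← h3])
  · exact turn_comm_ne p₂ (by rw [← h1, ← h0, ← h2, ← h3])
  · have h4 := hAB p₀ (by rw [← h3, ← h2, ← h1, ← h0])
    rw [← h3, ← h2] at h4
    exact h02 h4.symm

end Lattice

/-! ### The extremal graph and the absence of five-cycles -/

namespace Lattice

variable {t : ℕ}

/-- The points of the lattice and the possible centres of `K₄` blocks. -/
abbrev Site (t : ℕ) : Type := Torus t ⊕ (Bool × Torus t)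

/-- The sites that are vertices of the graph: the blocks at a digon have no centre. -/
def Valid : Site t → Prop
  | Sum.inl _ => True
  | Sum.inr (_, c) => cls c = 0 ∧ ¬ IsApex c

/-- The block of the given kind that contains a site. -/
noncomputable def block (s : Bool) : Site t → Option (Torus t)
  | Sum.inl p => some (rep s p)
  | Sum.inr (s', c) => if s = s' then some c else none

/-- The vertices of the extremal graph. -/
abbrev Vert (t : ℕ) : Type := {u : Site t // Valid u}

/-- The extremal graph: two vertices are adjacent if they lie in a common block. -/
def extremal (t : ℕ) : SimpleGraph (Vert t) where
  Adj u v := u ≠ v ∧ ∃ s c, block s u.1 = some c ∧ block s v.1 = some c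
  symm := ⟨fun _ _ h => ⟨h.1.symm, by
    obtain ⟨-, s, c, h1, h2⟩ := h
    exact ⟨s, c, h2, h1⟩⟩⟩
  loopless := ⟨fun _ h => h.1 rfl⟩

lemma block_inl {s : Bool} {p c : Torus t} : block s (Sum.inl p) = some c ↔ rep s p = c := by
  simp [block]

lemma block_inr {s s' : Bool} {p c : Torus t} :
    block s (Sum.inr (s', p)) = some c ↔ s = s' ∧ p = c := by
  simp [block]

lemma block_cases {s : Bool} {c : Torus t} {u : Site t} (h : block s u = some c) :
    u = Sum.inr (s, c) ∨ u = Sum.inl c ∨ u = Sum.inl (turn s c) ∨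
      u = Sum.inl (turn s (turn s c)) := by
  rcases u with p | ⟨s', p⟩
  · rw [block_inl] at h
    right
    have h1 : rep s c = rep s p := by rw [rep_of_cls (by rw [← h]; exact cls_rep s p), h]
    rcases eq_of_rep_eq h1 with h2 | h2 | h2
    · exact Or.inl (by rw [h2])
    · exact Or.inr (Or.inl (by rw [h2]))
    · exact Or.inr (Or.inr (by rw [h2]))
  · rw [block_inr] at h
    rw [h.1, h.2]
    exact Or.inl rfl

lemma block_unique {s : Bool} {c c' : Torus t} {u : Site t} (h : block s u = some c)
    (h' : block s u = some c') : c = c' := Option.some.inj (h.symm.trans h')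

lemma exists_inl {s s' : Bool} (hs : s ≠ s') {c c' : Torus t} {u : Site t}
    (h : block s u = some c) (h' : block s' u = some c') :
    ∃ p, u = Sum.inl p ∧ rep s p = c ∧ rep s' p = c' := by
  rcases u with p | ⟨s'', p⟩
  · exact ⟨p, rfl, block_inl.mp h, block_inl.mp h'⟩
  · exact absurd ((block_inr.mp h).1.trans (block_inr.mp h').1.symm) hs

lemma isApex_of_two_blocks {s s' : Bool} (hs : s ≠ s') {c c' : Torus t} {u v : Site t}
    (hne : u ≠ v) (hu : block s u = some c) (hu' : block s' u = some c')
    (hv : block s v = some c) (hv' : block s' v = some c') : IsApex c ∧ IsApex c' := by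
  obtain ⟨p, rfl, h1, h2⟩ := exists_inl hs hu hu'
  obtain ⟨q, rfl, h3, h4⟩ := exists_inl hs hv hv'
  have hpq : p ≠ q := fun h => hne (by rw [h])
  have hall : ∀ b, rep b p = rep b q := by
    intro b
    have : b = s ∨ b = s' := by
      revert hs; cases s <;> cases s' <;> cases b <;> decide
    rcases this with rfl | rfl
    · rw [h1, h3]
    · rw [h2, h4]
  exact ⟨h1 ▸ isApex_of_rep_eq hpq hall s, h2 ▸ isApex_of_rep_eq hpq hall s'⟩

lemma not_isApex_of_four {s : Bool} {c : Torus t} {u₁ u₂ u₃ u₄ : Vert t}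
    (h₁ : block s u₁.1 = some c) (h₂ : block s u₂.1 = some c) (h₃ : block s u₃.1 = some c)
    (h₄ : block s u₄.1 = some c) (h12 : u₁ ≠ u₂) (h13 : u₁ ≠ u₃) (h14 : u₁ ≠ u₄) (h23 : u₂ ≠ u₃)
    (h24 : u₂ ≠ u₄) (h34 : u₃ ≠ u₄) : ¬ IsApex c := by
  classical
  intro hc
  have hmem : ∀ u : Vert t, block s u.1 = some c →
      u.1 ∈ ({Sum.inl c, Sum.inl (turn s c), Sum.inl (turn s (turn s c))} : Finset (Site t)) := by
    intro u hu
    rcases block_cases hu with h | h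
    · have := u.2
      rw [h] at this
      exact absurd hc this.2
    · simpa using h
  have hsub : ({u₁.1, u₂.1, u₃.1, u₄.1} : Finset (Site t)) ⊆
      {Sum.inl c, Sum.inl (turn s c), Sum.inl (turn s (turn s c))} := by
    intro x hx
    simp only [Finset.mem_insert, Finset.mem_singleton] at hx
    rcases hx with rfl | rfl | rfl | rfl
    · exact hmem _ h₁
    · exact hmem _ h₂
    · exact hmem _ h₃
    · exact hmem _ h₄
  have hcard := Finset.card_le_card hsub
  have h3 := Finset.card_le_three (a := (Sum.inl c : Site t)) (b := Sum.inl (turn s c))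
    (c := Sum.inl (turn s (turn s c)))
  have hv : ∀ {a b : Vert t}, a ≠ b → a.1 ≠ b.1 := fun h h' => h (Subtype.ext h')
  rw [Finset.card_insert_of_notMem (by simp [hv h12, hv h13, hv h14]),
    Finset.card_insert_of_notMem (by simp [hv h23, hv h24]),
    Finset.card_insert_of_notMem (by simp [hv h34]), Finset.card_singleton] at hcard
  omega

lemma not_five {s : Bool} {c : Torus t} {u₁ u₂ u₃ u₄ u₅ : Vert t}
    (h₁ : block s u₁.1 = some c) (h₂ : block s u₂.1 = some c) (h₃ : block s u₃.1 = some c)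
    (h₄ : block s u₄.1 = some c) (h₅ : block s u₅.1 = some c)
    (hnd : [u₁, u₂, u₃, u₄, u₅].Nodup) : False := by
  classical
  have hsub : ([u₁, u₂, u₃, u₄, u₅].map Subtype.val).toFinset ⊆
      ({Sum.inr (s, c), Sum.inl c, Sum.inl (turn s c), Sum.inl (turn s (turn s c))} :
        Finset (Site t)) := by
    intro x hx
    simp only [List.map_cons, List.map_nil, List.mem_toFinset, List.mem_cons, List.not_mem_nil,
      or_false] at hx
    simp only [Finset.mem_insert, Finset.mem_singleton]
    rcases hx with rfl | rfl | rfl | rfl | rfl <;> exact block_cases ‹_›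
  have hcard := Finset.card_le_card hsub
  rw [List.toFinset_card_of_nodup (hnd.map Subtype.val_injective)] at hcard
  have := hcard.trans Finset.card_le_four
  simp at this

lemma eq_not {s s' : Bool} (h : s' ≠ s) : s' = !s := by
  revert h; cases s <;> cases s' <;> decide

lemma alternating {s : Bool} {p q : Torus t} (hne : p ≠ q) (h : rep s p = rep s q) :
    q = turn s p ∨ p = turn s q := by
  rcases eq_of_rep_eq h with h | h | h
  · exact absurd h.symm hne
  · exact Or.inl h
  · exact Or.inr (by rw [h, turn_three])

lemma no_alternating_blocks {u₀ u₁ u₂ u₃ : Site t} {c₀ c₁ c₂ c₃ : Torus t} {s : Bool}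
    (h01 : u₀ ≠ u₁) (h12 : u₁ ≠ u₂) (h23 : u₂ ≠ u₃) (h30 : u₃ ≠ u₀) (h02 : u₀ ≠ u₂)
    (h13 : u₁ ≠ u₃)
    (a0 : block s u₀ = some c₀) (b0 : block s u₁ = some c₀)
    (a1 : block (!s) u₁ = some c₁) (b1 : block (!s) u₂ = some c₁)
    (a2 : block s u₂ = some c₂) (b2 : block s u₃ = some c₂)
    (a3 : block (!s) u₃ = some c₃) (b3 : block (!s) u₀ = some c₃) : False := by
  have hs : s ≠ !s := by cases s <;> decide
  obtain ⟨p₀, rfl, d0, e0⟩ := exists_inl hs a0 b3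
  obtain ⟨p₁, rfl, d1, e1⟩ := exists_inl hs b0 a1
  obtain ⟨p₂, rfl, d2, e2⟩ := exists_inl hs a2 b1
  obtain ⟨p₃, rfl, d3, e3⟩ := exists_inl hs b2 a3
  have hp : ∀ {p q : Torus t}, (Sum.inl p : Site t) ≠ Sum.inl q → p ≠ q := fun h h' => h (by rw [h'])
  have k0 := alternating (hp h01) (d0.trans d1.symm)
  have k1 := alternating (hp h12) (e1.trans e2.symm)
  have k2 := alternating (hp h23) (d2.trans d3.symm)
  have k3 := alternating (hp h30) (e3.trans e0.symm)
  cases s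
  · exact no_alternating_cycle (hp h13) k1 k2 k3 k0
  · exact no_alternating_cycle (hp h02) k0 k1 k2 k3

/-- The edges `ab` and `bc` share `b` and their kind, hence their block. The kinds of the other
three edges then put all five vertices in one block, or four vertices in a block that also shares
two points with one of the other kind (impossible, as blocks at digons lack their centre), or give a
closed alternating walk `a`, `c`, `d`, `e`. -/
lemma no_five_of_consecutive {a b c d e : Vert t} {s s₂ s₃ s₄ : Bool} {q q' q₂ q₃ q₄ : Torus t}
    (hnd : [a, b, c, d, e].Nodup)
    (ha : block s a.1 = some q) (hb : block s b.1 = some q) (hb' : block s b.1 = some q')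
    (hc : block s c.1 = some q')
    (hc₂ : block s₂ c.1 = some q₂) (hd₂ : block s₂ d.1 = some q₂)
    (hd₃ : block s₃ d.1 = some q₃) (he₃ : block s₃ e.1 = some q₃)
    (he₄ : block s₄ e.1 = some q₄) (ha₄ : block s₄ a.1 = some q₄) : False := by
  obtain rfl := block_unique hb hb'
  have hn := hnd
  simp only [List.nodup_cons, List.mem_cons, List.not_mem_nil, or_false, not_or, not_false_eq_true,
    List.nodup_nil, and_true] at hn
  obtain ⟨⟨hab, hac, had, hae⟩, ⟨hbc, hbd, hbe⟩, ⟨hcd, hce⟩, hde⟩ := hn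
  have hv : ∀ {a b : Vert t}, a ≠ b → a.1 ≠ b.1 := fun h h' => h (Subtype.ext h')
  by_cases h2 : s₂ = s
  · subst h2
    obtain rfl := block_unique hc hc₂
    have hap := not_isApex_of_four ha hb hc hd₂ hab hac had hbc hbd hcd
    by_cases h3 : s₃ = s₂
    · subst h3
      obtain rfl := block_unique hd₂ hd₃
      exact not_five ha hb hc hd₂ he₃ hnd
    by_cases h4 : s₄ = s₂
    · subst h4
      obtain rfl := block_unique ha ha₄
      exact not_five ha hb hc hd₂ he₄ hnd
    obtain rfl : s₃ = s₄ := (eq_not h3).trans (eq_not h4).symm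
    obtain rfl := block_unique he₃ he₄
    exact hap (isApex_of_two_blocks (Ne.symm h3) (hv had) ha ha₄ hd₂ hd₃).1
  by_cases h4 : s₄ = s
  · subst h4
    obtain rfl := block_unique ha ha₄
    have hap := not_isApex_of_four ha hb hc he₄ hab hac hae hbc hbe hce
    by_cases h3 : s₃ = s₄
    · subst h3
      obtain rfl := block_unique he₃ he₄
      exact not_five ha hb hc hd₃ he₄ hnd
    obtain rfl : s₂ = s₃ := (eq_not h2).trans (eq_not h3).symm
    obtain rfl := block_unique hd₂ hd₃
    exact hap (isApex_of_two_blocks (Ne.symm h2) (hv hce) hc hc₂ he₄ he₃).1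
  obtain rfl : s₂ = s₄ := (eq_not h2).trans (eq_not h4).symm
  by_cases h3 : s₃ = s
  · subst h3
    obtain rfl := eq_not h2
    exact no_alternating_blocks (hv hac) (hv hcd) (hv hde) (hv (Ne.symm hae)) (hv had) (hv hce)
      ha hc hc₂ hd₂ hd₃ he₃ he₄ ha₄
  · obtain rfl : s₃ = s₂ := (eq_not h3).trans (eq_not h2).symm
    obtain rfl := block_unique hd₂ hd₃
    obtain rfl := block_unique he₃ he₄
    exact not_isApex_of_four hc₂ hd₂ he₃ ha₄ hcd hce (Ne.symm hac) hde (Ne.symm had) (Ne.symm hae)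
      (isApex_of_two_blocks (Ne.symm h2) (hv hac) ha ha₄ hc hc₂).2

lemma extremal_noFiveCycle : (extremal t).NoFiveCycle := by
  rintro a b c d e ⟨hab, s₁, q₁, x₁, y₁⟩ ⟨hbc, s₂, q₂, x₂, y₂⟩ ⟨hcd, s₃, q₃, x₃, y₃⟩
    ⟨hde, s₄, q₄, x₄, y₄⟩ ⟨hea, s₅, q₅, x₅, y₅⟩ hac had hbd hbe hce
  have hnd : [a, b, c, d, e].Nodup := by
    simp [hab, hac, had, Ne.symm hea, hbc, hbd, hbe, hcd, hce, hde]
  have hrot : ∀ {a b c d e : Vert t}, [a, b, c, d, e].Nodup → [b, c, d, e, a].Nodup := by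
    intro a b c d e h
    exact (List.nodup_rotate (n := 1)).mpr h
  by_cases h12 : s₁ = s₂
  · subst h12
    exact no_five_of_consecutive hnd x₁ y₁ x₂ y₂ x₃ y₃ x₄ y₄ x₅ y₅
  by_cases h23 : s₂ = s₃
  · subst h23
    exact no_five_of_consecutive (hrot hnd) x₂ y₂ x₃ y₃ x₄ y₄ x₅ y₅ x₁ y₁
  by_cases h34 : s₃ = s₄
  · subst h34
    exact no_five_of_consecutive (hrot (hrot hnd)) x₃ y₃ x₄ y₄ x₅ y₅ x₁ y₁ x₂ y₂
  by_cases h45 : s₄ = s₅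
  · subst h45
    exact no_five_of_consecutive (hrot (hrot (hrot hnd))) x₄ y₄ x₅ y₅ x₁ y₁ x₂ y₂ x₃ y₃
  -- Two kinds cannot alternate around a cycle of odd length.
  have h51 : s₅ = s₁ := by
    clear * - h12 h23 h34 h45
    revert h12 h23 h34 h45
    cases s₁ <;> cases s₂ <;> cases s₃ <;> cases s₄ <;> cases s₅ <;> decide
  subst h51
  exact no_five_of_consecutive (hrot (hrot (hrot (hrot hnd)))) x₅ y₅ x₁ y₁ x₂ y₂ x₃ y₃ x₄ y₄

end Lattice

/-! ### Counting lattice points, and the full map on the sphere -/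

namespace Lattice

open Finset

variable {t : ℕ}

open Classical in
lemma card_filter_rep [NeZero t] (s : Bool) (P : Torus t → Prop) :
    #{p : Torus t | P (rep s p)} = 3 * #{c : Torus t | cls c = 0 ∧ P c} := by
  rw [card_eq_sum_card_fiberwise (f := rep s) (t := ({c | cls c = 0 ∧ P c} : Finset (Torus t)))]
  · refine (sum_const_nat fun c hc => ?_).trans (mul_comm _ 3)
    obtain ⟨hc1, hc2⟩ := (mem_filter.mp hc).2
    have : (({p : Torus t | P (rep s p)} : Finset (Torus t)).filter fun p => rep s p = c) =
        {c, turn s c, turn s (turn s c)} := by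
      ext p
      simp only [mem_filter, mem_univ, true_and, mem_insert, mem_singleton]
      constructor
      · rintro ⟨-, h⟩
        exact eq_of_rep_eq ((rep_of_cls hc1).trans h.symm)
      · intro h
        have : rep s p = c := by
          rcases h with rfl | rfl | rfl <;> simp only [rep_turn, rep_of_cls hc1]
        exact ⟨this ▸ hc2, this⟩
    rw [this, card_insert_of_notMem, card_insert_of_notMem, card_singleton]
    · simpa using (turn_ne s (turn s c)).symm
    · simpa using ⟨(turn_ne s c).symm, (turn_turn_ne s c).symm⟩
  · intro p hp
    simp only [coe_filter, mem_univ, true_and, Set.mem_ofPred_eq] at hp ⊢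
    exact ⟨cls_rep s p, hp⟩

lemma card_torus [NeZero t] : Fintype.card (Torus t) = 9 * t ^ 2 := by
  rw [Fintype.card_prod, ZMod.card]
  ring

open Classical in
lemma card_isApex [NeZero t] : #{p : Torus t | IsApex p} = 3 := by
  have ht : 0 < t := Nat.pos_of_ne_zero (NeZero.ne t)
  have : ({p : Torus t | IsApex p} : Finset (Torus t)) =
      (range 3).image fun k : ℕ => (((k * t : ℕ) : ZMod (3 * t)), ((k * t : ℕ) : ZMod (3 * t))) := by
    ext ⟨x, y⟩
    simp only [mem_filter, mem_univ, true_and, isApex_iff, mem_image, mem_range, Prod.mk.injEq]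
    constructor
    · rintro ⟨rfl, h⟩
      have h1 : ((3 * y.val : ℕ) : ZMod (3 * t)) = 0 := by
        push_cast
        rwa [ZMod.natCast_zmod_val]
      rw [ZMod.natCast_eq_zero_iff] at h1
      obtain ⟨k, hk⟩ := Nat.dvd_of_mul_dvd_mul_left (by norm_num) h1
      have hlt := ZMod.val_lt y
      have hy : ((k * t : ℕ) : ZMod (3 * t)) = y := by
        rw [mul_comm k t, ← hk, ZMod.natCast_zmod_val]
      exact ⟨k, by nlinarith, hy, hy⟩
    · rintro ⟨k, -, rfl, rfl⟩
      refine ⟨rfl, ?_⟩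
      have : ((3 * (k * t) : ℕ) : ZMod (3 * t)) = 0 := by
        rw [ZMod.natCast_eq_zero_iff]
        exact ⟨k, by ring⟩
      simpa using this
  rw [this, card_image_of_injOn, card_range]
  intro k hk l hl h
  simp only [coe_range, Set.mem_Iio] at hk hl
  have h1 := congrArg Prod.fst h
  simp only [ZMod.natCast_eq_natCast_iff] at h1
  have h2 := Nat.ModEq.eq_of_lt_of_lt h1 (by nlinarith) (by nlinarith)
  exact Nat.eq_of_mul_eq_mul_right ht h2

open Classical in
lemma card_cls_eq_zero [NeZero t] : #{c : Torus t | cls c = 0} = 3 * t ^ 2 := by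
  have h := card_filter_rep (t := t) true fun _ => True
  simp only [and_true, filter_true, card_univ, card_torus] at h
  omega

open Classical in
lemma card_centre [NeZero t] :
    #{c : Torus t | cls c = 0 ∧ ¬ IsApex c} + 3 = 3 * t ^ 2 := by
  rw [← card_cls_eq_zero, ← card_filter_add_card_filter_not (s := {c : Torus t | cls c = 0}) IsApex,
    filter_filter, filter_filter, add_comm]
  congr 1
  refine card_isApex.symm.trans (congrArg card ?_)
  ext p
  simp only [mem_filter, mem_univ, true_and]
  exact ⟨fun h => ⟨h.cls_eq, h⟩, fun h => h.2⟩

open Classical in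
lemma card_not_isApex [NeZero t] : #{p : Torus t | ¬ IsApex p} + 3 = 9 * t ^ 2 := by
  rw [← card_torus, ← card_univ, ← card_filter_add_card_filter_not (s := univ) IsApex, card_isApex,
    add_comm]

open Classical in
lemma card_not_isApex_symm [NeZero t] (s : Bool) :
    #{p : Torus t | ¬ IsApex ((turn s).symm p)} + 3 = 9 * t ^ 2 := by
  rw [← card_not_isApex]
  congr 1
  refine card_equiv (turn s).symm ?_
  simp

/-- The darts of the map obtained by drawing a `K₄` in every block: the darts `0` and `2` at a
lattice point go along the block of the given kind, forwards and backwards, the dart `1` goes to its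
centre, and the dart `3` comes from there. -/
abbrev Flag (t : ℕ) : Type := Torus t × Bool × Fin 4

/-- The vertex rotation of the full map. -/
def rot : Equiv.Perm (Flag t) where
  toFun
    | (p, s, 0) => (p, s, 1)
    | (p, s, 1) => (p, s, 2)
    | (p, s, 2) => (p, !s, 0)
    | (p, s, 3) => (turn s p, s, 3)
  invFun
    | (p, s, 0) => (p, !s, 2)
    | (p, s, 1) => (p, s, 0)
    | (p, s, 2) => (p, s, 1)
    | (p, s, 3) => ((turn s).symm p, s, 3)
  left_inv := by
    rintro ⟨p, s, k⟩
    fin_cases k <;> simp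
  right_inv := by
    rintro ⟨p, s, k⟩
    fin_cases k <;> simp

/-- The reversal of flags. -/
def rev : Flag t → Flag t
  | (p, s, 0) => (turn s p, s, 2)
  | (p, s, 1) => (p, s, 3)
  | (p, s, 2) => ((turn s).symm p, s, 0)
  | (p, s, 3) => (p, s, 1)

lemma rev_involutive : Function.Involutive (rev (t := t)) := by
  rintro ⟨p, s, k⟩
  fin_cases k <;> simp [rev]

/-- The edge involution of the full map. -/
def edgePerm : Equiv.Perm (Flag t) := rev_involutive.toPerm

lemma edgePerm_apply (d : Flag t) : edgePerm d = rev d := rfl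

lemma edgePerm_edgePerm (d : Flag t) : edgePerm (edgePerm d) = d := rev_involutive d

/-- The starting point of a flag. -/
noncomputable def src : Flag t → Site t
  | (p, _, 0) => Sum.inl p
  | (p, _, 1) => Sum.inl p
  | (p, _, 2) => Sum.inl p
  | (p, s, 3) => Sum.inr (s, rep s p)

lemma src_rot (d : Flag t) : src (rot d) = src d := by
  obtain ⟨p, s, k⟩ := d
  fin_cases k
  · rfl
  · rfl
  · rfl
  · exact congrArg (fun c => Sum.inr (s, c)) (rep_turn s p)

lemma sameCycle_rot_iff {d e : Flag t} : rot.SameCycle d e ↔ src d = src e := by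
  constructor
  · intro h
    obtain ⟨n, rfl⟩ := h
    have hp : ∀ (n : ℕ) (d : Flag t), src ((rot ^ n) d) = src d := by
      intro n
      induction n with
      | zero => simp
      | succ n ih => intro d; rw [pow_succ', Equiv.Perm.mul_apply, src_rot, ih]
    rcases n with n | n
    · simpa using (hp n d).symm
    · have := hp (n + 1) ((rot ^ Int.negSucc n) d)
      rw [← this, ← Equiv.Perm.mul_apply, zpow_negSucc, mul_inv_cancel, Equiv.Perm.one_apply]
  · have hone : ∀ d : Flag t, rot.SameCycle d (rot d) := fun d => ⟨1, by simp⟩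
    have h0 : ∀ p : Torus t, ∀ s k, k ≠ 3 → rot.SameCycle (p, true, 0) (p, s, k) := by
      intro p s k hk
      have ht1 : rot.SameCycle ((p, true, 0) : Flag t) (p, true, 1) := hone _
      have ht2 : rot.SameCycle ((p, true, 0) : Flag t) (p, true, 2) := ht1.trans (hone _)
      have hf0 : rot.SameCycle ((p, true, 0) : Flag t) (p, false, 0) := ht2.trans (hone _)
      have hf1 : rot.SameCycle ((p, true, 0) : Flag t) (p, false, 1) := hf0.trans (hone _)
      have hf2 : rot.SameCycle ((p, true, 0) : Flag t) (p, false, 2) := hf1.trans (hone _)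
      fin_cases k
      · cases s
        · exact hf0
        · exact Equiv.Perm.SameCycle.rfl
      · cases s
        · exact hf1
        · exact ht1
      · cases s
        · exact hf2
        · exact ht2
      · exact absurd rfl hk
    have h3 : ∀ (p q : Torus t) s, rep s p = rep s q →
        rot.SameCycle ((p, s, 3) : Flag t) (q, s, 3) := by
      intro p q s h
      have h1 : rot.SameCycle ((p, s, 3) : Flag t) (turn s p, s, 3) := hone _
      rcases eq_of_rep_eq h with rfl | rfl | rfl
      · exact Equiv.Perm.SameCycle.rfl
      · exact h1
      · exact h1.trans (hone _)
    obtain ⟨p, s, k⟩ := d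
    obtain ⟨q, s', l⟩ := e
    intro h
    have hl : ∀ (p : Torus t) s k, k ≠ 3 → src (p, s, k) = Sum.inl p := by
      intro p s k hk
      fin_cases k
      · rfl
      · rfl
      · rfl
      · exact absurd rfl hk
    by_cases hk : k = 3 <;> by_cases hl' : l = 3
    · subst hk hl'
      simp only [src, Sum.inr.injEq, Prod.mk.injEq] at h
      obtain ⟨rfl, h⟩ := h
      exact h3 p q s h
    · subst hk
      rw [hl q s' l hl'] at h
      simp [src] at h
    · subst hl'
      rw [hl p s k hk] at h
      simp [src] at h
    · rw [hl p s k hk, hl q s' l hl'] at h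
      obtain rfl := Sum.inl.inj h
      exact (h0 p s k hk).symm.trans (h0 p s' l hl')

/-- The rotation about the hexagons. -/
def hexPerm : Equiv.Perm (Torus t) := (turn true).trans (turn false)

lemma hexPerm_three (p : Torus t) : hexPerm (hexPerm (hexPerm p)) = p := by
  simp only [hexPerm, Equiv.trans_apply, turn_false_true, turn_true_false]
  ext <;> simp only [Prod.fst_add, Prod.snd_add] <;> ring

lemma hexPerm_eq_iff (p : Torus t) : hexPerm p = p ↔ IsApex ((turn true).symm.symm p) := by
  rw [Equiv.symm_symm, IsApex, hexPerm, Equiv.trans_apply, (turn true).apply_eq_iff_eq]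

-- The permutation has order three on 9t² points and three fixed points, in bijection with the
-- digons by `turn true`: (9t² + 6) / 3 orbits.
open Classical in
lemma le_orbitCount_hexPerm [NeZero t] :
    3 * t ^ 2 + 2 ≤ CombMap.orbitCount (hexPerm (t := t)) := by
  have h := CombMap.card_add_le_orbitCount (hexPerm_three (t := t))
  have h3 : #{p : Torus t | hexPerm p = p} = 3 :=
    (card_equiv (turn true) (by simp [hexPerm_eq_iff])).trans card_isApex
  rw [card_torus] at h
  have h4 : ∀ n m : ℕ, n = m → 9 * t ^ 2 + 2 * n ≤ 3 * CombMap.orbitCount (hexPerm (t := t)) →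
      m = 3 → 3 * t ^ 2 + 2 ≤ CombMap.orbitCount (hexPerm (t := t)) := by
    intro n m h1 h2 h3
    omega
  refine h4 _ _ ?_ h h3
  congr!

/-- The face of the full map to the left of a flag. -/
def faceOf : Flag t →
    (Torus t × Bool) ⊕ Quotient (Equiv.Perm.SameCycle.setoid (hexPerm (t := t)))
  | (p, s, 2) => Sum.inl (p, s)
  | (p, s, 1) => Sum.inl (turn s p, s)
  | (p, s, 3) => Sum.inl (p, s)
  | (p, true, 0) => Sum.inr (Quotient.mk _ p)
  | (p, false, 0) => Sum.inr (Quotient.mk _ ((turn true).symm p))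

lemma faceOf_face (d : Flag t) : faceOf (edgePerm.trans rot d) = faceOf d := by
  obtain ⟨p, s, k⟩ := d
  rw [Equiv.trans_apply, edgePerm_apply]
  fin_cases k
  · cases s
    · refine congrArg Sum.inr (Quotient.sound (s := Equiv.Perm.SameCycle.setoid _) ?_)
      refine Equiv.Perm.SameCycle.symm ⟨1, ?_⟩
      rw [zpow_one, hexPerm, Equiv.trans_apply, Equiv.apply_symm_apply]
    · refine congrArg Sum.inr (congrArg _ ?_)
      exact (turn true).symm_apply_apply p
  · rfl
  · exact congrArg (fun q => Sum.inl (q, s)) ((turn s).apply_symm_apply p)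
  · rfl

lemma faceOf_surjective : Function.Surjective (faceOf (t := t)) := by
  rintro (⟨p, s⟩ | q)
  · exact ⟨(p, s, 2), rfl⟩
  · induction q using Quotient.inductionOn with
    | h p => exact ⟨(p, true, 0), rfl⟩

lemma edgePerm_ne (d : Flag t) : edgePerm d ≠ d := by
  obtain ⟨p, s, k⟩ := d
  rw [edgePerm_apply]
  intro h
  have h2 := congrArg (fun x : Flag t => x.2.2) h
  fin_cases k <;> simp [rev] at h2

/-- The rotations act transitively. -/
lemma eq_of_turn_invariant [NeZero t] {X : Type*} {f : Torus t → X}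
    (hf : ∀ s p, f (turn s p) = f p) (p q : Torus t) : f p = f q := by
  have h1 : ∀ p : Torus t, f (p + (1, 0)) = f p := by
    intro p
    rw [← hf true, ← hf false p]
    congr 1
    ext
    · simp [turn_true, turn_false]
    · simp [turn_true, turn_false]
      ring
  have h2 : ∀ p : Torus t, f (p + (0, 1)) = f p := by
    intro p
    obtain ⟨p, rfl⟩ := (turn false).surjective p
    rw [hf false, ← hf true p]
    congr 1
    ext <;> simp [turn_true, turn_false]
  have h1' : ∀ (n : ℕ) (p : Torus t), f (p + n • (1, 0)) = f p := by
    intro n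
    induction n with
    | zero => simp
    | succ n ih => intro p; rw [succ_nsmul, ← add_assoc, h1, ih]
  have h2' : ∀ (n : ℕ) (p : Torus t), f (p + n • (0, 1)) = f p := by
    intro n
    induction n with
    | zero => simp
    | succ n ih => intro p; rw [succ_nsmul, ← add_assoc, h2, ih]
  rw [← h1' (q.1 - p.1).val, ← h2' (q.2 - p.2).val]
  congr 1
  ext <;> simp

lemma eq_of_mem_invFun [NeZero t] {x : Flag t → ℚ}
    (hx : x ∈ CombMap.invFun edgePerm ⊓ CombMap.invFun rot) (d e : Flag t) : x d = x e := by
  obtain ⟨hα, hσ⟩ := Submodule.mem_inf.mp hx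
  have hsrc : ∀ d e, src d = src e → x d = x e := fun d e h =>
    (CombMap.invFun_sameCycle hσ (sameCycle_rot_iff.mpr h)).symm
  have hturn : ∀ s (p : Torus t), x (turn s p, true, 0) = x (p, true, 0) := by
    intro s p
    rw [hsrc (turn s p, true, 0) (turn s p, s, 2) rfl, hsrc (p, true, 0) (p, s, 0) rfl]
    exact hα (p, s, 0)
  have key : ∀ d : Flag t, x d = x (d.1, true, 0) := by
    rintro ⟨p, s, k⟩
    fin_cases k
    · exact hsrc _ _ rfl
    · exact hsrc _ _ rfl
    · exact hsrc _ _ rfl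
    · exact (hα (p, s, 1)).trans (hsrc _ _ rfl)
  rw [key d, key e]
  exact eq_of_turn_invariant (f := fun p => x (p, true, 0)) hturn d.1 e.1

/-- There are 72t² flags, 36t² edges, at least 15t² vertices, and at least 18t² triangles plus 3t² +
2 hexagons and digons, which attains Euler's bound. The digons give parallel edges, so this is a map
on flags and not a rotation system of a simple graph. -/
lemma flat_flag [NeZero t] : CombMap.Flat (edgePerm (t := t)) rot := by
  classical
  refine CombMap.flat_of_le _ _ edgePerm_edgePerm ?_
  have hcard : Fintype.card (Flag t) = 72 * t ^ 2 := by
    have h := card_torus (t := t)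
    rw [Fintype.card_prod, h, Fintype.card_prod, Fintype.card_bool, Fintype.card_fin]
    ring
  have hface : 18 * t ^ 2 + (3 * t ^ 2 + 2) ≤
      CombMap.orbitCount ((edgePerm (t := t)).trans rot) := by
    have := Fintype.ofFinite (Quotient (Equiv.Perm.SameCycle.setoid (hexPerm (t := t))))
    have h := CombMap.le_orbitCount faceOf faceOf_face (faceOf_surjective (t := t))
    rw [Fintype.card_sum, Fintype.card_prod, card_torus, Fintype.card_bool,
      ← Nat.card_eq_fintype_card] at h
    have h2 := le_orbitCount_hexPerm (t := t)
    rw [CombMap.orbitCount] at h2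
    omega
  have hvert : 15 * t ^ 2 ≤ CombMap.orbitCount (rot (t := t)) := by
    have h := CombMap.le_orbitCount (X := Torus t ⊕ (Bool × {c : Torus t // cls c = 0}))
      (fun d : Flag t => Sum.map id (fun x : Bool × Torus t => (x.1, ⟨rep x.1 x.2, cls_rep _ _⟩))
        (src d)) (fun d => congrArg _ (src_rot d)) (by
        rintro (p | ⟨s, c, hc⟩)
        · exact ⟨(p, true, 0), rfl⟩
        · refine ⟨(c, s, 3), ?_⟩
          simp [src, rep_of_cls hc])
    have h1 := card_torus (t := t)
    rw [Fintype.card_sum, h1, Fintype.card_prod, Fintype.card_bool, Fintype.card_subtype] at h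
    have h2 : #{c : Torus t | cls c = 0} = 3 * t ^ 2 := by rw [← card_cls_eq_zero]
    omega
  have hedge := CombMap.orbitCount_involutive (edgePerm_edgePerm (t := t)) edgePerm_ne
  rw [hcard] at hedge
  rw [hcard, CombMap.finrank_inf_eq_one _ _ fun x hx => eq_of_mem_invFun hx]
  omega

end Lattice

/-! ### The extremal graph as a submap -/

namespace Lattice

open Finset

variable {t : ℕ}

/-- The flags that remain after deleting the centres of the blocks at the digons and one side of
every digon. -/
def Chosen : Flag t → Prop
  | (p, s, 0) => s = false → ¬ IsApex p
  | (p, s, 1) => ¬ IsApex (rep s p)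
  | (p, s, 2) => s = false → ¬ IsApex ((turn s).symm p)
  | (p, s, 3) => ¬ IsApex (rep s p)

lemma Chosen.rev {d : Flag t} (h : Chosen d) : Chosen (rev d) := by
  obtain ⟨p, s, k⟩ := d
  fin_cases k
  · intro hs
    rw [Equiv.symm_apply_apply]
    exact h hs
  · exact h
  · exact h
  · exact h

lemma Chosen.valid {d : Flag t} (h : Chosen d) : Valid (src d) := by
  obtain ⟨p, s, k⟩ := d
  fin_cases k
  · trivial
  · trivial
  · trivial
  · exact ⟨cls_rep s p, h⟩

lemma block_src (d : Flag t) : block d.2.1 (src d) = some (rep d.2.1 d.1) := by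
  obtain ⟨p, s, k⟩ := d
  fin_cases k
  · rfl
  · rfl
  · rfl
  · exact block_inr.mpr ⟨rfl, rfl⟩

lemma rep_turn_symm (s : Bool) (p : Torus t) : rep s ((turn s).symm p) = rep s p := by
  rw [← rep_turn s ((turn s).symm p), Equiv.apply_symm_apply]

lemma block_src_rev (d : Flag t) : block d.2.1 (src (rev d)) = some (rep d.2.1 d.1) := by
  obtain ⟨p, s, k⟩ := d
  fin_cases k
  · exact block_inl.mpr (rep_turn s p)
  · exact block_inr.mpr ⟨rfl, rfl⟩
  · exact block_inl.mpr (rep_turn_symm s p)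
  · exact block_inl.mpr rfl

lemma src_rev_ne (d : Flag t) : src d ≠ src (rev d) := by
  obtain ⟨p, s, k⟩ := d
  fin_cases k
  · exact fun h => turn_ne s p (Sum.inl.inj h).symm
  · exact Sum.inl_ne_inr
  · refine fun h => turn_ne s p ?_
    rw [Equiv.eq_symm_apply (turn s) |>.mp (Sum.inl.inj h)]
  · exact Sum.inr_ne_inl

/-- The dart of the extremal graph given by a chosen flag. -/
noncomputable def flagDart (d : {d : Flag t // Chosen d}) : (extremal t).Dart :=
  ⟨(⟨src d.1, d.2.valid⟩, ⟨src (rev d.1), d.2.rev.valid⟩),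
    fun h => src_rev_ne d.1 (congrArg Subtype.val h), d.1.2.1, rep d.1.2.1 d.1.1, block_src d.1,
    block_src_rev d.1⟩

lemma not_isApex_of_turn_symm_eq {s s' : Bool} {p : Torus t} (h0 : s = false → ¬ IsApex p)
    (h2 : s' = false → ¬ IsApex ((turn s').symm p)) : turn s p ≠ (turn s').symm p := by
  intro h
  have h1 : turn s' (turn s p) = p := by rw [h, Equiv.apply_symm_apply]
  cases s <;> cases s'
  · exact turn_turn_ne false p h1
  · exact h0 rfl h1
  · refine h2 rfl ?_
    rw [IsApex, Equiv.apply_symm_apply, h]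
  · exact turn_turn_ne true p h1

lemma turn_injective_left {s s' : Bool} {p : Torus t} (h : turn s p = turn s' p) : s = s' := by
  cases s <;> cases s'
  · rfl
  · exact absurd h.symm (turn_true_ne_false p)
  · exact absurd h (turn_true_ne_false p)
  · rfl

lemma turn_symm_injective_left {s s' : Bool} {p : Torus t}
    (h : (turn s).symm p = (turn s').symm p) : s = s' := by
  refine turn_injective_left (p := (turn s).symm p) ?_
  rw [Equiv.apply_symm_apply, h, Equiv.apply_symm_apply]

/-- Parallel edges of the full map occur only at digons, and there only the side of kind `true` is
chosen. -/
lemma eq_of_src_eq {d e : Flag t} (hd : Chosen d) (he : Chosen e) (h1 : src d = src e)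
    (h2 : src (rev d) = src (rev e)) : d = e := by
  obtain ⟨p, s, k⟩ := d
  obtain ⟨q, s', l⟩ := e
  fin_cases k <;> fin_cases l <;> simp only [src, rev, Sum.inl.injEq, Sum.inr.injEq,
    Prod.mk.injEq, reduceCtorEq] at h1 h2
  · obtain rfl := h1
    obtain rfl := turn_injective_left h2
    rfl
  · obtain rfl := h1
    exact absurd h2 (not_isApex_of_turn_symm_eq hd he)
  · obtain rfl := h1
    obtain ⟨rfl, -⟩ := h2
    rfl
  · obtain rfl := h1
    exact absurd h2.symm (not_isApex_of_turn_symm_eq he hd)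
  · obtain rfl := h1
    obtain rfl := turn_symm_injective_left h2
    rfl
  · obtain rfl := h2
    obtain ⟨rfl, -⟩ := h1
    rfl

lemma flagDart_injective : Function.Injective (flagDart (t := t)) := by
  rintro ⟨d, hd⟩ ⟨e, he⟩ h
  have h' := congrArg (fun a : (extremal t).Dart => a.toProd) h
  exact Subtype.ext (eq_of_src_eq hd he (congrArg (fun x => x.1.1) h')
    (congrArg (fun x => x.2.1) h'))

lemma exists_chosen {u v : Site t} (hu : Valid u) (hv : Valid v) (hne : u ≠ v) {s : Bool}
    {c : Torus t} (h1 : block s u = some c) (h2 : block s v = some c) :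
    ∃ d, Chosen d ∧ src d = u ∧ src (rev d) = v := by
  rcases u with p | ⟨s', c'⟩ <;> rcases v with q | ⟨s'', c''⟩
  · rw [block_inl] at h1 h2
    have hpq : p ≠ q := fun h => hne (by rw [h])
    rcases alternating hpq (h1.trans h2.symm) with rfl | rfl
    -- On a digon the deleted side of kind `false` is replaced by the parallel side of kind `true`,
    -- which runs in the opposite sense.
    · by_cases h : s = false ∧ IsApex p
      · refine ⟨(p, true, 2), fun h => absurd h (by decide), rfl, congrArg Sum.inl ?_⟩
        rw [Equiv.symm_apply_eq, h.1]
        exact h.2.symm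
      · exact ⟨(p, s, 0), fun h1 h2 => h ⟨h1, h2⟩, rfl, rfl⟩
    · by_cases h : s = false ∧ IsApex q
      · refine ⟨(turn s q, true, 0), fun h => absurd h (by decide), rfl, congrArg Sum.inl ?_⟩
        rw [h.1]
        exact h.2
      · refine ⟨(turn s q, s, 2), fun h1 h2 => h ⟨h1, ?_⟩, rfl, congrArg Sum.inl ?_⟩
        · rwa [Equiv.symm_apply_apply] at h2
        · exact Equiv.symm_apply_apply _ _
  · rw [block_inl] at h1
    rw [block_inr] at h2
    obtain ⟨rfl, rfl⟩ := h2
    exact ⟨(p, s, 1), fun h => hv.2 (h1 ▸ h), rfl, congrArg (fun c => Sum.inr (s, c)) h1⟩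
  · rw [block_inr] at h1
    rw [block_inl] at h2
    obtain ⟨rfl, rfl⟩ := h1
    exact ⟨(q, s, 3), fun h => hu.2 (h2 ▸ h), congrArg (fun c => Sum.inr (s, c)) h2, rfl⟩
  · rw [block_inr] at h1 h2
    exact absurd (by rw [← h1.1, ← h2.1, h1.2, h2.2]) hne

lemma flagDart_surjective : Function.Surjective (flagDart (t := t)) := by
  rintro ⟨⟨⟨u, hu⟩, ⟨v, hv⟩⟩, hne, s, c, h1, h2⟩
  obtain ⟨d, hd, rfl, rfl⟩ := exists_chosen hu hv (fun h => hne (Subtype.ext h)) h1 h2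
  exact ⟨⟨d, hd⟩, rfl⟩

/-- The chosen flags correspond to the darts. -/
noncomputable def flagEquiv : {d : Flag t // Chosen d} ≃ (extremal t).Dart :=
  Equiv.ofBijective flagDart ⟨flagDart_injective, flagDart_surjective⟩

instance [NeZero t] : Finite (extremal t).Dart := Finite.of_equiv _ flagEquiv

lemma exists_isFlat_extremal [NeZero t] [Fintype (extremal t).Dart] :
    ∃ R : SimpleGraph.RotationSystem (extremal t), R.IsFlat := by
  refine SimpleGraph.RotationSystem.exists_isFlat_of_embedding (flat_flag (t := t))
    edgePerm_edgePerm (fun d => (flagEquiv.symm d).1)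
    (Subtype.val_injective.comp flagEquiv.symm.injective) ?_ ?_
  · intro d
    obtain ⟨⟨d, hd⟩, rfl⟩ := flagEquiv.surjective d
    have h : (flagEquiv ⟨d, hd⟩).symm = flagEquiv ⟨rev d, hd.rev⟩ := by
      ext1
      refine Prod.ext rfl (Subtype.ext ?_)
      exact congrArg src (rev_involutive d).symm
    rw [h, Equiv.symm_apply_apply, Equiv.symm_apply_apply]
    rfl
  · intro d e
    obtain ⟨⟨d, hd⟩, rfl⟩ := flagEquiv.surjective d
    obtain ⟨⟨e, he⟩, rfl⟩ := flagEquiv.surjective e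
    rw [Equiv.symm_apply_apply, Equiv.symm_apply_apply, sameCycle_rot_iff]
    exact ⟨fun h => Subtype.ext h, fun h => congrArg Subtype.val h⟩

open Classical in
-- The deleted flags are 2 for each of the three digons and 6 for each of the six missing centres: 6
-- + 36 = 42.
lemma card_chosen [NeZero t] : #{d : Flag t | Chosen d} + 42 = 72 * t ^ 2 := by
  have h0 := card_torus (t := t)
  have h1 := card_not_isApex (t := t)
  have h2 := card_not_isApex_symm (t := t) false
  have h3 : ∀ s, #{p : Torus t | ¬ IsApex (rep s p)} + 9 = 9 * t ^ 2 := by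
    intro s
    have h4 := card_centre (t := t)
    have h5 : #{p : Torus t | ¬ IsApex (rep s p)} = 3 * #{c : Torus t | cls c = 0 ∧ ¬ IsApex c} := by
      convert card_filter_rep (t := t) s fun c => ¬ IsApex c
    omega
  have h3t := h3 true
  have h3f := h3 false
  have hsum : #{d : Flag t | Chosen d} = ∑ p : Torus t, ∑ s : Bool, ∑ k : Fin 4,
      if Chosen (p, s, k) then 1 else 0 := by
    rw [card_filter, Fintype.sum_prod_type]
    exact sum_congr rfl fun p _ => Fintype.sum_prod_type _
  have hterm : ∀ p : Torus t, (∑ s : Bool, ∑ k : Fin 4, if Chosen (p, s, k) then 1 else 0) =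
      2 + (if ¬ IsApex p then 1 else 0) + (if ¬ IsApex ((turn false).symm p) then 1 else 0) +
      2 * (if ¬ IsApex (rep true p) then 1 else 0) +
      2 * (if ¬ IsApex (rep false p) then 1 else 0) := by
    intro p
    rw [Fintype.sum_bool, Fin.sum_univ_four, Fin.sum_univ_four]
    by_cases h1 : IsApex p <;> by_cases h2 : IsApex ((turn false).symm p) <;>
      by_cases h3 : IsApex (rep true p) <;> by_cases h4 : IsApex (rep false p) <;>
      simp [Chosen, h1, h2, h3, h4]
  rw [hsum, sum_congr rfl fun p _ => hterm p]
  simp only [sum_add_distrib, ← mul_sum, ← card_filter, sum_const, card_univ, h0, smul_eq_mul]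
  omega

lemma ncard_edgeSet_extremal [NeZero t] : (extremal t).edgeSet.ncard = 36 * t ^ 2 - 21 := by
  classical
  have := Fintype.ofFinite (extremal t).Dart
  have h1 := SimpleGraph.RotationSystem.card_dart (G := extremal t)
  rw [← Fintype.card_congr flagEquiv, Fintype.card_subtype] at h1
  have h2 : #{d : Flag t | Chosen d} + 42 = 72 * t ^ 2 := by rw [← card_chosen]
  omega

lemma card_vert [NeZero t] : Nat.card (Vert t) = 15 * t ^ 2 - 6 := by
  classical
  have h0 := card_torus (t := t)
  have h1 : #{c : Torus t | cls c = 0 ∧ ¬ IsApex c} + 3 = 3 * t ^ 2 := by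
    rw [← card_centre]
  rw [Nat.card_eq_fintype_card, Fintype.card_subtype, card_filter, Fintype.sum_sum_type,
    Fintype.sum_prod_type (fun x : Bool × Torus t => _), Fintype.sum_bool]
  have h2 : (∑ p : Torus t, if Valid (Sum.inl p) then 1 else 0) = 9 * t ^ 2 := by
    rw [sum_congr rfl fun p _ => if_pos (show Valid (Sum.inl p) from trivial), sum_const,
      card_univ, h0, smul_eq_mul, mul_one]
  have h3 : ∀ s, (∑ c : Torus t, if Valid (Sum.inr (s, c)) then 1 else 0) =
      #{c : Torus t | cls c = 0 ∧ ¬ IsApex c} := by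
    intro s
    rw [card_filter]
    congr!
  rw [h2, h3, h3]
  omega

end Lattice

/-! ### Deleting a vertex, and transport along isomorphisms -/

namespace SimpleGraph

variable {V W : Type*} {G : SimpleGraph V} {H : SimpleGraph W}

/-- A walk through `x` enters and leaves by neighbours of `x`, so connections between these
neighbours repair it. -/
lemma connected_induce_compl {x y : V} (hG : G.Connected) (hxy : y ≠ x)
    (hx : ∀ u v : V, ∀ hu : u ≠ x, ∀ hv : v ≠ x, G.Adj x u → G.Adj x v →
      (G.induce {x}ᶜ).Reachable ⟨u, hu⟩ ⟨v, hv⟩) : (G.induce {x}ᶜ).Connected := by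
  have key : ∀ {u w : V} (_ : G.Walk u w) (hw : w ≠ x),
      (∀ hu : u ≠ x, (G.induce {x}ᶜ).Reachable ⟨u, hu⟩ ⟨w, hw⟩) ∧
      (u = x → ∀ (n : V) (hn : n ≠ x), G.Adj x n →
        (G.induce {x}ᶜ).Reachable ⟨n, hn⟩ ⟨w, hw⟩) := by
    intro u w p hw
    induction p with
    | nil => exact ⟨fun _ => Reachable.refl _, fun h => absurd h hw⟩
    | @cons u v w hadj p ih =>
      obtain ⟨ih1, ih2⟩ := ih hw
      constructor
      · intro hu
        by_cases hv : v = x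
        · exact ih2 hv u hu (hv ▸ hadj.symm)
        · have h1 : (G.induce {x}ᶜ).Adj ⟨u, hu⟩ ⟨v, hv⟩ := hadj
          exact h1.reachable.trans (ih1 hv)
      · rintro rfl n hn hadj'
        exact (hx n v hn hadj.ne' hadj' hadj).trans (ih1 hadj.ne')
  have : Nonempty ({x}ᶜ : Set V) := ⟨⟨y, hxy⟩⟩
  refine ⟨fun a b => ?_⟩
  obtain ⟨p⟩ := hG.preconnected a.1 b.1
  exact (key p b.2).1 a.2

lemma free_of_noFiveCycle (h : G.NoFiveCycle) : (cycleGraph 5).Free G := by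
  rintro ⟨f⟩
  have hadj : ∀ i j : Fin 5, (cycleGraph 5).Adj i j → G.Adj (f i) (f j) := fun i j hij =>
    f.toHom.map_adj hij
  have hne : ∀ i j : Fin 5, i ≠ j → f i ≠ f j := fun i j hij h => hij (f.injective h)
  refine h (f 0) (f 1) (f 2) (f 3) (f 4) (hadj _ _ ?_) (hadj _ _ ?_) (hadj _ _ ?_) (hadj _ _ ?_)
    (hadj _ _ ?_) (hne _ _ (by decide)) (hne _ _ (by decide)) (hne _ _ (by decide))
    (hne _ _ (by decide)) (hne _ _ (by decide)) <;> rw [cycleGraph_adj] <;> decide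

lemma IsTwoConnected.of_iso [Finite V] [Finite W] (e : G ≃g H) (h : G.IsTwoConnected) :
    H.IsTwoConnected := by
  refine ⟨?_, e.connected_iff.mp h.2.1, fun w => ?_⟩
  · rw [← Nat.card_congr e.toEquiv]
    exact h.1
  · obtain ⟨v, rfl⟩ := e.surjective w
    refine (Iso.connected_iff (e.induce (s := {v}ᶜ) (t := {e v}ᶜ) ?_)).mp (h.2.2 v)
    exact Set.BijOn.compl (Set.bijOn_singleton.mpr rfl) e.bijective

lemma MinDegreeAtLeast.of_iso [Finite V] [Finite W] {k : ℕ} (e : G ≃g H)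
    (h : G.MinDegreeAtLeast k) : H.MinDegreeAtLeast k := by
  intro w
  obtain ⟨v, rfl⟩ := e.surjective w
  refine (h v).trans_eq ?_
  rw [← Nat.card_coe_set_eq, ← Nat.card_coe_set_eq]
  exact Nat.card_congr (e.mapNeighborSet v)

lemma ncard_edgeSet_congr (e : G ≃g H) : H.edgeSet.ncard = G.edgeSet.ncard := by
  rw [← Nat.card_coe_set_eq, ← Nat.card_coe_set_eq]
  exact (Nat.card_congr e.mapEdgeSet).symm

lemma IsFlat.isPlanar [Finite V] (h : G.IsFlat) (hc : G.Connected) [Nonempty G.Dart] :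
    G.IsPlanar := by
  have := Fintype.ofFinite V
  obtain ⟨_, R, hR⟩ := h
  exact ⟨R, hR.isSpherical hc⟩

lemma IsFlat.of_iso [Finite W] (e : H ≃g G) (h : G.IsFlat) : H.IsFlat := by
  classical
  have := Fintype.ofFinite W
  obtain ⟨_, R, hR⟩ := h
  have := Fintype.ofFinite H.Dart
  refine ⟨this, RotationSystem.exists_isFlat_of_embedding hR RotationSystem.flip_flip
    (fun d => e.toHom.mapDart d) ?_ ?_ ?_⟩
  · intro d d' hd
    have h1 := congrArg (fun a : G.Dart => a.toProd) hd
    ext1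
    exact Prod.ext (e.injective (congrArg Prod.fst h1)) (e.injective (congrArg Prod.snd h1))
  · intro d
    rfl
  · intro d d'
    rw [R.sameCycle_next_iff]
    exact e.injective.eq_iff

end SimpleGraph

/-! ### Two-connectedness and minimum degree of the extremal graph -/

namespace Lattice

open SimpleGraph

variable {t : ℕ}

/-- A lattice point as a vertex of the extremal graph. -/
def pt (p : Torus t) : Vert t := ⟨Sum.inl p, trivial⟩

lemma pt_injective : Function.Injective (pt (t := t)) := fun _ _ h =>
  Sum.inl.inj (congrArg Subtype.val h)

lemma adj_turn (s : Bool) (p : Torus t) : (extremal t).Adj (pt p) (pt (turn s p)) :=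
  ⟨fun h => turn_ne s p (pt_injective h).symm, s, rep s p, block_inl.mpr rfl,
    block_inl.mpr (rep_turn s p)⟩

lemma adj_turn_turn (s : Bool) (p : Torus t) :
    (extremal t).Adj (pt p) (pt (turn s (turn s p))) := by
  have h := adj_turn s (turn s (turn s p))
  rw [turn_three] at h
  exact h.symm

lemma adj_centre {s : Bool} {c : Torus t} (h : Valid (Sum.inr (s, c))) {p : Torus t}
    (hp : rep s p = c) : (extremal t).Adj ⟨Sum.inr (s, c), h⟩ (pt p) :=
  ⟨fun h => Sum.inr_ne_inl (congrArg Subtype.val h), s, c, block_inr.mpr ⟨rfl, rfl⟩,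
    block_inl.mpr hp⟩

lemma connected_extremal [NeZero t] : (extremal t).Connected := by
  have h1 : ∀ p q : Torus t, (extremal t).Reachable (pt p) (pt q) := by
    intro p q
    rw [← ConnectedComponent.eq]
    refine eq_of_turn_invariant (f := fun p => (extremal t).connectedComponentMk (pt p))
      (fun s p => ?_) p q
    exact ConnectedComponent.eq.mpr (adj_turn s p).reachable.symm
  have h2 : ∀ u : Vert t, ∃ p, (extremal t).Reachable u (pt p) := by
    rintro ⟨p | ⟨s, c⟩, hu⟩
    · exact ⟨p, Reachable.refl _⟩
    · exact ⟨c, (adj_centre hu (rep_of_cls hu.1)).reachable⟩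
  have : Nonempty (Vert t) := ⟨pt 0⟩
  refine ⟨fun u v => ?_⟩
  obtain ⟨p, hp⟩ := h2 u
  obtain ⟨q, hq⟩ := h2 v
  exact hp.trans ((h1 p q).trans hq.symm)

/-- Reachability in the graph without `x`. -/
def Avoids (x u v : Vert t) : Prop :=
  ∃ (hu : u ≠ x) (hv : v ≠ x), ((extremal t).induce {x}ᶜ).Reachable ⟨u, hu⟩ ⟨v, hv⟩

lemma Avoids.of_block {x u v : Vert t} {s : Bool} {c : Torus t} (hu : u ≠ x) (hv : v ≠ x)
    (h1 : block s u.1 = some c) (h2 : block s v.1 = some c) : Avoids x u v := by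
  refine ⟨hu, hv, ?_⟩
  by_cases h : u = v
  · subst h
    exact Reachable.refl _
  · have hadj : ((extremal t).induce {x}ᶜ).Adj ⟨u, hu⟩ ⟨v, hv⟩ := ⟨h, s, c, h1, h2⟩
    exact hadj.reachable

lemma Avoids.trans {x u v w : Vert t} (h1 : Avoids x u v) (h2 : Avoids x v w) : Avoids x u w := by
  obtain ⟨hu, hv, h1⟩ := h1
  obtain ⟨_, hw, h2⟩ := h2
  exact ⟨hu, hw, h1.trans h2⟩

lemma Avoids.symm {x u v : Vert t} (h : Avoids x u v) : Avoids x v u := by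
  obtain ⟨hu, hv, h⟩ := h
  exact ⟨hv, hu, h.symm⟩

lemma avoids_turn {p q : Torus t} (s : Bool) (h1 : q ≠ p) (h2 : turn s q ≠ p) :
    Avoids (pt p) (pt q) (pt (turn s q)) :=
  Avoids.of_block (s := s) (c := rep s q) (fun h => h1 (pt_injective h))
    (fun h => h2 (pt_injective h)) (block_inl.mpr rfl) (block_inl.mpr (rep_turn s q))

/-- The two blocks at `p` stay connected around the far side of a hexagon through `p`. At a digon
they share a second point. -/
lemma avoids_false_true (p : Torus t) :
    Avoids (pt p) (pt (turn false p)) (pt (turn true p)) := by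
  have hinv : Avoids (pt p) (pt (turn true (turn true p))) (pt (turn true p)) :=
    (avoids_turn true (turn_ne true p) (turn_turn_ne true p)).symm
  by_cases hp : IsApex p
  · have h : turn false p = turn true (turn true p) := by
      rw [← turn_symm, Equiv.eq_symm_apply]
      exact hp
    rwa [h]
  -- The cube of the composition is the identity: five alternating steps from `p` reach its other
  -- neighbour on the hexagon.
  have hcycle : turn false (turn true (turn false (turn true (turn false p)))) =
      turn true (turn true p) := by
    rw [← turn_symm, Equiv.eq_symm_apply, turn_true_false, turn_true_false, turn_true_false]
    ext <;> simp only <;> ring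
  have n3 : turn false (turn true (turn false p)) ≠ p := by
    intro h
    have h := congrArg cls h
    simp only [cls_turn, sgn] at h
    generalize cls p = c at h
    revert h
    revert c
    decide
  have n4 : turn true (turn false (turn true (turn false p))) ≠ p := by
    intro h
    have h2 := congrArg (turn true) hcycle
    rw [h, turn_three] at h2
    exact hp h2
  have a1 := avoids_turn true (turn_ne false p) hp
  have a2 := avoids_turn false hp n3
  have a3 := avoids_turn true n3 n4
  have a4 := avoids_turn false n4 (by rw [hcycle]; exact turn_turn_ne true p)
  rw [hcycle] at a4
  exact a1.trans (a2.trans (a3.trans (a4.trans hinv)))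

lemma isTwoConnected_extremal [NeZero t] : (extremal t).IsTwoConnected := by
  refine ⟨?_, connected_extremal, fun x => ?_⟩
  · have : 1 ≤ t ^ 2 := Nat.one_le_pow _ _ (Nat.pos_of_ne_zero (NeZero.ne t))
    rw [card_vert]
    omega
  obtain ⟨y, hy⟩ : ∃ y : Vert t, y ≠ x := by
    by_cases h : pt 0 = x
    · exact ⟨pt (turn true 0), fun h' => turn_ne true 0 (pt_injective (h'.trans h.symm))⟩
    · exact ⟨_, h⟩
  refine connected_induce_compl connected_extremal hy fun u v hu hv h1 h2 => ?_
  obtain ⟨-, s, c, h1x, h1u⟩ := h1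
  obtain ⟨-, s', c', h2x, h2v⟩ := h2
  suffices Avoids x u v from this.2.2
  by_cases hs : s = s'
  · subst hs
    obtain rfl := block_unique h1x h2x
    exact Avoids.of_block hu hv h1u h2v
  obtain ⟨p, hp, hps, hps'⟩ := exists_inl hs h1x h2x
  obtain rfl : x = pt p := Subtype.ext hp
  have hmid : Avoids (pt p) (pt (turn s p)) (pt (turn s' p)) := by
    have h := avoids_false_true p
    cases s <;> cases s'
    · exact absurd rfl hs
    · exact h
    · exact h.symm
    · exact absurd rfl hs
  have hturn : ∀ b, pt (turn b p) ≠ pt p := fun b h => turn_ne b p (pt_injective h)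
  have hu' := Avoids.of_block hu (hturn s) h1u (block_inl.mpr ((rep_turn s p).trans hps))
  have hv' := Avoids.of_block hv (hturn s') h2v (block_inl.mpr ((rep_turn s' p).trans hps'))
  exact hu'.trans (hmid.trans hv'.symm)

lemma three_le_ncard_neighborSet [NeZero t] {u a b c : Vert t} (ha : (extremal t).Adj u a)
    (hb : (extremal t).Adj u b) (hc : (extremal t).Adj u c) (hab : a ≠ b) (hac : a ≠ c)
    (hbc : b ≠ c) : 3 ≤ ((extremal t).neighborSet u).ncard := by
  have h : ({a, b, c} : Set (Vert t)).ncard = 3 :=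
    Set.ncard_eq_three.mpr ⟨a, b, c, hab, hac, hbc, rfl⟩
  rw [← h]
  refine Set.ncard_le_ncard ?_ (Set.toFinite _)
  rintro x (rfl | rfl | rfl)
  · exact ha
  · exact hb
  · exact hc

lemma minDegreeAtLeast_extremal [NeZero t] : (extremal t).MinDegreeAtLeast 3 := by
  have hne : ∀ {p q : Torus t}, p ≠ q → pt p ≠ pt q := fun h h' => h (pt_injective h')
  rintro ⟨p | ⟨s, c⟩, hu⟩
  · have h1 : pt (turn true p) ≠ pt (turn true (turn true p)) := hne (turn_ne _ _).symm
    by_cases h : turn true (turn true p) = turn false p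
    -- At a digon one neighbour in the block of kind `false` coincides with one of kind `true`; the
    -- other is new.
    · refine three_le_ncard_neighborSet (adj_turn true p) (adj_turn_turn true p)
        (adj_turn_turn false p) h1 (hne ?_) (hne ?_)
      · intro h2
        refine turn_comm_ne p ?_
        rw [h2, turn_three, ← h, turn_three]
      · rw [h]
        exact (turn_ne _ _).symm
    · exact three_le_ncard_neighborSet (adj_turn true p) (adj_turn_turn true p)
        (adj_turn false p) h1 (hne (turn_true_ne_false p)) (hne h)
  · have hc := rep_of_cls (s := s) hu.1
    refine three_le_ncard_neighborSet (adj_centre hu hc)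
      (adj_centre hu ((rep_turn s c).trans hc))
      (adj_centre hu ((rep_turn s _).trans ((rep_turn s c).trans hc)))
      (hne (turn_ne _ _).symm) (hne (turn_turn_ne _ _).symm) (hne (turn_ne _ _).symm)

lemma exists_extremal (n : ℕ) (hn : 1 ≤ n) : ∃ G : SimpleGraph (Fin (15 * n ^ 2 - 6)),
    G.IsPlanar ∧ (cycleGraph 5).Free G ∧ G.IsTwoConnected ∧ G.MinDegreeAtLeast 3 ∧
      G.edgeSet.ncard = 36 * n ^ 2 - 21 := by
  classical
  have : NeZero n := ⟨by omega⟩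
  have e : Fin (15 * n ^ 2 - 6) ≃ Vert n := (Finite.equivFinOfCardEq card_vert).symm
  have i : (extremal n).comap e ≃g extremal n := Iso.comap e _
  have hfin : Fintype (extremal n).Dart := Fintype.ofFinite _
  have h2 := isTwoConnected_extremal.of_iso i.symm
  have : Nonempty ((extremal n).comap e).Dart :=
    ⟨i.symm.toHom.mapDart ⟨(pt 0, pt (turn true 0)), adj_turn true 0⟩⟩
  refine ⟨(extremal n).comap e, (IsFlat.of_iso i ⟨hfin, exists_isFlat_extremal⟩).isPlanar h2.2.1,
    ?_, h2, minDegreeAtLeast_extremal.of_iso i.symm, ?_⟩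
  · rw [free_congr_right i]
    exact free_of_noFiveCycle extremal_noFiveCycle
  · rw [ncard_edgeSet_congr i.symm, ncard_edgeSet_extremal]

end Lattice
-- The main theorem
theorem mainTheorem6 :
    -- the planar Turán number of the cycle of length 5
    (∀ n : ℕ, 11 ≤ n →
      (SimpleGraph.planarTuranNumber n (SimpleGraph.cycleGraph 5) : ℝ) ≤ (12 * (n : ℝ) - 33) / 5) ∧
    -- the same bound, for every graph
    (∀ (V : Type*) [Finite V] (G : SimpleGraph V), 11 ≤ Nat.card V →
      G.IsPlanar → (SimpleGraph.cycleGraph 5).Free G →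
        (G.edgeSet.ncard : ℝ) ≤ (12 * (Nat.card V : ℝ) - 33) / 5) ∧
    -- the 2-connected core case
    (∀ (V : Type*) [Finite V] (G : SimpleGraph V), 11 ≤ Nat.card V →
      G.IsPlanar → (SimpleGraph.cycleGraph 5).Free G → G.IsTwoConnected → G.MinDegreeAtLeast 3 →
        (G.edgeSet.ncard : ℝ) ≤ (12 * (Nat.card V : ℝ) - 33) / 5) ∧
    -- the extremal construction
    (∀ t : ℕ, 1 ≤ t → ∃ G : SimpleGraph (Fin (15 * t ^ 2 - 6)),
      G.IsPlanar ∧ (SimpleGraph.cycleGraph 5).Free G ∧ G.IsTwoConnected ∧ G.MinDegreeAtLeast 3 ∧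
        G.edgeSet.ncard = 36 * t ^ 2 - 21 ∧
        (G.edgeSet.ncard : ℝ) = (12 * ((15 * t ^ 2 - 6 : ℕ) : ℝ) - 33) / 5) := by
  refine ⟨fun n hn => ?_, ?_, ?_, fun t ht => ?_⟩
  · have h : (5 * SimpleGraph.planarTuranNumber n (SimpleGraph.cycleGraph 5) + 33 : ℝ) ≤ 12 * n := by
      exact_mod_cast SimpleGraph.planarTuranNumber_bound hn
    rw [le_div_iff₀ (by norm_num)]
    linarith
  · intro V _ G hn hG hfree
    have h : (5 * G.edgeSet.ncard + 33 : ℝ) ≤ 12 * Nat.card V := by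
      exact_mod_cast hG.edge_bound hn hfree
    rw [le_div_iff₀ (by norm_num)]
    linarith
  · intro V _ G hn hG hfree _ _
    have h : (5 * G.edgeSet.ncard + 33 : ℝ) ≤ 12 * Nat.card V := by
      exact_mod_cast hG.edge_bound hn hfree
    rw [le_div_iff₀ (by norm_num)]
    linarith
  · obtain ⟨G, h1, h2, h3, h4, h5⟩ := Lattice.exists_extremal t ht
    refine ⟨G, h1, h2, h3, h4, h5, ?_⟩
    -- This keeps the subtractions in ℕ from truncating.
    have h6 : 1 ≤ t ^ 2 := Nat.one_le_pow _ _ ht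
    have h7 : 5 * (36 * t ^ 2 - 21) + 33 = 12 * (15 * t ^ 2 - 6) := by omega
    have h8 : (5 * (36 * t ^ 2 - 21 : ℕ) + 33 : ℝ) = 12 * ((15 * t ^ 2 - 6 : ℕ) : ℝ) := by
      exact_mod_cast h7
    rw [h5, eq_div_iff (by norm_num)]
    linarith
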